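/- Let $p(y_1,y_2|x)$ be a two-receiver discrete memoryless broadcast channel with finite alphabets $\mathcal X,\mathcal Y_1,\mathcal Y_2$. A code of length $n$ has an encoder $(m_0,m_1,m_2)\mapsto x^n$ for message sets of sizes $M_0,M_1,M_2$; receiver $1$ estimates $(m_0,m_1)$ from $y_1^n$, receiver $2$ estimates $(m_0,m_2)$ from $y_2^n$. A triple $(R_0,R_1,R_2)$ of nonnegative reals is achievable if for every $\varepsilon>0$ and all large $n$ there is a code with $M_k\ge e^{nR_k}$ ($k=0,1,2$) for which the probability, for independent uniform messages, that some receiver errs is at most $\varepsilon$. The capacity region is the closure of the set of achievable triples. Mutual informations are in nats and take values in $[0,\infty]$. Consider all random variables $T,U,V,W_1,W_2$ (real-valued, with arbitrary distributions), $X\in\mathcal X$, $Y_1\in\mathcal Y_1$, $Y_2\in\mathcal Y_2$ such that $(T,U,V,W_1,W_2)\to X\to(Y_1,Y_2)$ is a Markov chain with $(Y_1,Y_2)$ given $X$ distributed according to $p(y_1,y_2|x)$, such that $T,U,V$ are mutually independent, and such that the following equalities hold: (1) $$I(T;Y_1|W_1)=I(T;Y_2|W_2),$$ $$I(T;Y_1|W_1)=I(T;Y_1|V,W_1)=I(T;Y_1|U,W_1)=I(T;Y_1|U,V,W_1),$$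 $$I(T;Y_2|W_2)=I(T;Y_2|V,W_2)=I(T;Y_2|U,W_2)=I(T;Y_2|U,V,W_2),$$ $$I(U;Y_1|W_1)=I(U;Y_1|V,W_1)=I(U;Y_1|T,W_1)=I(U;Y_1|T,V,W_1),$$ $$I(V;Y_2|W_2)=I(V;Y_2|U,W_2)=I(V;Y_2|T,W_2)=I(V;Y_2|T,U,W_2);$$ (2) for all $A\subseteq\{T,U,V\}$, $B_1\subseteq\{T,U\}$, $B_2\subseteq\{T,V\}$, $$I(B_1;B_2|A,W_1,W_2,Y_1)=I(B_1;B_2|A,W_1,W_2,Y_2),$$ and also, so that this equality keeps its content when both sides are infinite (it is equivalent to it when $I(B_1;B_2|A,W_1,W_2)<\infty$), $$I(B_1;Y_1|A,B_2,W_1,W_2)-I(B_1;Y_1|A,W_1,W_2)=I(B_1;Y_2|A,B_2,W_1,W_2)-I(B_1;Y_2|A,W_1,W_2);$$ (3) for all $A\subseteq\{T,U,V\}$, $$I(W_2;Y_1|A,W_1)=I(W_1;Y_2|A,W_2).$$ Then the union, over all such random variables, of the sets of nonnegative triples $(R_0,R_1,R_2)$ with $$R_0\le\min\{I(T;Y_1|W_1),I(T;Y_2|W_2)\},\qquad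 R_1\le I(U;Y_1|W_1),\qquad R_2\le I(V;Y_2|W_2)$$ contains the capacity region of the channel. Further, the capacity region is still contained in this union if it is restricted to those random variables for which $X$ is a deterministic function of $(T,U,V,W_1,W_2)$ and $T$, $U$, $V$ are each uniformly distributed (on $[0,1]$). -/

import Mathlib

open MeasureTheory ProbabilityTheory
open scoped ENNReal

namespace BroadcastOuter

noncomputable section

/-! ### Conditional mutual information -/

/-- Conditional mutual information `I(A;B|C)` in nats, with values in `[0,∞]`, of random variables
on `(Ω, μ)`: the relative entropy of the joint law of `(C,(A,B))` with respect to the law under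
which `C` has its own distribution and, given `C`, `A` and `B` are independent with their
conditional distributions given `C`. -/
def condMI {Ω α β γ : Type*} [MeasurableSpace Ω]
    [MeasurableSpace α] [StandardBorelSpace α] [Nonempty α]
    [MeasurableSpace β] [StandardBorelSpace β] [Nonempty β]
    [MeasurableSpace γ]
    (μ : Measure Ω) [IsFiniteMeasure μ] (A : Ω → α) (B : Ω → β) (C : Ω → γ) : ℝ≥0∞ :=
  InformationTheory.klDiv (μ.map fun ω => (C ω, (A ω, B ω)))
    (μ.map C ⊗ₘ (condDistrib A C μ ×ₖ condDistrib B C μ))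

/-! ### The discrete memoryless broadcast channel -/

section Channel

variable {𝒳 𝒴₁ 𝒴₂ : Type*} [MeasurableSpace 𝒳] [MeasurableSpace 𝒴₁] [MeasurableSpace 𝒴₂]

/-- A block code of length `n` with `M₀` common messages and `M₁`, `M₂` private messages. Receiver
`k` estimates the common message and its own private message. -/
structure Code (𝒳 𝒴₁ 𝒴₂ : Type*) (n M₀ M₁ M₂ : ℕ) where
  enc : Fin M₀ × Fin M₁ × Fin M₂ → Fin n → 𝒳
  dec₁ : (Fin n → 𝒴₁) → Fin M₀ × Fin M₁
  dec₂ : (Fin n → 𝒴₂) → Fin M₀ × Fin M₂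

/-- The set of output blocks on which some receiver errs when `m` has been sent. -/
def Code.errorSet {n M₀ M₁ M₂ : ℕ} (c : Code 𝒳 𝒴₁ 𝒴₂ n M₀ M₁ M₂)
    (m : Fin M₀ × Fin M₁ × Fin M₂) : Set (Fin n → 𝒴₁ × 𝒴₂) :=
  {y | c.dec₁ (fun i => (y i).1) ≠ (m.1, m.2.1) ∨ c.dec₂ (fun i => (y i).2) ≠ (m.1, m.2.2)}

/-- Average error probability over independent uniform messages, for `n` memoryless uses of the
channel `κ`. -/
def Code.errorProb (κ : Kernel 𝒳 (𝒴₁ × 𝒴₂)) {n M₀ M₁ M₂ : ℕ} (c : Code 𝒳 𝒴₁ 𝒴₂ n M₀ M₁ M₂) : ℝ :=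
  (∑ m : Fin M₀ × Fin M₁ × Fin M₂,
    (Measure.pi fun i => κ (c.enc m i)).real (c.errorSet m)) / ((M₀ : ℝ) * M₁ * M₂)

/-- `(R₀,R₁,R₂)` is achievable (rates in nats per channel use): for every `ε > 0` and every large
block length `n` there is a code with at least `exp (n R_k)` messages of kind `k`, `k = 0, 1, 2`,
and average error probability at most `ε`. -/
def Achievable (κ : Kernel 𝒳 (𝒴₁ × 𝒴₂)) (R : ℝ × ℝ × ℝ) : Prop :=
  0 ≤ R.1 ∧ 0 ≤ R.2.1 ∧ 0 ≤ R.2.2 ∧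
  ∀ ε : ℝ, 0 < ε → ∃ N : ℕ, ∀ n : ℕ, N ≤ n → ∃ (M₀ M₁ M₂ : ℕ) (c : Code 𝒳 𝒴₁ 𝒴₂ n M₀ M₁ M₂),
    Real.exp (n * R.1) ≤ M₀ ∧ Real.exp (n * R.2.1) ≤ M₁ ∧ Real.exp (n * R.2.2) ≤ M₂ ∧
    c.errorProb κ ≤ ε

/-- The capacity region: the closure of the set of achievable rate triples. -/
def capacityRegion (κ : Kernel 𝒳 (𝒴₁ × 𝒴₂)) : Set (ℝ × ℝ × ℝ) :=
  closure {R | Achievable κ R}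

end Channel

/-! ### The outer bound -/

/-- Names of the three independent auxiliary random variables. -/
inductive Label
  | t
  | u
  | v
  deriving DecidableEq

/-- The family `(T, U, V)` indexed by names. -/
def family {Ω : Type*} (T U V : Ω → ℝ) : Label → Ω → ℝ
  | Label.t => T
  | Label.u => U
  | Label.v => V

/-- The subtuple of `(T, U, V)` consisting of the variables named in `A`. -/
def sub {Ω : Type*} (T U V : Ω → ℝ) (A : Finset Label) : Ω → (A → ℝ) :=
  fun ω i => family T U V i ω

section Region

variable {𝒳 𝒴₁ 𝒴₂ : Type*}
  [Fintype 𝒳] [MeasurableSpace 𝒳] [MeasurableSingletonClass 𝒳]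
  [Fintype 𝒴₁] [Nonempty 𝒴₁] [MeasurableSpace 𝒴₁] [MeasurableSingletonClass 𝒴₁]
  [Fintype 𝒴₂] [Nonempty 𝒴₂] [MeasurableSpace 𝒴₂] [MeasurableSingletonClass 𝒴₂]

/-- The conditions on `(T,U,V,W₁,W₂,X,Y₁,Y₂)` in the outer bound for the channel `κ`. -/
structure Admissible (κ : Kernel 𝒳 (𝒴₁ × 𝒴₂)) {Ω : Type} [MeasurableSpace Ω] (μ : Measure Ω)
    [IsFiniteMeasure μ] (T U V W₁ W₂ : Ω → ℝ) (X : Ω → 𝒳) (Y₁ : Ω → 𝒴₁) (Y₂ : Ω → 𝒴₂) : Prop where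
  measurable_T : Measurable T
  measurable_U : Measurable U
  measurable_V : Measurable V
  measurable_W₁ : Measurable W₁
  measurable_W₂ : Measurable W₂
  measurable_X : Measurable X
  measurable_Y₁ : Measurable Y₁
  measurable_Y₂ : Measurable Y₂
  /-- `(T,U,V,W₁,W₂) → X → (Y₁,Y₂)` is a Markov chain whose last transition is the channel. -/
  markov : μ.map (fun ω => (((T ω, U ω, V ω, W₁ ω, W₂ ω), X ω), (Y₁ ω, Y₂ ω))) =
    μ.map (fun ω => ((T ω, U ω, V ω, W₁ ω, W₂ ω), X ω)) ⊗ₘ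
      Kernel.prodMkLeft (ℝ × ℝ × ℝ × ℝ × ℝ) κ
  /-- `T`, `U`, `V` are mutually independent. -/
  indep : iIndepFun (family T U V) μ
  T_Y₁_eq_T_Y₂ : condMI μ T Y₁ W₁ = condMI μ T Y₂ W₂
  T_Y₁_V : condMI μ T Y₁ W₁ = condMI μ T Y₁ (fun ω => (V ω, W₁ ω))
  T_Y₁_U : condMI μ T Y₁ W₁ = condMI μ T Y₁ (fun ω => (U ω, W₁ ω))
  T_Y₁_UV : condMI μ T Y₁ W₁ = condMI μ T Y₁ (fun ω => (U ω, V ω, W₁ ω))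
  T_Y₂_V : condMI μ T Y₂ W₂ = condMI μ T Y₂ (fun ω => (V ω, W₂ ω))
  T_Y₂_U : condMI μ T Y₂ W₂ = condMI μ T Y₂ (fun ω => (U ω, W₂ ω))
  T_Y₂_UV : condMI μ T Y₂ W₂ = condMI μ T Y₂ (fun ω => (U ω, V ω, W₂ ω))
  U_Y₁_V : condMI μ U Y₁ W₁ = condMI μ U Y₁ (fun ω => (V ω, W₁ ω))
  U_Y₁_T : condMI μ U Y₁ W₁ = condMI μ U Y₁ (fun ω => (T ω, W₁ ω))
  U_Y₁_TV : condMI μ U Y₁ W₁ = condMI μ U Y₁ (fun ω => (T ω, V ω, W₁ ω))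
  V_Y₂_U : condMI μ V Y₂ W₂ = condMI μ V Y₂ (fun ω => (U ω, W₂ ω))
  V_Y₂_T : condMI μ V Y₂ W₂ = condMI μ V Y₂ (fun ω => (T ω, W₂ ω))
  V_Y₂_TU : condMI μ V Y₂ W₂ = condMI μ V Y₂ (fun ω => (T ω, U ω, W₂ ω))
  /-- `I(B₁;B₂|A,W₁,W₂,Y₁) = I(B₁;B₂|A,W₁,W₂,Y₂)`, an equality in `[0,∞]`. -/
  sub_sub : ∀ A B₁ B₂ : Finset Label,
    B₁ ⊆ {Label.t, Label.u} → B₂ ⊆ {Label.t, Label.v} →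
    condMI μ (sub T U V B₁) (sub T U V B₂) (fun ω => (sub T U V A ω, W₁ ω, W₂ ω, Y₁ ω)) =
    condMI μ (sub T U V B₁) (sub T U V B₂) (fun ω => (sub T U V A ω, W₁ ω, W₂ ω, Y₂ ω))
  /-- The same equality in a form that keeps its content when both sides of `sub_sub` are infinite.
  By the chain rule, `I(B₁;B₂|A,W,Y) + I(B₁;Y|A,W) = I(B₁;B₂|A,W) + I(B₁;Y|A,B₂,W)`, so for finite
  `I(B₁;B₂|A,W)` it is equivalent to `sub_sub`. All four terms are finite. -/
  sub_sub' : ∀ A B₁ B₂ : Finset Label,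
    B₁ ⊆ {Label.t, Label.u} → B₂ ⊆ {Label.t, Label.v} →
    condMI μ (sub T U V B₁) Y₁ (fun ω => (sub T U V (A ∪ B₂) ω, W₁ ω, W₂ ω)) +
      condMI μ (sub T U V B₁) Y₂ (fun ω => (sub T U V A ω, W₁ ω, W₂ ω)) =
    condMI μ (sub T U V B₁) Y₂ (fun ω => (sub T U V (A ∪ B₂) ω, W₁ ω, W₂ ω)) +
      condMI μ (sub T U V B₁) Y₁ (fun ω => (sub T U V A ω, W₁ ω, W₂ ω))
  /-- `I(W₂;Y₁|A,W₁) = I(W₁;Y₂|A,W₂)`. -/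
  W_Y : ∀ A : Finset Label,
    condMI μ W₂ Y₁ (fun ω => (sub T U V A ω, W₁ ω)) =
    condMI μ W₁ Y₂ (fun ω => (sub T U V A ω, W₂ ω))

/-- The rate constraints given by `(T,U,V,W₁,W₂,Y₁,Y₂)`. -/
def RateBounds {Ω : Type} [MeasurableSpace Ω] (μ : Measure Ω) [IsFiniteMeasure μ]
    (T U V W₁ W₂ : Ω → ℝ) (Y₁ : Ω → 𝒴₁) (Y₂ : Ω → 𝒴₂) (R : ℝ × ℝ × ℝ) : Prop :=
  0 ≤ R.1 ∧ 0 ≤ R.2.1 ∧ 0 ≤ R.2.2 ∧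
  ENNReal.ofReal R.1 ≤ min (condMI μ T Y₁ W₁) (condMI μ T Y₂ W₂) ∧
  ENNReal.ofReal R.2.1 ≤ condMI μ U Y₁ W₁ ∧
  ENNReal.ofReal R.2.2 ≤ condMI μ V Y₂ W₂

/-- The outer region: the union of the rate constraints over all admissible random variables. -/
def outerRegion (κ : Kernel 𝒳 (𝒴₁ × 𝒴₂)) : Set (ℝ × ℝ × ℝ) :=
  {R | ∃ (Ω : Type) (_ : MeasurableSpace Ω) (μ : Measure Ω) (_ : IsProbabilityMeasure μ)
      (T U V W₁ W₂ : Ω → ℝ) (X : Ω → 𝒳) (Y₁ : Ω → 𝒴₁) (Y₂ : Ω → 𝒴₂),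
      Admissible κ μ T U V W₁ W₂ X Y₁ Y₂ ∧ RateBounds μ T U V W₁ W₂ Y₁ Y₂ R}

/-- The same union restricted to the admissible random variables such that `T`, `U`, `V` are
uniformly distributed (on the unit interval) and `X` is a deterministic function of
`(T,U,V,W₁,W₂)`. -/
def restrictedOuterRegion (κ : Kernel 𝒳 (𝒴₁ × 𝒴₂)) : Set (ℝ × ℝ × ℝ) :=
  {R | ∃ (Ω : Type) (_ : MeasurableSpace Ω) (μ : Measure Ω) (_ : IsProbabilityMeasure μ)
      (T U V W₁ W₂ : Ω → ℝ) (X : Ω → 𝒳) (Y₁ : Ω → 𝒴₁) (Y₂ : Ω → 𝒴₂),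
      Admissible κ μ T U V W₁ W₂ X Y₁ Y₂ ∧ RateBounds μ T U V W₁ W₂ Y₁ Y₂ R ∧
      μ.map T = volume.restrict (Set.Icc 0 1) ∧
      μ.map U = volume.restrict (Set.Icc 0 1) ∧
      μ.map V = volume.restrict (Set.Icc 0 1) ∧
      ∃ f : ℝ × ℝ × ℝ × ℝ × ℝ → 𝒳, Measurable f ∧ ∀ ω, X ω = f (T ω, U ω, V ω, W₁ ω, W₂ ω)}

end Region

end

end BroadcastOuter

/-!
Given a good code, let `T`, `U`, `V` be the three messages, let `Yᵢ`, `X` be the letters at a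
uniformly random time `i`, and let `W₁` be the past of the first output sequence and `W₂` the future
of the second one. By Fano's inequality each receiver's messages cost almost no entropy given its
own output sequence, and the telescoping sum behind Csiszár's identity turns this into the equations
of the outer bound up to an error that vanishes with the block length.

The alphabets of these variables grow with the block length, so the limit is taken on their
*profile*: the joint law of the input letter and of the conditional probabilities of the output
letters given each set `S` of auxiliary variables. It is a probability measure on a fixed compact
space, it determines all entropies in the equations, and the property of being a profile (each
conditional probability is a conditional expectation given the coordinates visible from its set) is
closed under weak convergence.

A limit profile is no longer attached to random variables, and it is realized by secret sharing:
the coordinate belonging to `S` is encrypted by one-time pads on the circle whose shares are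
distributed over the members of `S`. Whoever holds all of `S` recovers the coordinate, while for
anyone else the shares are independent uniform noise. As `T`, `U`, `V` hold nothing but pads, they
are independent and uniform.
-/

namespace BroadcastOuter

noncomputable section

/-! ### Invariance and chain rules of conditional mutual information -/

section CondMI

open InformationTheory Function

lemma klDiv_map_of_leftInverse {α β : Type*} [MeasurableSpace α] [MeasurableSpace β]
    {f : α → β} {g : β → α} (hf : Measurable f) (hg : Measurable g) (hgf : LeftInverse g f)
    (μ ν : Measure α) [IsFiniteMeasure μ] [IsFiniteMeasure ν] :
    klDiv (μ.map f) (ν.map f) = klDiv μ ν := by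
  refine le_antisymm (klDiv_map_le μ ν hf) ?_
  simpa only [Measure.map_map hg hf, hgf.comp_eq_id, Measure.map_id] using
    klDiv_map_le (μ.map f) (ν.map f) hg

lemma map_compProd_of_leftInverse {α α' β : Type*} [MeasurableSpace α] [MeasurableSpace α']
    [MeasurableSpace β] {f : α → α'} {g : α' → α} (hf : Measurable f) (hg : Measurable g)
    (hgf : LeftInverse g f) (μ : Measure α) [SFinite μ] (κ : Kernel α β) [IsSFiniteKernel κ] :
    (μ ⊗ₘ κ).map (fun p => (f p.1, p.2)) = μ.map f ⊗ₘ κ.comap g hg := by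
  ext s hs
  rw [Measure.map_apply (by fun_prop) hs, Measure.compProd_apply (hs.preimage (by fun_prop)),
    Measure.compProd_apply hs, lintegral_map (Kernel.measurable_kernel_prodMk_left hs) hf]
  simp only [Kernel.comap_apply, hgf _]
  rfl

lemma compProd_prod_map_prodAssoc_symm {α β γ : Type*} [MeasurableSpace α]
    [MeasurableSpace β] [MeasurableSpace γ] (ν : Measure γ) (κ : Kernel γ α)
    [IsSFiniteKernel κ] (η : Kernel γ β) [IsSFiniteKernel η] :
    (ν ⊗ₘ (κ ×ₖ η)).map MeasurableEquiv.prodAssoc.symm = (ν ⊗ₘ κ) ⊗ₘ Kernel.prodMkRight α η := by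
  have hprod : κ ×ₖ η = κ ⊗ₖ Kernel.prodMkRight α η := by
    ext c s hs
    rw [Kernel.prod_apply, Kernel.compProd_apply hs, Measure.prod_apply hs]
    rfl
  rw [hprod, Measure.compProd_assoc]

lemma ae_map_prodMk_of_ae_map {Ω α γ : Type*} [MeasurableSpace Ω] [MeasurableSpace α]
    [MeasurableSpace γ] {μ : Measure Ω} {C : Ω → γ} {A : Ω → α} (hC : Measurable C)
    (hA : Measurable A) {p : γ → Prop} (h : ∀ᵐ c ∂μ.map C, p c) :
    ∀ᵐ q ∂μ.map fun ω => (C ω, A ω), p q.1 := by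
  refine ae_of_ae_map measurable_fst.aemeasurable ?_
  rwa [Measure.map_map measurable_fst (by fun_prop)]

variable {Ω α β δ γ γ' : Type*} [MeasurableSpace Ω]
  [MeasurableSpace α] [StandardBorelSpace α] [Nonempty α]
  [MeasurableSpace β] [StandardBorelSpace β] [Nonempty β]
  [MeasurableSpace δ] [StandardBorelSpace δ] [Nonempty δ]
  [MeasurableSpace γ] [MeasurableSpace γ']
  {μ : Measure Ω} [IsFiniteMeasure μ] {A : Ω → α} {B : Ω → β} {D : Ω → δ} {C : Ω → γ}

lemma condDistrib_comp_of_leftInverse {f : γ → γ'} {g : γ' → γ} (hf : Measurable f)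
    (hg : Measurable g) (hgf : LeftInverse g f) (hA : Measurable A) (hC : Measurable C) :
    condDistrib A (f ∘ C) μ =ᵐ[μ.map (f ∘ C)] (condDistrib A C μ).comap g hg := by
  refine condDistrib_ae_eq_of_measure_eq_compProd _ hA.aemeasurable ?_
  rw [← Measure.map_map hf hC, ← map_compProd_of_leftInverse hf hg hgf,
    compProd_map_condDistrib hA.aemeasurable, Measure.map_map (by fun_prop) (by fun_prop)]
  rfl

lemma condMI_comp_of_leftInverse {f : γ → γ'} {g : γ' → γ} (hf : Measurable f)
    (hg : Measurable g) (hgf : LeftInverse g f) (hA : Measurable A) (hB : Measurable B)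
    (hC : Measurable C) :
    condMI μ A B (f ∘ C) = condMI μ A B C := by
  have hker : condDistrib A (f ∘ C) μ ×ₖ condDistrib B (f ∘ C) μ
      =ᵐ[μ.map (f ∘ C)] (condDistrib A C μ ×ₖ condDistrib B C μ).comap g hg := by
    filter_upwards [condDistrib_comp_of_leftInverse (μ := μ) hf hg hgf hA hC,
      condDistrib_comp_of_leftInverse (μ := μ) hf hg hgf hB hC] with c hcA hcB
    simp only [Kernel.prod_apply, Kernel.comap_apply, hcA, hcB]
  have hlaw : μ.map (fun ω => ((f ∘ C) ω, (A ω, B ω)))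
      = (μ.map fun ω => (C ω, (A ω, B ω))).map (fun p => (f p.1, p.2)) := by
    rw [Measure.map_map (by fun_prop) (by fun_prop)]
    rfl
  rw [condMI, condMI, Measure.compProd_congr hker, hlaw, ← Measure.map_map hf hC,
    ← map_compProd_of_leftInverse hf hg hgf]
  exact klDiv_map_of_leftInverse (g := fun p => (g p.1, p.2)) (by fun_prop) (by fun_prop)
    (fun p => Prod.ext (hgf p.1) rfl) _ _

lemma condMI_eq_klDiv_compProd_prodMkRight (hA : Measurable A) (hB : Measurable B)
    (hC : Measurable C) :
    condMI μ A B C = klDiv (μ.map fun ω => ((C ω, A ω), B ω))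
      ((μ.map fun ω => (C ω, A ω)) ⊗ₘ Kernel.prodMkRight α (condDistrib B C μ)) := by
  have hlaw : μ.map (fun ω => ((C ω, A ω), B ω))
      = (μ.map fun ω => (C ω, (A ω, B ω))).map MeasurableEquiv.prodAssoc.symm := by
    rw [Measure.map_map (by fun_prop) (by fun_prop)]
    rfl
  rw [← compProd_map_condDistrib hA.aemeasurable, ← compProd_prod_map_prodAssoc_symm, hlaw, condMI]
  exact (klDiv_map_of_leftInverse (MeasurableEquiv.measurable _)
    MeasurableEquiv.prodAssoc.measurable MeasurableEquiv.prodAssoc.apply_symm_apply _ _).symm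

lemma condMI_comp_right_of_leftInverse {f : β → δ} {g : δ → β} (hf : Measurable f)
    (hg : Measurable g) (hgf : LeftInverse g f) (hA : Measurable A) (hB : Measurable B)
    (hC : Measurable C) :
    condMI μ A (f ∘ B) C = condMI μ A B C := by
  have hker : Kernel.prodMkRight α (condDistrib (f ∘ B) C μ)
      =ᵐ[μ.map fun ω => (C ω, A ω)] (Kernel.prodMkRight α (condDistrib B C μ)).map f := by
    filter_upwards [ae_map_prodMk_of_ae_map hC hA
      (condDistrib_comp (μ := μ) C hB.aemeasurable hf)] with p hp
    rw [Kernel.prodMkRight_apply, hp, Kernel.map_apply _ hf, Kernel.map_apply _ hf,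
      Kernel.prodMkRight_apply]
  have hlaw : μ.map (fun ω => ((C ω, A ω), f (B ω)))
      = (μ.map fun ω => ((C ω, A ω), B ω)).map (Prod.map id f) := by
    rw [Measure.map_map (by fun_prop) (by fun_prop)]
    rfl
  rw [condMI_eq_klDiv_compProd_prodMkRight hA (hf.comp hB) hC,
    condMI_eq_klDiv_compProd_prodMkRight hA hB hC, Measure.compProd_congr hker,
    Measure.compProd_map hf]
  exact hlaw ▸ klDiv_map_of_leftInverse (measurable_id.prodMap hf) (measurable_id.prodMap hg)
    (fun p => Prod.ext rfl (hgf p.2)) _ _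

lemma condDistrib_prodMk_ae_eq (hB : Measurable B) (hD : Measurable D) (hC : Measurable C) :
    condDistrib (fun ω => (D ω, B ω)) C μ =ᵐ[μ.map C]
      condDistrib D C μ ⊗ₖ condDistrib B (fun ω => (C ω, D ω)) μ := by
  refine condDistrib_ae_eq_of_measure_eq_compProd _ (by fun_prop) ?_
  rw [← Measure.compProd_assoc', compProd_map_condDistrib hD.aemeasurable,
    compProd_map_condDistrib hB.aemeasurable, Measure.map_map (by fun_prop) (by fun_prop)]
  rfl

/-- The conditional distribution of `B` given `(C, D)`, as a kernel from the values of `((C, A), D)`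
that ignores `A`. -/
def condDistribIgnoring (B : Ω → β) (D : Ω → δ) (α : Type*) [MeasurableSpace α] (C : Ω → γ)
    (μ : Measure Ω) [IsFiniteMeasure μ] : Kernel ((γ × α) × δ) β :=
  (condDistrib B (fun ω => (C ω, D ω)) μ).comap (fun p => (p.1.1, p.2)) (by fun_prop)

omit [StandardBorelSpace α] [Nonempty α] [StandardBorelSpace δ] [Nonempty δ] in
instance (B : Ω → β) (D : Ω → δ) (C : Ω → γ) :
    IsMarkovKernel (condDistribIgnoring B D α C μ) :=
  inferInstanceAs (IsMarkovKernel (Kernel.comap _ _ _))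

omit [StandardBorelSpace α] [Nonempty α] in
lemma prodMkRight_condDistrib_prodMk_ae_eq (hA : Measurable A) (hB : Measurable B)
    (hD : Measurable D) (hC : Measurable C) :
    Kernel.prodMkRight α (condDistrib (fun ω => (D ω, B ω)) C μ) =ᵐ[μ.map fun ω => (C ω, A ω)]
      Kernel.prodMkRight α (condDistrib D C μ) ⊗ₖ condDistribIgnoring B D α C μ := by
  filter_upwards [ae_map_prodMk_of_ae_map hC hA (condDistrib_prodMk_ae_eq (μ := μ) hB hD hC)]
    with p hp
  rw [Kernel.prodMkRight_apply, hp]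
  ext s hs
  rw [Kernel.compProd_apply hs, Kernel.compProd_apply hs]
  rfl

omit [StandardBorelSpace δ] [Nonempty δ] in
lemma condMI_eq_klDiv_compProd_condDistribIgnoring (hA : Measurable A) (hB : Measurable B)
    (hD : Measurable D) (hC : Measurable C) :
    condMI μ A B (fun ω => (C ω, D ω)) = klDiv (μ.map fun ω => (((C ω, A ω), D ω), B ω))
      ((μ.map fun ω => ((C ω, A ω), D ω)) ⊗ₘ condDistribIgnoring B D α C μ) := by
  let swap : (γ × α) × δ → (γ × δ) × α := fun p => ((p.1.1, p.2), p.1.2)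
  let swap' : (γ × δ) × α → (γ × α) × δ := fun p => ((p.1.1, p.2), p.1.2)
  have hswap : Measurable swap := by fun_prop
  have hswap' : Measurable swap' := by fun_prop
  rw [condMI_eq_klDiv_compProd_prodMkRight hA hB (hC.prodMk hD),
    ← klDiv_map_of_leftInverse (f := fun p : ((γ × α) × δ) × β => (swap p.1, p.2))
      (g := fun p => (swap' p.1, p.2)) (by fun_prop) (by fun_prop) (fun p => rfl),
    map_compProd_of_leftInverse hswap hswap' (fun p => rfl),
    Measure.map_map (by fun_prop) (by fun_prop), Measure.map_map (by fun_prop) (by fun_prop)]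
  rfl

lemma condMI_prodMk (hA : Measurable A) (hB : Measurable B) (hD : Measurable D)
    (hC : Measurable C) :
    condMI μ A (fun ω => (D ω, B ω)) C = condMI μ A D C + condMI μ A B (fun ω => (C ω, D ω)) := by
  have hlaw : μ.map (fun ω => ((C ω, A ω), (D ω, B ω)))
      = (μ.map fun ω => (((C ω, A ω), D ω), B ω)).map MeasurableEquiv.prodAssoc := by
    rw [Measure.map_map (by fun_prop) (by fun_prop)]
    rfl
  rw [condMI_eq_klDiv_compProd_prodMkRight hA (by fun_prop) hC,
    Measure.compProd_congr (prodMkRight_condDistrib_prodMk_ae_eq hA hB hD hC),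
    ← Measure.compProd_assoc', hlaw, klDiv_map_of_leftInverse MeasurableEquiv.prodAssoc.measurable
      MeasurableEquiv.prodAssoc.symm.measurable MeasurableEquiv.prodAssoc.symm_apply_apply,
    ← compProd_map_condDistrib hB.aemeasurable, klDiv_compProd_eq_add,
    ← condMI_eq_klDiv_compProd_prodMkRight hA hD hC, compProd_map_condDistrib hB.aemeasurable,
    ← condMI_eq_klDiv_compProd_condDistribIgnoring hA hB hD hC]

lemma condMI_add_condMI_comm (hA : Measurable A) (hB : Measurable B) (hD : Measurable D)
    (hC : Measurable C) :
    condMI μ A D C + condMI μ A B (fun ω => (C ω, D ω)) =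
      condMI μ A B C + condMI μ A D (fun ω => (C ω, B ω)) := by
  rw [← condMI_prodMk hA hB hD hC, ← condMI_prodMk hA hD hB hC]
  exact (condMI_comp_right_of_leftInverse (B := fun ω => (D ω, B ω)) measurable_swap
    measurable_swap Prod.swap_leftInverse hA (by fun_prop) hC).symm

end CondMI

/-! ### Conditional entropy of a finite-valued random variable -/

section KernelSingleton

variable {γ 𝒴 : Type*} [MeasurableSpace γ] [MeasurableSpace 𝒴] [MeasurableSingletonClass 𝒴]

lemma measurable_kernel_singleton [Countable 𝒴] (κ : Kernel γ 𝒴) :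
    Measurable fun p : γ × 𝒴 => κ p.1 {p.2} :=
  measurable_from_prod_countable_left fun y => Kernel.measurable_coe κ (measurableSet_singleton y)

lemma measurable_log_kernel_singleton [Countable 𝒴] (κ : Kernel γ 𝒴) :
    Measurable fun p : γ × 𝒴 => Real.log ((κ p.1).real {p.2}) :=
  (measurable_kernel_singleton κ).ennreal_toReal.log

lemma measurable_kernel_real_singleton (κ : Kernel γ 𝒴) (y : 𝒴) :
    Measurable fun c => (κ c).real {y} :=
  (Kernel.measurable_coe κ (measurableSet_singleton y)).ennreal_toReal

lemma ae_compProd_kernel_singleton_ne_zero [Countable 𝒴] (ν : Measure γ) [SFinite ν]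
    (κ : Kernel γ 𝒴) [IsSFiniteKernel κ] :
    ∀ᵐ p ∂(ν ⊗ₘ κ), κ p.1 {p.2} ≠ 0 := by
  refine (Measure.ae_compProd_iff (p := fun p => κ p.1 {p.2} ≠ 0)
    (measurable_kernel_singleton κ (measurableSet_singleton 0).compl)).2 (.of_forall fun c => ?_)
  rw [ae_iff_of_countable]
  exact fun _ hy => hy

lemma integrable_log_kernel_singleton [Finite 𝒴] (ν : Measure γ) [IsFiniteMeasure ν]
    (κ : Kernel γ 𝒴) [IsMarkovKernel κ] :
    Integrable (fun p : γ × 𝒴 => Real.log ((κ p.1).real {p.2})) (ν ⊗ₘ κ) := by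
  have := Fintype.ofFinite 𝒴
  have hnorm : ∀ c, ∫ y, ‖Real.log ((κ c).real {y})‖ ∂κ c
      = ∑ y, Real.negMulLog ((κ c).real {y}) := by
    intro c
    rw [integral_fintype .of_finite]
    refine Finset.sum_congr rfl fun y _ => ?_
    rw [Real.negMulLog, smul_eq_mul, Real.norm_of_nonpos
      (Real.log_nonpos measureReal_nonneg measureReal_le_one)]
    ring
  rw [Measure.integrable_compProd_iff (measurable_log_kernel_singleton κ).aestronglyMeasurable]
  refine ⟨.of_forall fun c => .of_finite, ?_⟩
  simp only [hnorm]
  refine integrable_finsetSum _ fun y _ => Integrable.of_bound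
    (Real.continuous_negMulLog.measurable.comp
      (measurable_kernel_real_singleton κ y)).aestronglyMeasurable 1 (.of_forall fun c => ?_)
  rw [Real.norm_of_nonneg (Real.negMulLog_nonneg measureReal_nonneg measureReal_le_one)]
  exact (Real.negMulLog_le_one_sub_self measureReal_nonneg).trans
    (sub_le_self 1 measureReal_nonneg)

lemma integral_log_kernel_singleton [Fintype 𝒴] (ν : Measure γ) [IsFiniteMeasure ν]
    (κ : Kernel γ 𝒴) [IsMarkovKernel κ] :
    ∫ p, Real.log ((κ p.1).real {p.2}) ∂(ν ⊗ₘ κ) =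
      -∫ c, ∑ y, Real.negMulLog ((κ c).real {y}) ∂ν := by
  rw [Measure.integral_compProd (integrable_log_kernel_singleton ν κ), ← integral_neg]
  congr 1 with c
  rw [integral_fintype .of_finite, ← Finset.sum_neg_distrib]
  exact Finset.sum_congr rfl fun y _ => by simp [Real.negMulLog]

variable [Countable 𝒴] {ν : Measure γ} [IsFiniteMeasure ν] {κ η : Kernel γ 𝒴} [IsMarkovKernel κ]
  [IsMarkovKernel η]

lemma compProd_eq_withDensity_div (h : ∀ᵐ c ∂ν, ∀ y, κ c {y} = 0 → η c {y} = 0) :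
    ν ⊗ₘ η = (ν ⊗ₘ κ).withDensity fun p => η p.1 {p.2} / κ p.1 {p.2} := by
  have hdiv : Measurable fun p : γ × 𝒴 => η p.1 {p.2} / κ p.1 {p.2} :=
    (measurable_kernel_singleton η).div (measurable_kernel_singleton κ)
  ext s hs
  rw [withDensity_apply _ hs, Measure.compProd_apply hs, ← lintegral_indicator hs,
    Measure.lintegral_compProd (hdiv.indicator hs)]
  refine lintegral_congr_ae ?_
  filter_upwards [h] with c hc
  rw [← lintegral_indicator_one (hs.preimage measurable_prodMk_left), lintegral_countable',
    lintegral_countable']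
  refine tsum_congr fun y => ?_
  by_cases hy : (c, y) ∈ s
  · rw [Set.indicator_of_mem (Set.mem_preimage.2 hy), Set.indicator_of_mem hy, Pi.one_apply,
      one_mul]
    exact (ENNReal.div_mul_cancel' (hc y) fun h => absurd h (measure_ne_top _ _)).symm
  · rw [Set.indicator_of_notMem (fun h => hy (Set.mem_preimage.1 h)), Set.indicator_of_notMem hy,
      zero_mul, zero_mul]

lemma llr_compProd_ae_eq (h : ∀ᵐ c ∂ν, ∀ y, κ c {y} = 0 → η c {y} = 0) :
    llr (ν ⊗ₘ η) (ν ⊗ₘ κ) =ᵐ[ν ⊗ₘ η] fun p =>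
      Real.log ((η p.1).real {p.2}) - Real.log ((κ p.1).real {p.2}) := by
  have hac : ν ⊗ₘ η ≪ ν ⊗ₘ κ :=
    compProd_eq_withDensity_div h ▸ withDensity_absolutelyContinuous _ _
  have hrn : _ =ᵐ[ν ⊗ₘ η] fun p => η p.1 {p.2} / κ p.1 {p.2} :=
    hac (Measure.rnDeriv_withDensity (ν ⊗ₘ κ)
      ((measurable_kernel_singleton η).div (measurable_kernel_singleton κ)))
  have hker : ∀ᵐ p ∂(ν ⊗ₘ η), ∀ y, κ p.1 {y} = 0 → η p.1 {y} = 0 :=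
    ae_of_ae_map measurable_fst.aemeasurable ((Measure.fst_compProd ν η).symm ▸ h)
  filter_upwards [hrn, ae_compProd_kernel_singleton_ne_zero ν η, hker] with p hp hη hκ
  rw [llr, compProd_eq_withDensity_div h, hp, ENNReal.toReal_div, Real.log_div]
  · rfl
  · exact (ENNReal.toReal_pos hη (measure_ne_top _ _)).ne'
  · exact (ENNReal.toReal_pos (fun h0 => hη (hκ _ h0)) (measure_ne_top _ _)).ne'

end KernelSingleton

section CondEntropy

open InformationTheory

/-- Conditional entropy `H(Y|m)` (in nats) of a finite-valued random variable given a `σ`-algebra.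
Conditioning on a `σ`-algebra rather than on a random variable identifies random variables that
carry the same information. -/
def condEntropy {Ω 𝒴 : Type*} [MeasurableSpace Ω] [Fintype 𝒴] (μ : Measure Ω) (Y : Ω → 𝒴)
    (m : MeasurableSpace Ω) : ℝ :=
  ∫ ω, ∑ y, Real.negMulLog ((μ⟦Y ⁻¹' {y} | m⟧) ω) ∂μ

variable {Ω α 𝒴 γ : Type*} [MeasurableSpace Ω] [MeasurableSpace α] [MeasurableSpace γ]
  [MeasurableSpace 𝒴] [MeasurableSingletonClass 𝒴] [Nonempty 𝒴]
  {μ : Measure Ω} [IsFiniteMeasure μ] {A : Ω → α} {Y : Ω → 𝒴} {C : Ω → γ}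

section Finite

variable [Finite 𝒴]

lemma integrable_log_condDistrib (hY : Measurable Y) (hC : Measurable C) :
    Integrable (fun ω => Real.log ((condDistrib Y C μ (C ω)).real {Y ω})) μ := by
  have h := integrable_log_kernel_singleton (μ.map C) (condDistrib Y C μ)
  rw [compProd_map_condDistrib hY.aemeasurable] at h
  exact h.comp_measurable (hC.prodMk hY)

lemma condDistrib_prodMk_singleton_eq_zero (hA : Measurable A) (hY : Measurable Y)
    (hC : Measurable C) :
    ∀ᵐ p ∂μ.map fun ω => (C ω, A ω), ∀ y, Kernel.prodMkRight α (condDistrib Y C μ) p {y} = 0 →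
      condDistrib Y (fun ω => (C ω, A ω)) μ p {y} = 0 := by
  refine ae_all_iff.2 fun y => ?_
  have hCA : Measurable fun ω => (C ω, A ω) := hC.prodMk hA
  have hy := measurableSet_singleton y
  let s : Set γ := {c | condDistrib Y C μ c {y} = 0}
  have hs : MeasurableSet s := Kernel.measurable_coe _ hy (measurableSet_singleton 0)
  have hnull : μ (C ⁻¹' s ∩ Y ⁻¹' {y}) = 0 := by
    rw [← setLIntegral_preimage_condDistrib hC hY.aemeasurable hy hs,
      setLIntegral_congr_fun (g := fun _ => 0) (hC hs) (fun ω hω => hω), lintegral_zero]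
  have hint : ∫⁻ p in Prod.fst ⁻¹' s, condDistrib Y (fun ω => (C ω, A ω)) μ p {y}
      ∂μ.map (fun ω => (C ω, A ω)) = 0 := by
    rw [setLIntegral_map (measurable_fst hs) (Kernel.measurable_coe _ hy) hCA, ← hnull]
    exact setLIntegral_preimage_condDistrib hCA hY.aemeasurable hy (measurable_fst hs)
  rw [lintegral_eq_zero_iff (Kernel.measurable_coe _ hy)] at hint
  exact (ae_restrict_iff' (measurable_fst hs)).1 hint

lemma map_absolutelyContinuous_compProd_prodMkRight (hA : Measurable A) (hY : Measurable Y)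
    (hC : Measurable C) :
    (μ.map fun ω => ((C ω, A ω), Y ω)) ≪
      (μ.map fun ω => (C ω, A ω)) ⊗ₘ Kernel.prodMkRight α (condDistrib Y C μ) := by
  rw [← compProd_map_condDistrib hY.aemeasurable,
    compProd_eq_withDensity_div (condDistrib_prodMk_singleton_eq_zero hA hY hC)]
  exact withDensity_absolutelyContinuous _ _

lemma llr_map_compProd_prodMkRight_ae_eq (hA : Measurable A) (hY : Measurable Y)
    (hC : Measurable C) :
    (fun ω => llr (μ.map fun ω => ((C ω, A ω), Y ω))
      ((μ.map fun ω => (C ω, A ω)) ⊗ₘ Kernel.prodMkRight α (condDistrib Y C μ))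
      ((C ω, A ω), Y ω)) =ᵐ[μ] fun ω =>
      Real.log ((condDistrib Y (fun ω => (C ω, A ω)) μ (C ω, A ω)).real {Y ω}) -
        Real.log ((condDistrib Y C μ (C ω)).real {Y ω}) := by
  have h := llr_compProd_ae_eq (condDistrib_prodMk_singleton_eq_zero (μ := μ) hA hY hC)
  rw [compProd_map_condDistrib hY.aemeasurable] at h
  exact ae_of_ae_map (by fun_prop) h

lemma condMI_ne_top [StandardBorelSpace α] [Nonempty α] (hA : Measurable A) (hY : Measurable Y)
    (hC : Measurable C) :
    condMI μ A Y C ≠ ⊤ := by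
  rw [condMI_eq_klDiv_compProd_prodMkRight hA hY hC]
  refine klDiv_ne_top (map_absolutelyContinuous_compProd_prodMkRight hA hY hC) ?_
  rw [integrable_map_measure (measurable_llr _ _).aestronglyMeasurable (by fun_prop)]
  exact (integrable_congr (llr_map_compProd_prodMkRight_ae_eq hA hY hC)).2
    ((integrable_log_condDistrib hY (hC.prodMk hA)).sub (integrable_log_condDistrib hY hC))

end Finite

variable [Fintype 𝒴]

lemma condEntropy_comap (hY : Measurable Y) (hC : Measurable C) :
    condEntropy μ Y (MeasurableSpace.comap C inferInstance) =
      ∫ ω, ∑ y, Real.negMulLog ((condDistrib Y C μ (C ω)).real {y}) ∂μ := by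
  refine integral_congr_ae ?_
  have h : ∀ y, (fun a => (condDistrib Y C μ (C a)).real {y}) =ᵐ[μ] _ := fun y =>
    condDistrib_ae_eq_condExp (μ := μ) hC hY (measurableSet_singleton y)
  filter_upwards [ae_all_iff.2 h] with ω hω
  simp only [← hω]

lemma integral_log_condDistrib (hY : Measurable Y) (hC : Measurable C) :
    ∫ ω, Real.log ((condDistrib Y C μ (C ω)).real {Y ω}) ∂μ =
      -condEntropy μ Y (MeasurableSpace.comap C inferInstance) := by
  have h := integral_log_kernel_singleton (μ.map C) (condDistrib Y C μ)
  rw [compProd_map_condDistrib hY.aemeasurable, integral_map (hC.prodMk hY).aemeasurable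
    (measurable_log_kernel_singleton _).aestronglyMeasurable] at h
  rw [condEntropy_comap hY hC, h, integral_map hC.aemeasurable]
  exact (Finset.measurable_sum _ fun y _ => Real.continuous_negMulLog.measurable.comp
    (measurable_kernel_real_singleton _ y)).aestronglyMeasurable

variable [StandardBorelSpace α] [Nonempty α]

lemma toReal_condMI (hA : Measurable A) (hY : Measurable Y) (hC : Measurable C) :
    (condMI μ A Y C).toReal = condEntropy μ Y (MeasurableSpace.comap C inferInstance) -
      condEntropy μ Y (MeasurableSpace.comap (fun ω => (C ω, A ω)) inferInstance) := by
  have hCA : Measurable fun ω => (C ω, A ω) := hC.prodMk hA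
  rw [condMI_eq_klDiv_compProd_prodMkRight hA hY hC, toReal_klDiv_of_measure_eq
      (map_absolutelyContinuous_compProd_prodMkRight hA hY hC),
    integral_map (by fun_prop) (measurable_llr _ _).aestronglyMeasurable,
    integral_congr_ae (llr_map_compProd_prodMkRight_ae_eq hA hY hC),
    integral_sub (integrable_log_condDistrib hY hCA) (integrable_log_condDistrib hY hC),
    integral_log_condDistrib hY hCA, integral_log_condDistrib hY hC]
  · ring
  · rw [← compProd_map_condDistrib hY.aemeasurable, Measure.compProd_apply_univ,
      Measure.compProd_apply_univ]

end CondEntropy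

/-! ### The outer bound in terms of conditional entropies -/

instance : Fintype Label :=
  ⟨{Label.t, Label.u, Label.v}, fun x => by cases x <;> simp⟩

/-- Which of `W₁`, `W₂` are observed. -/
inductive Side
  | one
  | two
  | both
  deriving DecidableEq

instance : Fintype Side :=
  ⟨{Side.one, Side.two, Side.both}, fun x => by cases x <;> simp⟩

/-- Adding the label `i` to any set of labels lowers the conditional entropy `h` by `c`, up to an
error `δ`: the mutual information with the variable named `i` is `c`, whatever other variables are
observed. -/
def HasIncrement (h : Finset Label → ℝ) (i : Label) (c δ : ℝ) : Prop :=
  ∀ A, i ∉ A → |h A - h (insert i A) - c| ≤ δ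

lemma HasIncrement.mono {h : Finset Label → ℝ} {i : Label} {c δ δ' : ℝ} (hh : HasIncrement h i c δ)
    (hδ : δ ≤ δ') : HasIncrement h i c δ' :=
  fun A hA => (hh A hA).trans hδ

/-- The equations of the outer bound, up to an error `δ`, for `H₁ A s = H(Y₁ | A, W_s)` and
`H₂ A s = H(Y₂ | A, W_s)`, where `c₀`, `c₁`, `c₂` are the values of `I(T;Y₁|W₁)`, `I(U;Y₁|W₁)`,
`I(V;Y₂|W₂)`. -/
structure EntropyEquations (H₁ H₂ : Finset Label → Side → ℝ) (c₀ c₁ c₂ δ : ℝ) : Prop where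
  t_one : HasIncrement (H₁ · .one) .t c₀ δ
  t_two : HasIncrement (H₂ · .two) .t c₀ δ
  u_one : HasIncrement (H₁ · .one) .u c₁ δ
  v_two : HasIncrement (H₂ · .two) .v c₂ δ
  sides : ∀ A, H₁ A .one - H₁ A .both = H₂ A .two - H₂ A .both
  sub_sub : ∀ A B₁ B₂ : Finset Label,
    B₁ ⊆ {Label.t, Label.u} → B₂ ⊆ {Label.t, Label.v} →
    |(H₁ (A ∪ B₂) .both - H₁ (A ∪ B₂ ∪ B₁) .both + (H₂ A .both - H₂ (A ∪ B₁) .both)) -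
      (H₂ (A ∪ B₂) .both - H₂ (A ∪ B₂ ∪ B₁) .both + (H₁ A .both - H₁ (A ∪ B₁) .both))| ≤ δ

section SigmaAlgebras

variable {Ω : Type*} {T U V : Ω → ℝ}

/-- The `σ`-algebra generated by the variables named in `A`. -/
abbrev labelSigma (T U V : Ω → ℝ) (A : Finset Label) : MeasurableSpace Ω :=
  ⨆ i ∈ A, MeasurableSpace.comap (family T U V i) inferInstance

/-- The `σ`-algebra generated by the variables named in `A` and the observed ones of `W₁`, `W₂`. -/
abbrev viewSigma (T U V W₁ W₂ : Ω → ℝ) (A : Finset Label) : Side → MeasurableSpace Ω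
  | .one => labelSigma T U V A ⊔ MeasurableSpace.comap W₁ inferInstance
  | .two => labelSigma T U V A ⊔ MeasurableSpace.comap W₂ inferInstance
  | .both => labelSigma T U V A ⊔
      (MeasurableSpace.comap W₁ inferInstance ⊔ MeasurableSpace.comap W₂ inferInstance)

lemma comap_prodMk_eq_sup {α β : Type*} [MeasurableSpace α] [MeasurableSpace β] (f : Ω → α)
    (g : Ω → β) :
    MeasurableSpace.comap (fun ω => (f ω, g ω)) inferInstance =
      MeasurableSpace.comap f inferInstance ⊔ MeasurableSpace.comap g inferInstance :=
  MeasurableSpace.comap_prodMk f g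

lemma comap_sub (A : Finset Label) :
    MeasurableSpace.comap (sub T U V A) inferInstance = labelSigma T U V A := by
  rw [labelSigma, MeasurableSpace.pi, MeasurableSpace.comap_iSup, iSup_subtype]
  simp only [MeasurableSpace.comap_comp]
  rfl

lemma labelSigma_union (A B : Finset Label) :
    labelSigma T U V (A ∪ B) = labelSigma T U V A ⊔ labelSigma T U V B :=
  Finset.iSup_union

lemma labelSigma_insert (i : Label) (A : Finset Label) :
    labelSigma T U V (insert i A) =
      MeasurableSpace.comap (family T U V i) inferInstance ⊔ labelSigma T U V A :=
  Finset.iSup_insert _ _ _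

lemma labelSigma_empty : labelSigma T U V ∅ = ⊥ := by
  simp only [labelSigma, Finset.notMem_empty, iSup_false, iSup_bot]

lemma comap_sub_prodMk (W₁ W₂ : Ω → ℝ) (A : Finset Label) :
    MeasurableSpace.comap (fun ω => (sub T U V A ω, W₁ ω, W₂ ω)) inferInstance =
      viewSigma T U V W₁ W₂ A .both := by
  rw [comap_prodMk_eq_sup, comap_prodMk_eq_sup, comap_sub]

lemma viewSigma_both_sup_comap_sub (W₁ W₂ : Ω → ℝ) (A B : Finset Label) :
    viewSigma T U V W₁ W₂ A .both ⊔ MeasurableSpace.comap (sub T U V B) inferInstance =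
      viewSigma T U V W₁ W₂ (A ∪ B) .both := by
  rw [comap_sub]
  simp only [viewSigma, labelSigma_union]
  ac_rfl

lemma comap_sub_prodMk_sub (W₁ W₂ : Ω → ℝ) (A B : Finset Label) :
    MeasurableSpace.comap (fun ω => ((sub T U V A ω, W₁ ω, W₂ ω), sub T U V B ω)) inferInstance =
      viewSigma T U V W₁ W₂ (A ∪ B) .both := by
  rw [comap_prodMk_eq_sup, comap_sub_prodMk, viewSigma_both_sup_comap_sub]

lemma viewSigma_le {m : MeasurableSpace Ω} {W₁ W₂ : Ω → ℝ} {A : Finset Label} {s : Side}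
    (hF : ∀ i ∈ A, Measurable (family T U V i)) (hW₁ : s ≠ .two → Measurable W₁)
    (hW₂ : s ≠ .one → Measurable W₂) : viewSigma T U V W₁ W₂ A s ≤ m := by
  have hA : labelSigma T U V A ≤ m := iSup₂_le fun i hi => (hF i hi).comap_le
  rcases s with _ | _ | _
  · exact sup_le hA (hW₁ (by decide)).comap_le
  · exact sup_le hA (hW₂ (by decide)).comap_le
  · exact sup_le hA (sup_le (hW₁ (by decide)).comap_le (hW₂ (by decide)).comap_le)

lemma measurable_viewSigma_family (W₁ W₂ : Ω → ℝ) {A : Finset Label} (s : Side) {i : Label}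
    (hi : i ∈ A) : Measurable[viewSigma T U V W₁ W₂ A s] (family T U V i) := by
  refine measurable_iff_comap_le.2 (le_trans (b := labelSigma T U V A) ?_ ?_)
  · exact le_iSup₂_of_le i hi le_rfl
  · rcases s with _ | _ | _ <;> exact le_sup_left

lemma measurable_viewSigma_W₁ (W₁ W₂ : Ω → ℝ) (A : Finset Label) {s : Side} (hs : s ≠ .two) :
    Measurable[viewSigma T U V W₁ W₂ A s] W₁ := by
  refine measurable_iff_comap_le.2 ?_
  rcases s with _ | _ | _
  exacts [le_sup_right, absurd rfl hs, le_sup_of_le_right le_sup_left]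

lemma measurable_viewSigma_W₂ (W₁ W₂ : Ω → ℝ) (A : Finset Label) {s : Side} (hs : s ≠ .one) :
    Measurable[viewSigma T U V W₁ W₂ A s] W₂ := by
  refine measurable_iff_comap_le.2 ?_
  rcases s with _ | _ | _
  exacts [absurd rfl hs, le_sup_right, le_sup_of_le_right le_sup_right]

lemma comap_viewSigma {Ω' : Type*} (f : Ω' → Ω) (W₁ W₂ : Ω → ℝ) (A : Finset Label) (s : Side) :
    (viewSigma T U V W₁ W₂ A s).comap f =
      viewSigma (fun ω => T (f ω)) (fun ω => U (f ω)) (fun ω => V (f ω)) (fun ω => W₁ (f ω))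
        (fun ω => W₂ (f ω)) A s := by
  have hfamily : ∀ i, family (fun ω => T (f ω)) (fun ω => U (f ω)) (fun ω => V (f ω)) i =
      family T U V i ∘ f := fun i => by cases i <;> rfl
  rcases s with _ | _ | _ <;>
    simp only [viewSigma, labelSigma, MeasurableSpace.comap_sup, MeasurableSpace.comap_iSup,
      MeasurableSpace.comap_comp, hfamily] <;> rfl

lemma viewSigma_univ_both_le_comap (W₁ W₂ : Ω → ℝ) :
    viewSigma T U V W₁ W₂ Finset.univ .both ≤
      MeasurableSpace.comap (fun ω => (T ω, U ω, V ω, W₁ ω, W₂ ω)) inferInstance := by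
  have h := comap_measurable (m := inferInstance) fun ω => (T ω, U ω, V ω, W₁ ω, W₂ ω)
  refine viewSigma_le (fun i _ => ?_) (fun _ => h.snd.snd.snd.fst) (fun _ => h.snd.snd.snd.snd)
  rcases i with _ | _ | _
  exacts [h.fst, h.snd.fst, h.snd.snd.fst]

variable [MeasurableSpace Ω]

lemma measurable_family (hT : Measurable T) (hU : Measurable U) (hV : Measurable V) (i : Label) :
    Measurable (family T U V i) := by
  cases i <;> assumption

lemma measurable_sub (hF : ∀ i, Measurable (family T U V i)) (A : Finset Label) :
    Measurable (sub T U V A) :=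
  measurable_pi_lambda _ fun i => hF i

end SigmaAlgebras

lemma condMI_eq_ofReal {Ω α γ 𝒴 : Type*} {m m' : MeasurableSpace Ω} [MeasurableSpace Ω]
    {μ : Measure Ω} [IsFiniteMeasure μ] [Fintype 𝒴] [Nonempty 𝒴] [MeasurableSpace 𝒴]
    [MeasurableSingletonClass 𝒴] [MeasurableSpace α] [StandardBorelSpace α] [Nonempty α]
    [MeasurableSpace γ] {A : Ω → α} {Y : Ω → 𝒴} {C : Ω → γ} (hA : Measurable A)
    (hY : Measurable Y) (hC : Measurable C)
    (hm : MeasurableSpace.comap C inferInstance = m)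
    (hm' : m ⊔ MeasurableSpace.comap A inferInstance = m') :
    condMI μ A Y C = ENNReal.ofReal (condEntropy μ Y m - condEntropy μ Y m') := by
  rw [← hm', ← hm, ← comap_prodMk_eq_sup, ← toReal_condMI hA hY hC,
    ENNReal.ofReal_toReal (condMI_ne_top hA hY hC)]

section OneSide

variable {Ω 𝒴 : Type*} [MeasurableSpace Ω] {μ : Measure Ω} [IsFiniteMeasure μ] [Fintype 𝒴]
  [Nonempty 𝒴] [MeasurableSpace 𝒴] [MeasurableSingletonClass 𝒴] {T U V W : Ω → ℝ} {Y : Ω → 𝒴}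
  {c : ℝ} {i : Label}

lemma condMI_family_of_comap_eq {γ : Type*} [MeasurableSpace γ] {C : Ω → γ} {A : Finset Label}
    (hF : ∀ i, Measurable (family T U V i)) (hY : Measurable Y) (hC : Measurable C)
    (hc : HasIncrement (fun A => condEntropy μ Y
      (labelSigma T U V A ⊔ MeasurableSpace.comap W inferInstance)) i c 0) (hi : i ∉ A)
    (hm : MeasurableSpace.comap C inferInstance =
      labelSigma T U V A ⊔ MeasurableSpace.comap W inferInstance) :
    condMI μ (family T U V i) Y C = ENNReal.ofReal c := by
  rw [← sub_eq_zero.1 (abs_nonpos_iff.1 (hc A hi))]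
  exact condMI_eq_ofReal (hF i) hY hC hm (by rw [labelSigma_insert]; ac_rfl)

lemma condMI_family (hF : ∀ i, Measurable (family T U V i)) (hW : Measurable W)
    (hY : Measurable Y)
    (hc : HasIncrement (fun A => condEntropy μ Y
      (labelSigma T U V A ⊔ MeasurableSpace.comap W inferInstance)) i c 0) :
    condMI μ (family T U V i) Y W = ENNReal.ofReal c :=
  condMI_family_of_comap_eq hF hY hW hc (Finset.notMem_empty i)
    (by rw [labelSigma_empty, bot_sup_eq])

lemma condMI_family_prodMk (hF : ∀ i, Measurable (family T U V i)) (hW : Measurable W)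
    (hY : Measurable Y)
    (hc : HasIncrement (fun A => condEntropy μ Y
      (labelSigma T U V A ⊔ MeasurableSpace.comap W inferInstance)) i c 0)
    (j : Label) (hij : i ≠ j) :
    condMI μ (family T U V i) Y (fun ω => (family T U V j ω, W ω)) = ENNReal.ofReal c :=
  condMI_family_of_comap_eq (A := {j}) hF hY ((hF j).prodMk hW) hc (by simpa using hij)
    (by rw [comap_prodMk_eq_sup, ← insert_empty_eq, labelSigma_insert, labelSigma_empty,
          sup_bot_eq])

lemma condMI_family_prodMk_prodMk (hF : ∀ i, Measurable (family T U V i)) (hW : Measurable W)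
    (hY : Measurable Y)
    (hc : HasIncrement (fun A => condEntropy μ Y
      (labelSigma T U V A ⊔ MeasurableSpace.comap W inferInstance)) i c 0)
    (j k : Label) (hij : i ≠ j) (hik : i ≠ k) :
    condMI μ (family T U V i) Y (fun ω => (family T U V j ω, family T U V k ω, W ω)) =
      ENNReal.ofReal c :=
  condMI_family_of_comap_eq (A := {j, k}) hF hY ((hF j).prodMk ((hF k).prodMk hW)) hc
    (by simp [hij, hik])
    (by rw [comap_prodMk_eq_sup, comap_prodMk_eq_sup, labelSigma_insert,
          ← insert_empty_eq, labelSigma_insert, labelSigma_empty, sup_bot_eq, sup_assoc])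

end OneSide

section BothSides

variable {Ω 𝒴 𝒴' : Type*} [MeasurableSpace Ω] {μ : Measure Ω} [IsFiniteMeasure μ]
  [Nonempty 𝒴] [MeasurableSpace 𝒴] [MeasurableSingletonClass 𝒴]
  [Nonempty 𝒴'] [MeasurableSpace 𝒴'] [MeasurableSingletonClass 𝒴']
  {T U V W₁ W₂ : Ω → ℝ} {Y : Ω → 𝒴} {Y' : Ω → 𝒴'}

lemma measurable_sub_prodMk (hF : ∀ i, Measurable (family T U V i)) (hW₁ : Measurable W₁)
    (hW₂ : Measurable W₂) (A : Finset Label) :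
    Measurable fun ω => (sub T U V A ω, W₁ ω, W₂ ω) :=
  (measurable_sub hF A).prodMk (hW₁.prodMk hW₂)

lemma condMI_sub_eq_ofReal [Fintype 𝒴] (hF : ∀ i, Measurable (family T U V i))
    (hW₁ : Measurable W₁) (hW₂ : Measurable W₂) (hY : Measurable Y) (A B : Finset Label) :
    condMI μ (sub T U V B) Y (fun ω => (sub T U V A ω, W₁ ω, W₂ ω)) =
      ENNReal.ofReal (condEntropy μ Y (viewSigma T U V W₁ W₂ A .both) -
        condEntropy μ Y (viewSigma T U V W₁ W₂ (A ∪ B) .both)) :=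
  condMI_eq_ofReal (measurable_sub hF B) hY (measurable_sub_prodMk hF hW₁ hW₂ A)
    (comap_sub_prodMk _ _ A) (viewSigma_both_sup_comap_sub _ _ A B)

lemma condMI_sub_sub_prodMk_eq_union [Finite 𝒴] (hF : ∀ i, Measurable (family T U V i))
    (hW₁ : Measurable W₁) (hW₂ : Measurable W₂) (hY : Measurable Y) (A B B' : Finset Label) :
    condMI μ (sub T U V B) Y (fun ω => ((sub T U V A ω, W₁ ω, W₂ ω), sub T U V B' ω)) =
      condMI μ (sub T U V B) Y (fun ω => (sub T U V (A ∪ B') ω, W₁ ω, W₂ ω)) := by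
  have := Fintype.ofFinite 𝒴
  rw [condMI_sub_eq_ofReal hF hW₁ hW₂ hY]
  exact condMI_eq_ofReal (measurable_sub hF B) hY
    ((measurable_sub_prodMk hF hW₁ hW₂ A).prodMk (measurable_sub hF B'))
    (comap_sub_prodMk_sub _ _ A B') (viewSigma_both_sup_comap_sub _ _ _ _)

lemma condMI_sub_add_condMI_sub_comm [Finite 𝒴] (hF : ∀ i, Measurable (family T U V i))
    (hW₁ : Measurable W₁) (hW₂ : Measurable W₂) (hY : Measurable Y) (A B B' : Finset Label) :
    condMI μ (sub T U V B) Y (fun ω => (sub T U V A ω, W₁ ω, W₂ ω)) +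
      condMI μ (sub T U V B) (sub T U V B') (fun ω => (sub T U V A ω, W₁ ω, W₂ ω, Y ω)) =
    condMI μ (sub T U V B) (sub T U V B') (fun ω => (sub T U V A ω, W₁ ω, W₂ ω)) +
      condMI μ (sub T U V B) Y (fun ω => (sub T U V (A ∪ B') ω, W₁ ω, W₂ ω)) := by
  have hC := measurable_sub_prodMk hF hW₁ hW₂ A
  have hreassoc : condMI μ (sub T U V B) (sub T U V B')
        (fun ω => (sub T U V A ω, W₁ ω, W₂ ω, Y ω)) =
      condMI μ (sub T U V B) (sub T U V B') (fun ω => ((sub T U V A ω, W₁ ω, W₂ ω), Y ω)) :=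
    condMI_comp_of_leftInverse (C := fun ω => ((sub T U V A ω, W₁ ω, W₂ ω), Y ω))
      (f := fun p => (p.1.1, p.1.2.1, p.1.2.2, p.2))
      (g := fun p => ((p.1, p.2.1, p.2.2.1), p.2.2.2)) (by fun_prop) (by fun_prop)
      (fun _ => rfl) (measurable_sub hF B) (measurable_sub hF B') (hC.prodMk hY)
  rw [hreassoc, ← condMI_sub_sub_prodMk_eq_union hF hW₁ hW₂ hY]
  exact condMI_add_condMI_comm (measurable_sub hF B) (measurable_sub hF B') hY hC

lemma condMI_sub_sub_eq_of_add_eq_add [Finite 𝒴] [Finite 𝒴']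
    (hF : ∀ i, Measurable (family T U V i)) (hW₁ : Measurable W₁) (hW₂ : Measurable W₂)
    (hY : Measurable Y) (hY' : Measurable Y') (A B B' : Finset Label)
    (h : condMI μ (sub T U V B) Y (fun ω => (sub T U V (A ∪ B') ω, W₁ ω, W₂ ω)) +
        condMI μ (sub T U V B) Y' (fun ω => (sub T U V A ω, W₁ ω, W₂ ω)) =
      condMI μ (sub T U V B) Y' (fun ω => (sub T U V (A ∪ B') ω, W₁ ω, W₂ ω)) +
        condMI μ (sub T U V B) Y (fun ω => (sub T U V A ω, W₁ ω, W₂ ω))) :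
    condMI μ (sub T U V B) (sub T U V B') (fun ω => (sub T U V A ω, W₁ ω, W₂ ω, Y ω)) =
      condMI μ (sub T U V B) (sub T U V B') (fun ω => (sub T U V A ω, W₁ ω, W₂ ω, Y' ω)) := by
  have := Fintype.ofFinite 𝒴
  have := Fintype.ofFinite 𝒴'
  have hC := measurable_sub_prodMk hF hW₁ hW₂ A
  have hfin := ENNReal.add_ne_top.2 ⟨condMI_ne_top (μ := μ) (measurable_sub hF B) hY hC,
    condMI_ne_top (μ := μ) (measurable_sub hF B) hY' hC⟩
  refine (ENNReal.add_right_inj hfin).1 ?_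
  rw [add_right_comm, condMI_sub_add_condMI_sub_comm hF hW₁ hW₂ hY, add_assoc, h,
    add_comm (condMI μ _ Y _) (condMI μ _ Y' _), add_right_comm,
    condMI_sub_add_condMI_sub_comm hF hW₁ hW₂ hY']
  ac_rfl

end BothSides

section OuterBound

variable {𝒳 𝒴₁ 𝒴₂ : Type*}
  [MeasurableSpace 𝒳]
  [Fintype 𝒴₁] [Nonempty 𝒴₁] [MeasurableSpace 𝒴₁] [MeasurableSingletonClass 𝒴₁]
  [Fintype 𝒴₂] [Nonempty 𝒴₂] [MeasurableSpace 𝒴₂] [MeasurableSingletonClass 𝒴₂]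
  {Ω : Type} [MeasurableSpace Ω] {μ : Measure Ω} [IsProbabilityMeasure μ]
  {T U V W₁ W₂ : Ω → ℝ} {X : Ω → 𝒳} {Y₁ : Ω → 𝒴₁} {Y₂ : Ω → 𝒴₂} {c₀ c₁ c₂ : ℝ}

lemma EntropyEquations.condMI_add_eq_add (hF : ∀ i, Measurable (family T U V i))
    (hW₁ : Measurable W₁) (hW₂ : Measurable W₂) (hY₁ : Measurable Y₁) (hY₂ : Measurable Y₂)
    (h : EntropyEquations (fun A s => condEntropy μ Y₁ (viewSigma T U V W₁ W₂ A s))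
      (fun A s => condEntropy μ Y₂ (viewSigma T U V W₁ W₂ A s)) c₀ c₁ c₂ 0)
    (A : Finset Label) {B₁ B₂ : Finset Label} (hB₁ : B₁ ⊆ {Label.t, Label.u})
    (hB₂ : B₂ ⊆ {Label.t, Label.v}) :
    condMI μ (sub T U V B₁) Y₁ (fun ω => (sub T U V (A ∪ B₂) ω, W₁ ω, W₂ ω)) +
      condMI μ (sub T U V B₁) Y₂ (fun ω => (sub T U V A ω, W₁ ω, W₂ ω)) =
    condMI μ (sub T U V B₁) Y₂ (fun ω => (sub T U V (A ∪ B₂) ω, W₁ ω, W₂ ω)) +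
      condMI μ (sub T U V B₁) Y₁ (fun ω => (sub T U V A ω, W₁ ω, W₂ ω)) := by
  have hfin₁ : ∀ A, condMI μ (sub T U V B₁) Y₁ (fun ω => (sub T U V A ω, W₁ ω, W₂ ω)) ≠ ⊤ :=
    fun A => condMI_ne_top (measurable_sub hF B₁) hY₁ (measurable_sub_prodMk hF hW₁ hW₂ A)
  have hfin₂ : ∀ A, condMI μ (sub T U V B₁) Y₂ (fun ω => (sub T U V A ω, W₁ ω, W₂ ω)) ≠ ⊤ :=
    fun A => condMI_ne_top (measurable_sub hF B₁) hY₂ (measurable_sub_prodMk hF hW₁ hW₂ A)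
  rw [← ENNReal.toReal_eq_toReal_iff' (ENNReal.add_ne_top.2 ⟨hfin₁ _, hfin₂ _⟩)
    (ENNReal.add_ne_top.2 ⟨hfin₂ _, hfin₁ _⟩), ENNReal.toReal_add (hfin₁ _) (hfin₂ _),
    ENNReal.toReal_add (hfin₂ _) (hfin₁ _)]
  simp only [toReal_condMI (measurable_sub hF B₁) hY₁ (measurable_sub_prodMk hF hW₁ hW₂ _),
    toReal_condMI (measurable_sub hF B₁) hY₂ (measurable_sub_prodMk hF hW₁ hW₂ _),
    comap_sub_prodMk, comap_sub_prodMk_sub]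
  exact sub_eq_zero.1 (abs_nonpos_iff.1 (h.sub_sub A B₁ B₂ hB₁ hB₂))

lemma EntropyEquations.condMI_W_Y (hF : ∀ i, Measurable (family T U V i))
    (hW₁ : Measurable W₁) (hW₂ : Measurable W₂) (hY₁ : Measurable Y₁) (hY₂ : Measurable Y₂)
    (h : EntropyEquations (fun A s => condEntropy μ Y₁ (viewSigma T U V W₁ W₂ A s))
      (fun A s => condEntropy μ Y₂ (viewSigma T U V W₁ W₂ A s)) c₀ c₁ c₂ 0) (A : Finset Label) :
    condMI μ W₂ Y₁ (fun ω => (sub T U V A ω, W₁ ω)) =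
      condMI μ W₁ Y₂ (fun ω => (sub T U V A ω, W₂ ω)) := by
  rw [condMI_eq_ofReal (m := viewSigma T U V W₁ W₂ A .one)
      (m' := viewSigma T U V W₁ W₂ A .both) hW₂ hY₁ ((measurable_sub hF A).prodMk hW₁)
      (by rw [comap_prodMk_eq_sup, comap_sub]) (sup_assoc _ _ _),
    condMI_eq_ofReal (m := viewSigma T U V W₁ W₂ A .two)
      (m' := viewSigma T U V W₁ W₂ A .both) hW₁ hY₂ ((measurable_sub hF A).prodMk hW₂)
      (by rw [comap_prodMk_eq_sup, comap_sub])
      ((sup_assoc _ _ _).trans (congrArg _ (sup_comm _ _)))]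
  exact congrArg _ (h.sides A)

lemma EntropyEquations.admissible {κ : Kernel 𝒳 (𝒴₁ × 𝒴₂)}
    (hF : ∀ i, Measurable (family T U V i)) (hW₁ : Measurable W₁) (hW₂ : Measurable W₂)
    (hX : Measurable X) (hY₁ : Measurable Y₁) (hY₂ : Measurable Y₂)
    (hmarkov : μ.map (fun ω => (((T ω, U ω, V ω, W₁ ω, W₂ ω), X ω), (Y₁ ω, Y₂ ω))) =
      μ.map (fun ω => ((T ω, U ω, V ω, W₁ ω, W₂ ω), X ω)) ⊗ₘ
        Kernel.prodMkLeft (ℝ × ℝ × ℝ × ℝ × ℝ) κ)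
    (hindep : iIndepFun (family T U V) μ)
    (h : EntropyEquations (fun A s => condEntropy μ Y₁ (viewSigma T U V W₁ W₂ A s))
      (fun A s => condEntropy μ Y₂ (viewSigma T U V W₁ W₂ A s)) c₀ c₁ c₂ 0) :
    Admissible κ μ T U V W₁ W₂ X Y₁ Y₂ := by
  have hT₁ : condMI μ T Y₁ W₁ = _ := condMI_family hF hW₁ hY₁ h.t_one
  have hT₂ : condMI μ T Y₂ W₂ = _ := condMI_family hF hW₂ hY₂ h.t_two
  have hU₁ : condMI μ U Y₁ W₁ = _ := condMI_family hF hW₁ hY₁ h.u_one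
  have hV₂ : condMI μ V Y₂ W₂ = _ := condMI_family hF hW₂ hY₂ h.v_two
  have hTj₁ := condMI_family_prodMk hF hW₁ hY₁ h.t_one
  have hTj₂ := condMI_family_prodMk hF hW₂ hY₂ h.t_two
  have hUj₁ := condMI_family_prodMk hF hW₁ hY₁ h.u_one
  have hVj₂ := condMI_family_prodMk hF hW₂ hY₂ h.v_two
  have hTjk₁ := condMI_family_prodMk_prodMk hF hW₁ hY₁ h.t_one
  have hTjk₂ := condMI_family_prodMk_prodMk hF hW₂ hY₂ h.t_two
  have hUjk₁ := condMI_family_prodMk_prodMk hF hW₁ hY₁ h.u_one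
  have hVjk₂ := condMI_family_prodMk_prodMk hF hW₂ hY₂ h.v_two
  exact
    { measurable_T := hF .t
      measurable_U := hF .u
      measurable_V := hF .v
      measurable_W₁ := hW₁
      measurable_W₂ := hW₂
      measurable_X := hX
      measurable_Y₁ := hY₁
      measurable_Y₂ := hY₂
      markov := hmarkov
      indep := hindep
      T_Y₁_eq_T_Y₂ := hT₁.trans hT₂.symm
      T_Y₁_V := hT₁.trans (hTj₁ .v (by decide)).symm
      T_Y₁_U := hT₁.trans (hTj₁ .u (by decide)).symm
      T_Y₁_UV := hT₁.trans (hTjk₁ .u .v (by decide) (by decide)).symm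
      T_Y₂_V := hT₂.trans (hTj₂ .v (by decide)).symm
      T_Y₂_U := hT₂.trans (hTj₂ .u (by decide)).symm
      T_Y₂_UV := hT₂.trans (hTjk₂ .u .v (by decide) (by decide)).symm
      U_Y₁_V := hU₁.trans (hUj₁ .v (by decide)).symm
      U_Y₁_T := hU₁.trans (hUj₁ .t (by decide)).symm
      U_Y₁_TV := hU₁.trans (hUjk₁ .t .v (by decide) (by decide)).symm
      V_Y₂_U := hV₂.trans (hVj₂ .u (by decide)).symm
      V_Y₂_T := hV₂.trans (hVj₂ .t (by decide)).symm
      V_Y₂_TU := hV₂.trans (hVjk₂ .t .u (by decide) (by decide)).symm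
      sub_sub := fun A B₁ B₂ hB₁ hB₂ => condMI_sub_sub_eq_of_add_eq_add hF hW₁ hW₂ hY₁ hY₂ A B₁ B₂
        (h.condMI_add_eq_add hF hW₁ hW₂ hY₁ hY₂ A hB₁ hB₂)
      sub_sub' := fun A _ _ hB₁ hB₂ => h.condMI_add_eq_add hF hW₁ hW₂ hY₁ hY₂ A hB₁ hB₂
      W_Y := h.condMI_W_Y hF hW₁ hW₂ hY₁ hY₂ }

lemma EntropyEquations.rateBounds (hF : ∀ i, Measurable (family T U V i)) (hW₁ : Measurable W₁)
    (hW₂ : Measurable W₂) (hY₁ : Measurable Y₁) (hY₂ : Measurable Y₂)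
    (h : EntropyEquations (fun A s => condEntropy μ Y₁ (viewSigma T U V W₁ W₂ A s))
      (fun A s => condEntropy μ Y₂ (viewSigma T U V W₁ W₂ A s)) c₀ c₁ c₂ 0)
    {R : ℝ × ℝ × ℝ} (hR : 0 ≤ R) (hRc : R ≤ (c₀, c₁, c₂)) :
    RateBounds μ T U V W₁ W₂ Y₁ Y₂ R := by
  have hT₁ : condMI μ T Y₁ W₁ = _ := condMI_family hF hW₁ hY₁ h.t_one
  have hT₂ : condMI μ T Y₂ W₂ = _ := condMI_family hF hW₂ hY₂ h.t_two
  have hU₁ : condMI μ U Y₁ W₁ = _ := condMI_family hF hW₁ hY₁ h.u_one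
  have hV₂ : condMI μ V Y₂ W₂ = _ := condMI_family hF hW₂ hY₂ h.v_two
  refine ⟨hR.1, hR.2.1, hR.2.2, ?_, ?_, ?_⟩
  · rw [hT₁, hT₂, min_self]
    exact ENNReal.ofReal_le_ofReal hRc.1
  · exact hU₁ ▸ ENNReal.ofReal_le_ofReal hRc.2.1
  · exact hV₂ ▸ ENNReal.ofReal_le_ofReal hRc.2.2

end OuterBound

/-! ### Secret sharing by one-time pads -/

/-- Sets of observed variables: some of `T`, `U`, `V` and at least one of `W₁`, `W₂`. -/
abbrev Idx := Finset Label × Side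

/-- The set of variables to which a secret belongs: the secrets are numbered by the sets of observed
variables, and `none` is an additional secret which belongs to all the variables. -/
def owners (o : Option Idx) : Idx := o.getD (Finset.univ, .both)

/-- The secret `o` belongs to a subset of `S`, so that it can be computed from the variables
in `S`. -/
def Visible (S : Idx) (o : Option Idx) : Prop :=
  (owners o).1 ⊆ S.1 ∧ ((owners o).2 = S.2 ∨ S.2 = .both)

section Pads

variable {E : Type*} [AddCommGroup E]

/-- The share handed to `W₁` of a secret `x` belonging to given variables: `x` is hidden by the
pads `p` known to those of `T`, `U`, `V` it belongs to and, if it belongs to both `W₁` and `W₂`, by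
a pad `r` known to `W₂`. -/
def share₁ : Idx → E → (Label → E) → E → E
  | (B, .one), x, p, _ => x + ∑ i ∈ B, p i
  | (_, .two), _, _, _ => 0
  | (B, .both), x, p, r => x + ∑ i ∈ B, p i + r

/-- The share handed to `W₂` of the same secret. -/
def share₂ : Idx → E → (Label → E) → E → E
  | (_, .one), _, _, _ => 0
  | (B, .two), x, p, _ => x + ∑ i ∈ B, p i
  | (_, .both), _, _, r => r

lemma share₁_add (S : Idx) (x y : E) (p d : Label → E) (r d' : E) :
    share₁ S (x + y) (p + d) (r + d') = share₁ S x p r + share₁ S y d d' := by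
  rcases S with ⟨B, _ | _ | _⟩ <;>
    simp only [share₁, Pi.add_apply, Finset.sum_add_distrib, add_zero] <;> abel

lemma share₂_add (S : Idx) (x y : E) (p d : Label → E) (r d' : E) :
    share₂ S (x + y) (p + d) (r + d') = share₂ S x p r + share₂ S y d d' := by
  rcases S with ⟨B, _ | _ | _⟩ <;>
    simp only [share₂, Pi.add_apply, Finset.sum_add_distrib, add_zero]
  abel

lemma exists_pads_shares_eq_zero (S : Idx) (o : Option Idx) (x : E) (hx : Visible S o → x = 0) :
    ∃ (d : Label → E) (d' : E), (∀ i ∈ S.1, d i = 0) ∧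
      (S.2 ≠ .two → share₁ (owners o) x d d' = 0) ∧
      (S.2 ≠ .one → share₂ (owners o) x d d' = 0) := by
  obtain ⟨A, s⟩ := S
  simp only [Visible] at hx ⊢
  generalize owners o = O at hx ⊢
  obtain ⟨B, s'⟩ := O
  by_cases hB : B ⊆ A
  · by_cases hs : s' = s ∨ s = .both
    · obtain rfl := hx ⟨hB, hs⟩
      exact ⟨0, 0, by simp, by rcases s' <;> simp [share₁], by rcases s' <;> simp [share₂]⟩
    · refine ⟨0, if s = .one then -x else 0, by simp, ?_, ?_⟩ <;> rcases s <;> rcases s' <;>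
        simp_all [share₁, share₂]
  · obtain ⟨i, hiB, hiA⟩ := Finset.not_subset.1 hB
    refine ⟨Pi.single i (-x), 0, fun j hj => Pi.single_eq_of_ne (ne_of_mem_of_not_mem hj hiA) _,
      ?_, ?_⟩ <;> rcases s' <;> simp [share₁, share₂, hiB]

/-- What is seen by the variables in `S` of the secrets `e` when `T`, `U`, `V` have the values and
the pads in the first component of `x`, and the second component consists of the additional pads;
unobserved variables are replaced by `0`. -/
def view (S : Idx) (e : Option Idx → E) (x : (Label → ℝ × (Option Idx → E)) × (Option Idx → E)) :
    (Label → ℝ) × (Option Idx → E) × (Option Idx → E) :=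
  (fun i => if i ∈ S.1 then (x.1 i).1 else 0,
    fun o => if S.2 = .two then 0 else share₁ (owners o) (e o) (fun i => (x.1 i).2 o) (x.2 o),
    fun o => if S.2 = .one then 0 else share₂ (owners o) (e o) (fun i => (x.1 i).2 o) (x.2 o))

lemma exists_view_eq_view_add (S : Idx) (e e' : Option Idx → E)
    (h : ∀ o, Visible S o → e o = e' o) :
    ∃ (d : Label → Option Idx → E) (d' : Option Idx → E), (∀ i ∈ S.1, d i = 0) ∧
      ∀ x, view S e x = view S e' (fun i => ((x.1 i).1, (x.1 i).2 + d i), x.2 + d') := by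
  choose d d' hd h₁ h₂ using fun o =>
    exists_pads_shares_eq_zero S o (e' o - e o) fun ho => sub_eq_zero.2 (h o ho).symm
  refine ⟨fun i o => d o i, d', fun i hi => funext fun o => hd o i hi, fun x => ?_⟩
  have he' : e' = fun o => e o + (e' o - e o) := funext fun o => (add_sub_cancel _ _).symm
  refine Prod.ext rfl (Prod.ext (funext fun o => ?_) (funext fun o => ?_)) <;>
    refine ite_congr rfl (fun _ => rfl) fun hS => ?_
  · rw [he']
    exact (add_zero _).symm.trans <| (congrArg _ (h₁ o hS).symm).trans (share₁_add ..).symm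
  · rw [he']
    exact (add_zero _).symm.trans <| (congrArg _ (h₂ o hS).symm).trans (share₂_add ..).symm

variable [MeasurableSpace E] [MeasurableAdd₂ E]

lemma measurable_share₁ (S : Idx) :
    Measurable fun z : E × (Label → E) × E => share₁ S z.1 z.2.1 z.2.2 := by
  rcases S with ⟨B, _ | _ | _⟩ <;> simp only [share₁] <;> fun_prop

lemma measurable_share₂ (S : Idx) :
    Measurable fun z : E × (Label → E) × E => share₂ S z.1 z.2.1 z.2.2 := by
  rcases S with ⟨B, _ | _ | _⟩ <;> simp only [share₂] <;> fun_prop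

lemma measurable_view (S : Idx) : Measurable fun z : (Option Idx → E) ×
    ((Label → ℝ × (Option Idx → E)) × (Option Idx → E)) => view S z.1 z.2 := by
  have hshare (o : Option Idx) : Measurable fun z : (Option Idx → E) ×
      ((Label → ℝ × (Option Idx → E)) × (Option Idx → E)) =>
        (z.1 o, (fun i => (z.2.1 i).2 o), z.2.2 o) := by fun_prop
  refine Measurable.prodMk (measurable_pi_lambda _ fun i => ?_)
    ((measurable_pi_lambda _ fun o => ?_).prodMk (measurable_pi_lambda _ fun o => ?_))
  · exact Measurable.ite (.const _) (by fun_prop) measurable_const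
  · exact Measurable.ite (.const _) measurable_const ((measurable_share₁ _).comp (hshare o))
  · exact Measurable.ite (.const _) measurable_const ((measurable_share₂ _).comp (hshare o))

lemma measurable_view_right (S : Idx) (e : Option Idx → E) : Measurable (view S e) :=
  (measurable_view S).comp measurable_prodMk_left

variable {ν : Measure ℝ} [IsProbabilityMeasure ν] {m : Measure E} [IsProbabilityMeasure m]
  [m.IsAddLeftInvariant] {φ : ℝ → Option Idx → E}

/-- The law of a variable, replaced by `0` unless it is observed, and its pads. -/
def maskedPadLaw (ν : Measure ℝ) (φ : ℝ → Option Idx → E) (A : Finset Label) (i : Label) :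
    Measure (ℝ × (Option Idx → E)) :=
  ν.map fun t => (if i ∈ A then t else 0, φ t)

omit [AddCommGroup E] [MeasurableAdd₂ E] in
lemma measurable_masked (hφ : Measurable φ) (A : Finset Label) (i : Label) :
    Measurable fun t => (if i ∈ A then t else 0, φ t) :=
  (Measurable.ite (.const _) measurable_id measurable_const).prodMk hφ

omit [IsProbabilityMeasure ν] in
lemma measurePreserving_add_maskedPadLaw (hφ : Measurable φ)
    (hν : ν.map φ = Measure.pi fun _ => m) {A : Finset Label} {d : Label → Option Idx → E}
    (hd : ∀ i ∈ A, d i = 0) (i : Label) :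
    MeasurePreserving (fun x : ℝ × (Option Idx → E) => (x.1, x.2 + d i))
      (maskedPadLaw ν φ A i) (maskedPadLaw ν φ A i) := by
  by_cases hi : i ∈ A
  · simp only [hd i hi, add_zero]
    exact .id _
  · have hlaw : maskedPadLaw ν φ A i = (Measure.dirac 0).prod (Measure.pi fun _ => m) := by
      rw [Measure.dirac_prod, ← hν, Measure.map_map measurable_prodMk_left hφ]
      simp only [maskedPadLaw, hi, if_false]
      rfl
    rw [hlaw]
    exact (MeasurePreserving.id _).prod (measurePreserving_add_right _ _)

omit [m.IsAddLeftInvariant] in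
lemma map_view_masked (hφ : Measurable φ) (S : Idx) (e : Option Idx → E) :
    ((Measure.pi fun _ : Label => ν).prod (Measure.pi fun _ : Option Idx => m)).map
        (fun y => view S e (fun i => (y.1 i, φ (y.1 i)), y.2)) =
      ((Measure.pi (maskedPadLaw ν φ S.1)).prod (Measure.pi fun _ => m)).map (view S e) := by
  have hmask : ∀ i, MeasurePreserving (fun t => (if i ∈ S.1 then t else 0, φ t)) ν
      (maskedPadLaw ν φ S.1 i) := fun i => ⟨measurable_masked hφ _ _, rfl⟩
  have hprob : ∀ i, IsProbabilityMeasure (maskedPadLaw ν φ S.1 i) := fun i =>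
    Measure.isProbabilityMeasure_map (measurable_masked hφ _ _).aemeasurable
  have hprod := (measurePreserving_pi (fun _ => ν) _ hmask).prod
    (.id (Measure.pi fun _ : Option Idx => m))
  rw [← hprod.map_eq, Measure.map_map (measurable_view_right S e) hprod.measurable]
  congr 1
  funext y
  refine Prod.ext (funext fun i => ?_) rfl
  by_cases hi : i ∈ S.1 <;> simp [view, hi]

lemma map_view_congr (hφ : Measurable φ) (hν : ν.map φ = Measure.pi fun _ => m) (S : Idx)
    {e e' : Option Idx → E} (h : ∀ o, Visible S o → e o = e' o) :
    ((Measure.pi fun _ : Label => ν).prod (Measure.pi fun _ : Option Idx => m)).map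
        (fun y => view S e (fun i => (y.1 i, φ (y.1 i)), y.2)) =
      ((Measure.pi fun _ : Label => ν).prod (Measure.pi fun _ : Option Idx => m)).map
        (fun y => view S e' (fun i => (y.1 i, φ (y.1 i)), y.2)) := by
  obtain ⟨d, d', hd, hview⟩ := exists_view_eq_view_add S e e' h
  have hprob : ∀ i, IsProbabilityMeasure (maskedPadLaw ν φ S.1 i) := fun i =>
    Measure.isProbabilityMeasure_map (measurable_masked hφ _ _).aemeasurable
  have hshift := (measurePreserving_pi _ _ (measurePreserving_add_maskedPadLaw hφ hν hd)).prod
    (measurePreserving_add_right (Measure.pi fun _ : Option Idx => m) d')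
  rw [map_view_masked hφ, map_view_masked hφ]
  conv_rhs => rw [← hshift.map_eq, Measure.map_map (measurable_view_right S e') hshift.measurable]
  exact congrArg (Measure.map · _) (funext hview)

end Pads

/-! ### Profiles -/

/-- The channel input together with, for each set `S` of observed variables, the conditional
probabilities of the output letters given these variables. The alphabets are numbered, so that the
space lies in the lowest universe whatever the alphabets of the channel are. -/
abbrev ProfileSpace (N a b : ℕ) := Fin N × (Idx → (Fin a ⊕ Fin b) → unitInterval)

section Profile

variable {N a b : ℕ} {ι : Type*}

/-- Conditional entropy, given the variables in `(A, s)`, of an output whose letters are numbered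
by `f`. -/
def profileEntropy [Fintype ι] (f : ι → Fin a ⊕ Fin b) (P : Measure (ProfileSpace N a b))
    (A : Finset Label) (s : Side) : ℝ :=
  ∫ k, ∑ y, Real.negMulLog (k.2 (A, s) (f y)) ∂P

variable [NeZero N]

open Classical in
/-- The part of `k` that is determined by the variables in `S`, the rest being replaced by `0`. -/
def mask (S : Idx) (k : ProfileSpace N a b) : ProfileSpace N a b :=
  (if Visible S none then k.1 else 0, fun S' => if Visible S (some S') then k.2 S' else 0)

lemma continuous_mask (S : Idx) : Continuous (mask S : ProfileSpace N a b → _) := by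
  refine Continuous.prodMk ?_ (continuous_pi fun S' => ?_) <;> split_ifs <;> fun_prop

/-- `P` is the law of the input and the conditional probabilities of the output letters of some
random variables, for a channel with letter probabilities `q`: the coordinate `S` is the conditional
expectation of `q` given the coordinates determined by the variables in `S`. Testing with continuous
functions makes this a closed condition on `P`. -/
def IsProfile (q : Fin N → (Fin a ⊕ Fin b) → ℝ) (P : Measure (ProfileSpace N a b)) : Prop :=
  ∀ (S : Idx) (j : Fin a ⊕ Fin b) (g : BoundedContinuousFunction (ProfileSpace N a b) ℝ),
    ∫ k, q k.1 j * g (mask S k) ∂P = ∫ k, (k.2 S j : ℝ) * g (mask S k) ∂P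

lemma integral_mul_comp_eq_of_forall_continuous {α β : Type*} [MeasurableSpace α]
    [MeasurableSpace β] [TopologicalSpace β] [BorelSpace β] [HasOuterApproxClosed β]
    {P : Measure α} {f₁ f₂ : α → ℝ} (hf₁ : Measurable f₁) (hf₂ : Measurable f₂)
    (h₁ : Integrable f₁ P) (h₂ : Integrable f₂ P) (h₁₀ : 0 ≤ f₁) (h₂₀ : 0 ≤ f₂) {φ : α → β}
    (hφ : Measurable φ) (h : ∀ g : BoundedContinuousFunction β ℝ,
      ∫ x, f₁ x * g (φ x) ∂P = ∫ x, f₂ x * g (φ x) ∂P)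
    {L : β → ℝ} (hL : Measurable L) :
    ∫ x, f₁ x * L (φ x) ∂P = ∫ x, f₂ x * L (φ x) ∂P := by
  have hdens {f : α → ℝ} (hf : Measurable f) (hf₀ : 0 ≤ f) {g : β → ℝ} (hg : Measurable g) :
      ∫ y, g y ∂((P.withDensity fun x => ENNReal.ofReal (f x)).map φ) =
        ∫ x, f x * g (φ x) ∂P := by
    rw [integral_map hφ.aemeasurable hg.aestronglyMeasurable,
      integral_withDensity_eq_integral_toReal_smul hf.ennreal_ofReal (by simp)]
    simp only [ENNReal.toReal_ofReal (hf₀ _), smul_eq_mul]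
  have := isFiniteMeasure_withDensity_ofReal h₁.hasFiniteIntegral
  have := isFiniteMeasure_withDensity_ofReal h₂.hasFiniteIntegral
  have heq : (P.withDensity fun x => ENNReal.ofReal (f₁ x)).map φ =
      (P.withDensity fun x => ENNReal.ofReal (f₂ x)).map φ :=
    ext_of_forall_integral_eq_of_IsFiniteMeasure fun g => by
      rw [hdens hf₁ h₁₀ g.continuous.measurable, hdens hf₂ h₂₀ g.continuous.measurable, h]
  rw [← hdens hf₁ h₁₀ hL, heq, hdens hf₂ h₂₀ hL]

omit [NeZero N] in
lemma measurable_comp_fst (f : Fin N → ℝ) : Measurable fun k : ProfileSpace N a b => f k.1 :=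
  (Measurable.of_discrete (f := f)).comp measurable_fst

omit [NeZero N] in
lemma integrable_comp_fst (P : Measure (ProfileSpace N a b)) [IsFiniteMeasure P] (f : Fin N → ℝ) :
    Integrable (fun k : ProfileSpace N a b => f k.1) P :=
  .of_bound (measurable_comp_fst f).aestronglyMeasurable (∑ x, ‖f x‖) (.of_forall fun _ =>
    Finset.single_le_sum (f := fun x => ‖f x‖) (fun _ _ => norm_nonneg _) (Finset.mem_univ _))

omit [NeZero N] in
lemma integrable_letterProb (P : Measure (ProfileSpace N a b)) [IsFiniteMeasure P] (S : Idx)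
    (j : Fin a ⊕ Fin b) : Integrable (fun k : ProfileSpace N a b => (k.2 S j : ℝ)) P :=
  .of_bound (Measurable.aestronglyMeasurable (by fun_prop)) 1 (.of_forall fun k => by
    rw [Real.norm_of_nonneg (k.2 S j).2.1]
    exact (k.2 S j).2.2)

lemma IsProfile.integral_eq {q : Fin N → (Fin a ⊕ Fin b) → ℝ} {P : Measure (ProfileSpace N a b)}
    [IsFiniteMeasure P] (h : IsProfile q P) (hq : ∀ x j, 0 ≤ q x j) (S : Idx)
    (j : Fin a ⊕ Fin b) {L : ProfileSpace N a b → ℝ} (hL : Measurable L)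
    (hLmask : ∀ k, L (mask S k) = L k) :
    ∫ k, q k.1 j * L k ∂P = ∫ k, (k.2 S j : ℝ) * L k ∂P := by
  simpa only [hLmask] using integral_mul_comp_eq_of_forall_continuous
    (measurable_comp_fst (q · j)) (by fun_prop) (integrable_comp_fst P (q · j))
    (integrable_letterProb P S j) (fun _ => hq _ j) (fun k => (k.2 S j).2.1)
    (continuous_mask S).measurable (h S j) hL

end Profile

/-! ### Encodings and conditional entropies for the realization of profiles -/

lemma uncountable_unitAddCircle : Uncountable UnitAddCircle := by
  refine ⟨fun h => ?_⟩
  have hcount : (Set.Ico (0 : ℝ) (0 + 1)).Countable :=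
    (AddCircle.equivIco (1 : ℝ) 0).symm.injective.countable
  simpa using hcount.measure_zero volume

lemma exists_measurableEmbedding_unitAddCircle (α : Type*) [MeasurableSpace α]
    [StandardBorelSpace α] : ∃ f : α → UnitAddCircle, MeasurableEmbedding f :=
  have := uncountable_unitAddCircle
  have e : ℝ ≃ᵐ UnitAddCircle := PolishSpace.measurableEquivOfNotCountable
    not_countable not_countable
  ⟨_, e.measurableEmbedding.comp (measurableEmbedding_embeddingReal α)⟩

lemma exists_map_restrict_Icc_eq {α : Type*} [MeasurableSpace α] [StandardBorelSpace α]
    [Nonempty α] (m : Measure α) [IsProbabilityMeasure m] :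
    ∃ φ : ℝ → α, Measurable φ ∧ (volume.restrict (Set.Icc (0 : ℝ) 1)).map φ = m := by
  obtain ⟨f, hf, rfl⟩ := m.exists_measurable_map_eq
  have hφ : Measurable fun t => f (Set.projIcc 0 1 zero_le_one t) :=
    hf.comp continuous_projIcc.measurable
  refine ⟨_, hφ, ?_⟩
  have hcoe : Measure.map (Subtype.val : unitInterval → ℝ) volume =
      volume.restrict (Set.Icc (0 : ℝ) 1) :=
    unitInterval.measurePreserving_coe.map_eq
  rw [← hcoe, Measure.map_map hφ measurable_subtype_coe]
  congr 1
  funext t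
  simp [Set.projIcc_val]

lemma setIntegral_prod_fst {α β : Type*} [MeasurableSpace α] [MeasurableSpace β] (μ : Measure α)
    (ν : Measure β) [IsFiniteMeasure μ] [IsFiniteMeasure ν] {f : α → ℝ}
    (hf : Integrable f μ) {s : Set (α × β)} (hs : MeasurableSet s) :
    ∫ z in s, f z.1 ∂(μ.prod ν) = ∫ x, f x * ν.real (Prod.mk x ⁻¹' s) ∂μ := by
  rw [← integral_indicator hs, integral_prod _ ((hf.comp_fst ν).indicator hs)]
  congr 1 with x
  change ∫ y, (Prod.mk x ⁻¹' s).indicator (fun _ => f x) y ∂ν = _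
  rw [integral_indicator_const _ (hs.preimage measurable_prodMk_left), smul_eq_mul, mul_comm]

lemma map_compProd_prodMk {α β γ δ : Type*} [MeasurableSpace α] [MeasurableSpace β]
    [MeasurableSpace γ] [MeasurableSpace δ] (μ : Measure α) [SFinite μ] (κ : Kernel α β)
    [IsSFiniteKernel κ] (η : Kernel γ δ) [IsSFiniteKernel η] {g : α → γ} {h : β → δ}
    (hg : Measurable g) (hh : Measurable h) (hη : ∀ x, (κ x).map h = η (g x)) :
    (μ ⊗ₘ κ).map (fun p => (g p.1, h p.2)) = μ.map g ⊗ₘ η := by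
  ext s hs
  rw [Measure.map_apply (by fun_prop) hs, Measure.compProd_apply (hs.preimage (by fun_prop)),
    Measure.compProd_apply hs, lintegral_map (Kernel.measurable_kernel_prodMk_left hs) hg]
  refine lintegral_congr fun x => ?_
  rw [← hη, Measure.map_apply hh (hs.preimage measurable_prodMk_left)]
  rfl

lemma condEntropy_eq_of_setIntegral {Ω 𝒴 : Type*} {m mΩ : MeasurableSpace Ω} [Fintype 𝒴]
    [MeasurableSpace 𝒴] [MeasurableSingletonClass 𝒴] {μ : Measure Ω} [IsFiniteMeasure μ]
    {Y : Ω → 𝒴} (hY : Measurable Y) (hm : m ≤ mΩ) {p : 𝒴 → Ω → ℝ}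
    (hp : ∀ y, Measurable[m] (p y)) (hpi : ∀ y, Integrable (p y) μ)
    (h : ∀ y (s : Set Ω), MeasurableSet[m] s → ∫ ω in s, p y ω ∂μ = μ.real (s ∩ Y ⁻¹' {y})) :
    condEntropy μ Y m = ∫ ω, ∑ y, Real.negMulLog (p y ω) ∂μ := by
  have hae : ∀ y, p y =ᵐ[μ] μ⟦Y ⁻¹' {y} | m⟧ := by
    intro y
    have hYy : MeasurableSet (Y ⁻¹' {y}) := hY (measurableSet_singleton y)
    refine ae_eq_condExp_of_forall_setIntegral_eq hm ((integrable_const _).indicator hYy)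
      (fun s _ _ => (hpi y).integrableOn) (fun s hs _ => ?_)
      (hp y).stronglyMeasurable.aestronglyMeasurable
    rw [h y s hs, integral_indicator hYy, setIntegral_const, measureReal_restrict_apply hYy,
      Set.inter_comm, smul_eq_mul, mul_one]
  refine integral_congr_ae ?_
  filter_upwards [ae_all_iff.2 hae] with ω hω
  simp only [← hω]

lemma condEntropy_compProd {Z O 𝒴 : Type*} {m mZ : MeasurableSpace Z} [MeasurableSpace O]
    [Fintype 𝒴] [MeasurableSpace 𝒴] [MeasurableSingletonClass 𝒴] (hm : m ≤ mZ) (ν : Measure Z)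
    [IsFiniteMeasure ν] (η : Kernel Z O) [IsMarkovKernel η] {Y : O → 𝒴} (hY : Measurable Y)
    {p : 𝒴 → Z → ℝ} (hp : ∀ y, Measurable[m] (p y)) (hpi : ∀ y, Integrable (p y) ν)
    (h : ∀ y (s : Set Z), MeasurableSet[m] s →
      ∫ z in s, p y z ∂ν = ∫ z in s, (η z).real (Y ⁻¹' {y}) ∂ν) :
    condEntropy (ν ⊗ₘ η) (fun ω => Y ω.2) (m.comap Prod.fst) =
      ∫ z, ∑ y, Real.negMulLog (p y z) ∂ν := by
  have hfst : (ν ⊗ₘ η).map Prod.fst = ν := Measure.fst_compProd ν η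
  have hpm : ∀ y, Measurable (p y) := fun y => (hp y).mono hm le_rfl
  have hYsnd : Measurable fun ω : Z × O => Y ω.2 := hY.comp measurable_snd
  have hmfst : m.comap Prod.fst ≤ (inferInstance : MeasurableSpace (Z × O)) :=
    (MeasurableSpace.comap_mono hm).trans measurable_fst.comap_le
  have hent : Measurable fun z => ∑ y, Real.negMulLog (p y z) :=
    Finset.measurable_fun_sum _ fun y _ => Real.continuous_negMulLog.measurable.comp (hpm y)
  rw [condEntropy_eq_of_setIntegral hYsnd hmfst (p := fun y ω => p y ω.1)
    (fun y => (hp y).comp (comap_measurable _))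
    (fun y => (hfst.symm ▸ hpi y : Integrable (p y) _).comp_measurable measurable_fst)]
  · nth_rw 2 [← hfst]
    rw [integral_map measurable_fst.aemeasurable hent.aestronglyMeasurable]
  · rintro y _ ⟨s, hs, rfl⟩
    have hYy : MeasurableSet (Y ⁻¹' {y}) := hY (measurableSet_singleton y)
    have hprod : Prod.fst ⁻¹' s ∩ (fun ω : Z × O => Y ω.2) ⁻¹' {y} = s ×ˢ (Y ⁻¹' {y}) := rfl
    rw [← setIntegral_map (hm s hs) (hpm y).aestronglyMeasurable measurable_fst.aemeasurable, hfst,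
      h y s hs, hprod, measureReal_def, Measure.compProd_apply_prod (hm s hs) hYy,
      ← integral_toReal (Kernel.measurable_coe η hYy).aemeasurable
        (.of_forall fun z => measure_lt_top _ _)]
    rfl

/-! ### Realization of profiles by real-valued random variables -/

/-- One point of the circle for every secret: all the secrets, or all the pads known to a variable,
or all the shares handed to `W₁` or `W₂`. -/
abbrev PadSpace := Option Idx → UnitAddCircle

/-- The sample space, without the outputs of the channel, on which a profile is realized: the
profile, the values of `T`, `U`, `V`, and the pads shared by `W₁` and `W₂` only. -/
abbrev RealizationSpace (N a b : ℕ) := ProfileSpace N a b × ((Label → ℝ) × PadSpace)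

section Realization

/-- An injection of a standard Borel space into the circle, whose points can be hidden by pads. -/
def encodeCircle (α : Type*) [MeasurableSpace α] [StandardBorelSpace α] : α → UnitAddCircle :=
  (exists_measurableEmbedding_unitAddCircle α).choose

lemma measurableEmbedding_encodeCircle (α : Type*) [MeasurableSpace α] [StandardBorelSpace α] :
    MeasurableEmbedding (encodeCircle α) :=
  (exists_measurableEmbedding_unitAddCircle α).choose_spec

/-- The law of the pads. -/
abbrev padLaw : Measure PadSpace := Measure.pi fun _ => AddCircle.haarAddCircle

/-- The pads known to a variable which takes the value `t`; they are all extracted from `t`. -/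
def padsOfReal : ℝ → PadSpace := (exists_map_restrict_Icc_eq padLaw).choose

@[fun_prop]
lemma measurable_padsOfReal : Measurable padsOfReal :=
  (exists_map_restrict_Icc_eq padLaw).choose_spec.1

lemma map_padsOfReal : (volume.restrict (Set.Icc 0 1)).map padsOfReal = padLaw :=
  (exists_map_restrict_Icc_eq padLaw).choose_spec.2

instance : IsProbabilityMeasure (volume.restrict (Set.Icc (0 : ℝ) 1)) := ⟨by simp⟩

variable {N a b : ℕ}

/-- The secrets to be shared: the channel input and the conditional probabilities of the output
letters given the variables in `S`, for all `S`. -/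
def secrets (k : ProfileSpace N a b) : PadSpace
  | none => encodeCircle _ k.1
  | some S => encodeCircle _ (k.2 S)

@[fun_prop]
lemma measurable_secrets : Measurable (secrets : ProfileSpace N a b → PadSpace) := by
  refine measurable_pi_lambda _ fun o => ?_
  rcases o with _ | S
  · exact (measurableEmbedding_encodeCircle _).measurable.comp measurable_fst
  · exact (measurableEmbedding_encodeCircle _).measurable.comp
      ((measurable_pi_apply S).comp measurable_snd)

lemma secrets_mask [NeZero N] {S : Idx} (k : ProfileSpace N a b) {o : Option Idx}
    (ho : Visible S o) : secrets (mask S k) o = secrets k o := by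
  rcases o with _ | S' <;> simp [secrets, mask, ho]

/-- What is seen by the variables in `S`. -/
def realizedView (S : Idx) (z : RealizationSpace N a b) : (Label → ℝ) × PadSpace × PadSpace :=
  view S (secrets z.1) (fun i => (z.2.1 i, padsOfReal (z.2.1 i)), z.2.2)

lemma measurable_realizedView (S : Idx) :
    Measurable (realizedView S : RealizationSpace N a b → _) := by
  have hpads : Measurable fun (z : RealizationSpace N a b) (i : Label) =>
      (z.2.1 i, padsOfReal (z.2.1 i)) :=
    measurable_pi_lambda _ fun i => Measurable.prodMk (by fun_prop) (by fun_prop)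
  exact (measurable_view S).comp
    ((measurable_secrets.comp measurable_fst).prodMk (hpads.prodMk (by fun_prop)))

/-- The first shares of all the secrets. -/
def realizedShares₁ (z : RealizationSpace N a b) : PadSpace := fun o =>
  share₁ (owners o) (secrets z.1 o) (fun i => padsOfReal (z.2.1 i) o) (z.2.2 o)

/-- The second shares of all the secrets. -/
def realizedShares₂ (z : RealizationSpace N a b) : PadSpace := fun o =>
  share₂ (owners o) (secrets z.1 o) (fun i => padsOfReal (z.2.1 i) o) (z.2.2 o)

/-- The random variable `W₁`, which consists of the first shares. -/
def realizedW₁ (z : RealizationSpace N a b) : ℝ := embeddingReal PadSpace (realizedShares₁ z)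

/-- The random variable `W₂`, which consists of the second shares. -/
def realizedW₂ (z : RealizationSpace N a b) : ℝ := embeddingReal PadSpace (realizedShares₂ z)

/-- The `σ`-algebra generated by the variables in `(A, s)`. -/
abbrev realizedSigma (A : Finset Label) (s : Side) : MeasurableSpace (RealizationSpace N a b) :=
  viewSigma (fun z => z.2.1 .t) (fun z => z.2.1 .u) (fun z => z.2.1 .v) realizedW₁ realizedW₂ A s

lemma family_realized (i : Label) :
    family (fun z : RealizationSpace N a b => z.2.1 .t) (fun z => z.2.1 .u) (fun z => z.2.1 .v) i =
      fun z => z.2.1 i := by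
  cases i <;> rfl

lemma realizedSigma_le_comap (A : Finset Label) (s : Side) :
    realizedSigma A s ≤ MeasurableSpace.comap
      (realizedView (A, s) : RealizationSpace N a b → _) inferInstance := by
  have hview := comap_measurable (m := inferInstance)
    (realizedView (A, s) : RealizationSpace N a b → _)
  refine viewSigma_le (fun i hi => ?_) (fun hs => ?_) (fun hs => ?_)
  · have hfst : (fun z : RealizationSpace N a b => z.2.1 i) =
        fun z => (realizedView (A, s) z).1 i :=
      funext fun z => by simp [realizedView, view, hi]
    rw [family_realized, hfst]
    exact (measurable_pi_apply i).comp hview.fst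
  · have hW₁ : realizedW₁ = fun z : RealizationSpace N a b =>
        embeddingReal PadSpace (realizedView (A, s) z).2.1 :=
      funext fun z => by simp only [realizedView, view, hs, if_false]; rfl
    exact hW₁ ▸ (measurable_embeddingReal _).comp hview.snd.fst
  · have hW₂ : realizedW₂ = fun z : RealizationSpace N a b =>
        embeddingReal PadSpace (realizedView (A, s) z).2.2 :=
      funext fun z => by simp only [realizedView, view, hs, if_false]; rfl
    exact hW₂ ▸ (measurable_embeddingReal _).comp hview.snd.snd

lemma realizedSigma_le (A : Finset Label) (s : Side) :
    realizedSigma A s ≤ (inferInstance : MeasurableSpace (RealizationSpace N a b)) :=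
  (realizedSigma_le_comap A s).trans (measurable_realizedView (A, s)).comap_le

lemma measurable_realizedW₁ : Measurable (realizedW₁ : RealizationSpace N a b → ℝ) :=
  (measurable_viewSigma_W₁ _ _ ∅ (by decide)).mono (realizedSigma_le ∅ .one) le_rfl

lemma measurable_realizedW₂ : Measurable (realizedW₂ : RealizationSpace N a b → ℝ) :=
  (measurable_viewSigma_W₂ _ _ ∅ (by decide)).mono (realizedSigma_le ∅ .two) le_rfl

/-- The variables a secret belongs to suffice to remove all its pads. -/
lemma measurable_realizedSigma_secrets {A : Finset Label} {s : Side} {o : Option Idx}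
    (ho : Visible (A, s) o) :
    Measurable[realizedSigma A s] fun z : RealizationSpace N a b => secrets z.1 o := by
  have hpads : Measurable[realizedSigma A s] fun z : RealizationSpace N a b =>
      ∑ i ∈ (owners o).1, padsOfReal (z.2.1 i) o :=
    Finset.measurable_fun_sum _ fun i hi =>
      ((measurable_pi_apply o).comp measurable_padsOfReal).comp
        (family_realized i ▸ measurable_viewSigma_family _ _ s (ho.1 hi))
  have hshare₁ (hs : s ≠ .two) : Measurable[realizedSigma A s] fun z : RealizationSpace N a b =>
      realizedShares₁ z o := (measurable_pi_apply o).comp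
    ((measurableEmbedding_embeddingReal PadSpace).measurable_comp_iff.1
      (measurable_viewSigma_W₁ realizedW₁ realizedW₂ A hs))
  have hshare₂ (hs : s ≠ .one) : Measurable[realizedSigma A s] fun z : RealizationSpace N a b =>
      realizedShares₂ z o := (measurable_pi_apply o).comp
    ((measurableEmbedding_embeddingReal PadSpace).measurable_comp_iff.1
      (measurable_viewSigma_W₂ realizedW₁ realizedW₂ A hs))
  obtain ⟨-, hside⟩ := ho
  rcases howners : owners o with ⟨B, _ | _ | _⟩ <;>
    simp only [howners, realizedShares₁, realizedShares₂, share₁, share₂] at *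
  · simpa using (hshare₁ (by aesop)).fun_sub hpads
  · simpa using (hshare₂ (by aesop)).fun_sub hpads
  · simpa using ((hshare₁ (by aesop)).fun_sub (hshare₂ (by aesop))).fun_sub hpads

lemma measurable_realizedSigma_letterProb (A : Finset Label) (s : Side) (j : Fin a ⊕ Fin b) :
    Measurable[realizedSigma A s] fun z : RealizationSpace N a b => (z.1.2 (A, s) j : ℝ) := by
  have hsecret := measurable_realizedSigma_secrets (N := N) (a := a) (b := b)
    (o := some (A, s)) ⟨subset_rfl, .inl rfl⟩
  exact measurable_subtype_coe.comp ((measurable_pi_apply j).comp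
    ((measurableEmbedding_encodeCircle _).measurable_comp_iff.1 hsecret))

lemma measurable_realizedSigma_input :
    Measurable[realizedSigma Finset.univ .both] fun z : RealizationSpace N a b => z.1.1 :=
  (measurableEmbedding_encodeCircle _).measurable_comp_iff.1
    (measurable_realizedSigma_secrets (o := none) ⟨subset_rfl, .inl rfl⟩)

/-- The joint law of a profile with law `P`, of the independent uniform `T`, `U`, `V` and of the
pads shared by `W₁` and `W₂`. -/
def realizationMeasure (P : Measure (ProfileSpace N a b)) : Measure (RealizationSpace N a b) :=
  P.prod ((Measure.pi fun _ => volume.restrict (Set.Icc 0 1)).prod padLaw)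

instance (P : Measure (ProfileSpace N a b)) [IsFiniteMeasure P] :
    IsFiniteMeasure (realizationMeasure P) :=
  inferInstanceAs (IsFiniteMeasure (P.prod _))

instance (P : Measure (ProfileSpace N a b)) [IsProbabilityMeasure P] :
    IsProbabilityMeasure (realizationMeasure P) :=
  inferInstanceAs (IsProbabilityMeasure (P.prod _))

lemma IsProfile.setIntegral_realizedSigma [NeZero N] {q : Fin N → (Fin a ⊕ Fin b) → ℝ}
    {P : Measure (ProfileSpace N a b)} [IsFiniteMeasure P] (hP : IsProfile q P)
    (hq : ∀ x j, 0 ≤ q x j) {A : Finset Label} {s : Side} (j : Fin a ⊕ Fin b)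
    {t : Set (RealizationSpace N a b)} (ht : MeasurableSet[realizedSigma A s] t) :
    ∫ z in t, (z.1.2 (A, s) j : ℝ) ∂realizationMeasure P =
      ∫ z in t, q z.1.1 j ∂realizationMeasure P := by
  obtain ⟨D, hD, rfl⟩ := realizedSigma_le_comap A s t ht
  have hviewD : MeasurableSet (realizedView (A, s) ⁻¹' D : Set (RealizationSpace N a b)) :=
    measurable_realizedView _ hD
  rw [realizationMeasure, setIntegral_prod_fst _ _ (integrable_letterProb P (A, s) j) hviewD,
    setIntegral_prod_fst _ _ (integrable_comp_fst P (q · j)) hviewD]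
  refine (hP.integral_eq hq (A, s) j (measurable_measure_prodMk_left hviewD).ennreal_toReal
    fun k => ?_).symm
  have hmap (k : ProfileSpace N a b) := map_measureReal_apply
    (μ := (Measure.pi fun _ : Label => volume.restrict (Set.Icc (0 : ℝ) 1)).prod padLaw)
    ((measurable_realizedView (A, s)).comp (measurable_prodMk_left (x := k))) hD
  exact (hmap (mask (A, s) k)).symm.trans <| (congrArg (Measure.real · D) <|
    map_view_congr measurable_padsOfReal map_padsOfReal (A, s) fun o ho =>
      secrets_mask k ho).trans (hmap k)

lemma profileEntropy_comp_equiv {ι ι' : Type*} [Fintype ι] [Fintype ι'] (e : ι' ≃ ι)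
    (f : ι → Fin a ⊕ Fin b) (P : Measure (ProfileSpace N a b)) :
    profileEntropy (f ∘ e) P = profileEntropy f P := by
  funext A s
  exact integral_congr_ae (.of_forall fun k =>
    e.sum_comp fun y => Real.negMulLog (k.2 (A, s) (f y)))

end Realization

section Channel

variable {𝒳 𝒴₁ 𝒴₂ : Type*} [MeasurableSpace 𝒳]
  [Finite 𝒴₁] [MeasurableSpace 𝒴₁] [MeasurableSingletonClass 𝒴₁]
  [Finite 𝒴₂] [MeasurableSpace 𝒴₂] [MeasurableSingletonClass 𝒴₂]
  {N a b : ℕ} (κ : Kernel 𝒳 (𝒴₁ × 𝒴₂)) (eX : Fin N ≃ 𝒳) (e₁ : Fin a ≃ 𝒴₁) (e₂ : Fin b ≃ 𝒴₂)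

/-- The pairs of output letters in which the letter with the number `j` occurs; `.inl` numbers the
letters of the first output, `.inr` those of the second. -/
def letterSet : Fin a ⊕ Fin b → Set (𝒴₁ × 𝒴₂)
  | .inl y => {p | e₁.symm p.1 = y}
  | .inr y => {p | e₂.symm p.2 = y}

/-- The probabilities of the letters of both outputs of the channel, for numbered alphabets. -/
def outputProb (x : Fin N) (j : Fin a ⊕ Fin b) : ℝ :=
  (κ (eX x)).real (letterSet e₁ e₂ j)

/-- The channel from the realized variables to the numbers of the output letters. -/
def realizationKernel : Kernel (RealizationSpace N a b) (Fin a × Fin b) :=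
  (κ.map (Prod.map e₁.symm e₂.symm)).comap (fun z => eX z.1.1)
    (Measurable.of_discrete.comp (measurable_fst.comp measurable_fst))

lemma realizationKernel_apply (z : RealizationSpace N a b) :
    realizationKernel κ eX e₁ e₂ z = (κ (eX z.1.1)).map (Prod.map e₁.symm e₂.symm) := by
  rw [realizationKernel, Kernel.comap_apply, Kernel.map_apply _ Measurable.of_discrete]

variable [IsMarkovKernel κ]

instance : IsMarkovKernel (realizationKernel κ eX e₁ e₂) :=
  have := Kernel.IsMarkovKernel.map κ
    (f := Prod.map e₁.symm e₂.symm) Measurable.of_discrete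
  inferInstanceAs (IsMarkovKernel (Kernel.comap _ _ _))

/-- The joint law of the variables realizing `P` and the numbers of the output letters. -/
abbrev realizationLaw (P : Measure (ProfileSpace N a b)) :
    Measure (RealizationSpace N a b × (Fin a × Fin b)) :=
  realizationMeasure P ⊗ₘ realizationKernel κ eX e₁ e₂

variable {κ eX e₁ e₂} {P : Measure (ProfileSpace N a b)}

lemma IsProfile.condEntropy_realizationLaw [NeZero N] [IsFiniteMeasure P]
    (hP : IsProfile (outputProb κ eX e₁ e₂) P) {𝒴 : Type*} [Fintype 𝒴] [MeasurableSpace 𝒴]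
    [MeasurableSingletonClass 𝒴] {f : 𝒴 → Fin a ⊕ Fin b} {Y : Fin a × Fin b → 𝒴}
    (hY : ∀ x y, (κ (eX x)).real (Prod.map e₁.symm e₂.symm ⁻¹' (Y ⁻¹' {y})) =
      outputProb κ eX e₁ e₂ x (f y)) (A : Finset Label) (s : Side) :
    condEntropy (realizationLaw κ eX e₁ e₂ P) (fun ω => Y ω.2)
        ((realizedSigma A s).comap Prod.fst) = profileEntropy f P A s := by
  have hq : ∀ x j, 0 ≤ outputProb κ eX e₁ e₂ x j := fun _ _ => measureReal_nonneg
  have hκ (z : RealizationSpace N a b) (y : 𝒴) :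
      (realizationKernel κ eX e₁ e₂ z).real (Y ⁻¹' {y}) = outputProb κ eX e₁ e₂ z.1.1 (f y) := by
    rw [realizationKernel_apply, map_measureReal_apply .of_discrete .of_discrete, hY]
  rw [condEntropy_compProd (realizedSigma_le A s) (realizationMeasure P)
    (realizationKernel κ eX e₁ e₂) (Y := Y) .of_discrete (p := fun y z => z.1.2 (A, s) (f y))
    (fun y => measurable_realizedSigma_letterProb A s (f y))
    (fun y => (integrable_letterProb P (A, s) (f y)).comp_fst _)
    (fun y t ht => by simpa only [hκ] using hP.setIntegral_realizedSigma hq (f y) ht)]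
  exact (integral_fun_fst fun k : ProfileSpace N a b =>
    ∑ y, Real.negMulLog (k.2 (A, s) (f y))).trans (by simp [profileEntropy])

lemma measurePreserving_realizationLaw [IsProbabilityMeasure P] :
    MeasurePreserving (fun ω : RealizationSpace N a b × (Fin a × Fin b) => ω.1.2.1)
      (realizationLaw κ eX e₁ e₂ P)
      (Measure.pi fun _ => volume.restrict (Set.Icc (0 : ℝ) 1)) :=
  have hfst : MeasurePreserving Prod.fst (realizationLaw κ eX e₁ e₂ P) (realizationMeasure P) :=
    ⟨measurable_fst, Measure.fst_compProd _ _⟩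
  measurePreserving_fst.comp (measurePreserving_snd.comp hfst)

lemma map_realizationLaw_label [IsProbabilityMeasure P] (i : Label) :
    (realizationLaw κ eX e₁ e₂ P).map (fun ω => ω.1.2.1 i) =
      volume.restrict (Set.Icc (0 : ℝ) 1) :=
  ((measurePreserving_eval _ i).comp measurePreserving_realizationLaw).map_eq

lemma family_realizationLaw :
    family (fun ω : RealizationSpace N a b × (Fin a × Fin b) => ω.1.2.1 .t)
      (fun ω => ω.1.2.1 .u) (fun ω => ω.1.2.1 .v) = fun i ω => ω.1.2.1 i := by
  funext i
  cases i <;> rfl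

lemma iIndepFun_realizationLaw [IsProbabilityMeasure P] :
    iIndepFun (fun i ω => ω.1.2.1 i) (realizationLaw κ eX e₁ e₂ P) := by
  rw [iIndepFun_iff_map_fun_eq_pi_map fun i => by fun_prop]
  simp only [map_realizationLaw_label]
  exact measurePreserving_realizationLaw.map_eq

lemma map_realizationLaw_eq_compProd [IsFiniteMeasure P] {α : Type*} [MeasurableSpace α]
    {g : RealizationSpace N a b → α} (hg : Measurable g) :
    (realizationLaw κ eX e₁ e₂ P).map (fun ω => ((g ω.1, eX ω.1.1.1), (e₁ ω.2.1, e₂ ω.2.2))) =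
      (realizationLaw κ eX e₁ e₂ P).map (fun ω => (g ω.1, eX ω.1.1.1)) ⊗ₘ
        Kernel.prodMkLeft α κ := by
  have hgX : Measurable fun z : RealizationSpace N a b => (g z, eX z.1.1) :=
    hg.prodMk (Measurable.of_discrete.comp (measurable_fst.comp measurable_fst))
  have hfst : (realizationLaw κ eX e₁ e₂ P).map (fun ω => (g ω.1, eX ω.1.1.1)) =
      (realizationMeasure P).map fun z => (g z, eX z.1.1) := by
    rw [← Measure.fst_compProd (realizationMeasure P) (realizationKernel κ eX e₁ e₂),
      Measure.fst, Measure.map_map hgX measurable_fst]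
    rfl
  rw [hfst]
  refine map_compProd_prodMk _ _ _ hgX (h := Prod.map e₁ e₂) .of_discrete fun z => ?_
  rw [Kernel.prodMkLeft_apply, realizationKernel_apply,
    Measure.map_map .of_discrete .of_discrete, Prod.map_comp_map, Equiv.self_comp_symm,
    Equiv.self_comp_symm, Prod.map_id, Measure.map_id]

end Channel

section Channel

variable {𝒳 𝒴₁ 𝒴₂ : Type*} [MeasurableSpace 𝒳]
  [Fintype 𝒴₁] [Nonempty 𝒴₁] [MeasurableSpace 𝒴₁] [MeasurableSingletonClass 𝒴₁]
  [Fintype 𝒴₂] [Nonempty 𝒴₂] [MeasurableSpace 𝒴₂] [MeasurableSingletonClass 𝒴₂]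
  {N a b : ℕ} [NeZero N]

theorem mem_restrictedOuterRegion_of_isProfile (κ : Kernel 𝒳 (𝒴₁ × 𝒴₂)) [IsMarkovKernel κ]
    (eX : Fin N ≃ 𝒳) (e₁ : Fin a ≃ 𝒴₁) (e₂ : Fin b ≃ 𝒴₂) (P : Measure (ProfileSpace N a b))
    [IsProbabilityMeasure P] (hP : IsProfile (outputProb κ eX e₁ e₂) P) {c₀ c₁ c₂ : ℝ}
    (hE : EntropyEquations (profileEntropy Sum.inl P) (profileEntropy Sum.inr P) c₀ c₁ c₂ 0)
    {R : ℝ × ℝ × ℝ} (hR : 0 ≤ R) (hRc : R ≤ (c₀, c₁, c₂)) : R ∈ restrictedOuterRegion κ := by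
  have hF (i : Label) : Measurable fun ω : RealizationSpace N a b × (Fin a × Fin b) =>
      ω.1.2.1 i := by fun_prop
  have hW₁ := measurable_realizedW₁ (N := N) (a := a) (b := b)
  have hW₂ := measurable_realizedW₂ (N := N) (a := a) (b := b)
  have hX : Measurable fun ω : RealizationSpace N a b × (Fin a × Fin b) => eX ω.1.1.1 :=
    Measurable.of_discrete.comp (by fun_prop)
  have hY₁ : Measurable fun ω : RealizationSpace N a b × (Fin a × Fin b) => e₁ ω.2.1 :=
    Measurable.of_discrete.comp (by fun_prop)
  have hY₂ : Measurable fun ω : RealizationSpace N a b × (Fin a × Fin b) => e₂ ω.2.2 :=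
    Measurable.of_discrete.comp (by fun_prop)
  have hentropy₁ := hP.condEntropy_realizationLaw (f := Sum.inl ∘ e₁.symm) (Y := fun p => e₁ p.1)
    fun x y => by simp [outputProb, letterSet, Set.preimage, eq_comm]
  have hentropy₂ := hP.condEntropy_realizationLaw (f := Sum.inr ∘ e₂.symm) (Y := fun p => e₂ p.2)
    fun x y => by simp [outputProb, letterSet, Set.preimage, eq_comm]
  simp only [comap_viewSigma] at hentropy₁ hentropy₂
  rw [← profileEntropy_comp_equiv e₁.symm, ← profileEntropy_comp_equiv e₂.symm,
    ← funext₂ hentropy₁, ← funext₂ hentropy₂] at hE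
  have hfamily := family_realizationLaw (N := N) (a := a) (b := b)
  have hmeas := measurable_family (hF .t) (hF .u) (hF .v)
  obtain ⟨f, hf, hXf⟩ := ((measurable_realizedSigma_input (N := N) (a := a) (b := b)).mono
    (viewSigma_univ_both_le_comap _ _) le_rfl).exists_eq_measurable_comp
  refine ⟨_, inferInstance, realizationLaw κ eX e₁ e₂ P, inferInstance, _, _, _, _, _, _, _, _,
    hE.admissible hmeas (hW₁.comp measurable_fst) (hW₂.comp measurable_fst) hX hY₁ hY₂
      (map_realizationLaw_eq_compProd (g := fun z => (z.2.1 .t, z.2.1 .u, z.2.1 .v,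
        realizedW₁ z, realizedW₂ z)) ?_) (hfamily ▸ iIndepFun_realizationLaw),
    hE.rateBounds hmeas (hW₁.comp measurable_fst) (hW₂.comp measurable_fst) hY₁ hY₂ hR hRc,
    map_realizationLaw_label _, map_realizationLaw_label _, map_realizationLaw_label _,
    eX ∘ f, Measurable.of_discrete.comp hf, fun ω => congrArg eX (congrFun hXf ω.1)⟩
  fun_prop

end Channel

/-! ### Entropy on a finite weighted set -/

section FiniteEntropy

variable {Ω β : Type*}

lemma rel_iff_of_rel {r : Setoid Ω} {ω ω' : Ω} (h : r ω' ω) (x : Ω) : r x ω' ↔ r x ω :=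
  ⟨fun hx => r.trans hx h, fun hx => r.trans hx (r.symm h)⟩

variable [Fintype Ω] {w : Ω → ℝ} {r s : Setoid Ω}

open Classical in
/-- The weight of the `r`-class of `ω`. An observation on a finite set with weights `w` is encoded
as the equivalence relation of leading to the same outcome, so that `r ⊓ s` is the joint observation
of `r` and `s`. -/
def classMass (w : Ω → ℝ) (r : Setoid Ω) (ω : Ω) : ℝ :=
  ∑ ω' with r ω' ω, w ω'

/-- The entropy of the observation `r`. -/
def partitionEntropy (w : Ω → ℝ) (r : Setoid Ω) : ℝ :=
  ∑ ω, w ω * -Real.log (classMass w r ω)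

open Classical in
/-- The conditional probability of `E`, given the observation `r`, at the sample point `ω`. -/
def condProb (w : Ω → ℝ) (r : Setoid Ω) (E : Set Ω) (ω : Ω) : ℝ :=
  (∑ ω' with r ω' ω ∧ ω' ∈ E, w ω') / classMass w r ω

lemma classMass_congr {ω ω' : Ω} (h : r ω' ω) : classMass w r ω' = classMass w r ω := by
  classical
  rw [classMass, classMass, Finset.filter_congr fun x _ => rel_iff_of_rel h x]

lemma condProb_congr {E : Set Ω} {ω ω' : Ω} (h : r ω' ω) :
    condProb w r E ω' = condProb w r E ω := by
  classical
  rw [condProb, condProb, classMass_congr h,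
    Finset.filter_congr fun x _ => and_congr_left' (rel_iff_of_rel h x)]

lemma le_classMass (hw : ∀ ω, 0 ≤ w ω) (ω : Ω) : w ω ≤ classMass w r ω :=
  Finset.single_le_sum (f := w) (fun ω _ => hw ω) (by simp)

lemma classMass_pos (hw : ∀ ω, 0 ≤ w ω) {ω : Ω} (h : w ω ≠ 0) : 0 < classMass w r ω :=
  ((hw ω).lt_of_ne' h).trans_le (le_classMass hw ω)

lemma classMass_mono (hw : ∀ ω, 0 ≤ w ω) (h : r ≤ s) (ω : Ω) :
    classMass w r ω ≤ classMass w s ω := by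
  refine Finset.sum_le_sum_of_subset_of_nonneg (fun ω' h' => ?_) fun _ _ _ => hw _
  simp only [Finset.mem_filter, Finset.mem_univ, true_and] at h' ⊢
  exact h h'

lemma partitionEntropy_anti (hw : ∀ ω, 0 ≤ w ω) (h : r ≤ s) :
    partitionEntropy w s ≤ partitionEntropy w r := by
  refine Finset.sum_le_sum fun ω _ => ?_
  rcases eq_or_ne (w ω) 0 with hω | hω
  · simp [hω]
  · exact mul_le_mul_of_nonneg_left
      (neg_le_neg (Real.log_le_log (classMass_pos hw hω) (classMass_mono hw h ω))) (hw ω)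

lemma condProb_mem_unitInterval (hw : ∀ ω, 0 ≤ w ω) (E : Set Ω) (ω : Ω) :
    condProb w r E ω ∈ unitInterval := by
  have h0 : 0 ≤ classMass w r ω := (hw ω).trans (le_classMass hw ω)
  refine ⟨div_nonneg (Finset.sum_nonneg fun ω' _ => hw ω') h0, div_le_one_of_le₀ ?_ h0⟩
  refine Finset.sum_le_sum_of_subset_of_nonneg (fun ω' h => ?_) fun _ _ _ => hw _
  simp only [Finset.mem_filter, Finset.mem_univ, true_and] at h ⊢
  exact h.1

lemma condProb_pos (hw : ∀ ω, 0 ≤ w ω) {E : Set Ω} {ω : Ω} (h : w ω ≠ 0) (hE : ω ∈ E) :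
    0 < condProb w r E ω :=
  div_pos (((hw ω).lt_of_ne' h).trans_le
    (Finset.single_le_sum (f := w) (fun ω _ => hw ω) (by simp [hE]))) (classMass_pos hw h)

open Classical in
lemma sum_mul_eq_sum_mul_condProb (hw : ∀ ω, 0 ≤ w ω) (E : Set Ω) {G : Ω → ℝ}
    (hG : ∀ ω ω', r ω' ω → G ω' = G ω) :
    ∑ ω with ω ∈ E, w ω * G ω = ∑ ω, w ω * (condProb w r E ω * G ω) := by
  have hclass (ω' : Ω) : ∑ ω with r ω' ω, w ω = classMass w r ω' := by
    simp only [classMass, r.comm']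
  calc ∑ ω' with ω' ∈ E, w ω' * G ω'
    _ = ∑ ω' with ω' ∈ E, ∑ ω with r ω' ω, w ω * (w ω' * G ω' / classMass w r ω') := by
        refine Finset.sum_congr rfl fun ω' _ => ?_
        rw [← Finset.sum_mul, hclass]
        rcases eq_or_ne (w ω') 0 with hω | hω
        · simp [hω]
        · rw [mul_div_cancel₀ _ (classMass_pos hw hω).ne']
    _ = ∑ ω, ∑ ω' with r ω' ω ∧ ω' ∈ E, w ω * (w ω' * G ω' / classMass w r ω') :=
        Finset.sum_comm' fun ω' ω => by simp [and_comm]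
    _ = ∑ ω, w ω * (condProb w r E ω * G ω) := by
        refine Finset.sum_congr rfl fun ω _ => ?_
        rw [condProb, div_mul_eq_mul_div, Finset.sum_mul, Finset.sum_div, Finset.mul_sum]
        refine Finset.sum_congr rfl fun ω' h' => ?_
        have h : r ω' ω := (Finset.mem_filter.1 h').2.1
        rw [classMass_congr h, hG ω ω' h]

open Classical in
lemma sum_apply_eq_sum_condProb (hw : ∀ ω, 0 ≤ w ω) [Fintype β] (f : Ω → β) {G : Ω → β → ℝ}
    (hG : ∀ ω ω', r ω' ω → G ω' = G ω) :
    ∑ ω, w ω * G ω (f ω) = ∑ ω, w ω * ∑ b, condProb w r (f ⁻¹' {b}) ω * G ω b := by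
  simp only [Finset.mul_sum]
  rw [Finset.sum_comm, ← Finset.sum_fiberwise _ f]
  refine Finset.sum_congr rfl fun b _ => ?_
  rw [← sum_mul_eq_sum_mul_condProb hw (f ⁻¹' {b}) fun ω ω' h => congrFun (hG ω ω' h) b]
  refine Finset.sum_congr (by simp) fun ω h => ?_
  rw [show f ω = b by simpa using h]

lemma partitionEntropy_inf_ker_sub_eq_sum_log (hw : ∀ ω, 0 ≤ w ω) (f : Ω → β) :
    partitionEntropy w (r ⊓ Setoid.ker f) - partitionEntropy w r =
      ∑ ω, w ω * -Real.log (condProb w r (f ⁻¹' {f ω}) ω) := by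
  rw [partitionEntropy, partitionEntropy, ← Finset.sum_sub_distrib]
  refine Finset.sum_congr rfl fun ω _ => ?_
  rcases eq_or_ne (w ω) 0 with hω | hω
  · simp [hω]
  have hmass : condProb w r (f ⁻¹' {f ω}) ω =
      classMass w (r ⊓ Setoid.ker f) ω / classMass w r ω :=
    congrArg (· / classMass w r ω) (Finset.sum_congr
      (by ext; simp [Setoid.inf_iff_and, Setoid.ker_def]) fun _ _ => rfl)
  rw [hmass, Real.log_div (classMass_pos hw hω).ne' (classMass_pos hw hω).ne']
  ring

lemma partitionEntropy_inf_ker_sub (hw : ∀ ω, 0 ≤ w ω) [Fintype β] (f : Ω → β) :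
    partitionEntropy w (r ⊓ Setoid.ker f) - partitionEntropy w r =
      ∑ ω, w ω * ∑ b, Real.negMulLog (condProb w r (f ⁻¹' {b}) ω) := by
  rw [partitionEntropy_inf_ker_sub_eq_sum_log hw, sum_apply_eq_sum_condProb hw f
    (G := fun ω b => -Real.log (condProb w r (f ⁻¹' {b}) ω))
    fun ω ω' h => funext fun b => by rw [condProb_congr h]]
  simp only [Real.negMulLog, neg_mul, mul_neg]

/-- Gibbs' inequality: `-log q` is the length of a code for `f` known to an observer of `r`. -/
lemma partitionEntropy_inf_ker_sub_le (hw : ∀ ω, 0 ≤ w ω) [Fintype β] (f : Ω → β)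
    {q : Ω → β → ℝ} (hqr : ∀ ω ω', r ω' ω → q ω' = q ω) (hq : ∀ ω b, 0 < q ω b)
    (hq1 : ∀ ω, ∑ b, q ω b ≤ 1) :
    partitionEntropy w (r ⊓ Setoid.ker f) - partitionEntropy w r ≤
      ∑ ω, w ω * -Real.log (q ω (f ω)) := by
  let p (ω : Ω) (b : β) : ℝ := condProb w r (f ⁻¹' {b}) ω
  have hlog (ω : Ω) : w ω * -Real.log (p ω (f ω)) ≤
      w ω * -Real.log (q ω (f ω)) + (w ω * (q ω (f ω) / p ω (f ω)) - w ω) := by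
    rcases eq_or_ne (w ω) 0 with hω | hω
    · simp [hω]
    have hp : 0 < p ω (f ω) := condProb_pos hw hω rfl
    have := mul_le_mul_of_nonneg_left (Real.log_le_sub_one_of_pos (div_pos (hq ω (f ω)) hp)) (hw ω)
    rw [Real.log_div (hq ω (f ω)).ne' hp.ne'] at this
    linarith
  have hratio : ∑ ω, w ω * (q ω (f ω) / p ω (f ω)) ≤ ∑ ω, w ω := by
    rw [sum_apply_eq_sum_condProb (r := r) hw f (G := fun ω b => q ω b / p ω b)
      fun ω ω' h => funext fun b => by simp only [p, hqr ω ω' h, condProb_congr h]]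
    refine Finset.sum_le_sum fun ω _ => mul_le_of_le_one_right (hw ω) ((hq1 ω).trans' ?_)
    refine Finset.sum_le_sum fun b _ => ?_
    have := mul_div_mul_left_le (a := q ω b) (b := 1) (c := p ω b) (by simp [(hq ω b).le])
    simpa [mul_div_assoc] using this
  rw [partitionEntropy_inf_ker_sub_eq_sum_log hw]
  have := Finset.sum_le_sum fun ω (_ : ω ∈ Finset.univ) => hlog ω
  rw [Finset.sum_add_distrib, Finset.sum_sub_distrib] at this
  linarith

lemma partitionEntropy_top (hw1 : ∑ ω, w ω = 1) : partitionEntropy w ⊤ = 0 := by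
  simp [partitionEntropy, classMass, hw1]

lemma partitionEntropy_ker_le_log_card (hw : ∀ ω, 0 ≤ w ω) (hw1 : ∑ ω, w ω = 1)
    [Fintype β] [Nonempty β] (f : Ω → β) :
    partitionEntropy w (Setoid.ker f) ≤ Real.log (Fintype.card β) := by
  have hcard : (0 : ℝ) < Fintype.card β := Nat.cast_pos.2 Fintype.card_pos
  have h := partitionEntropy_inf_ker_sub_le (r := ⊤) hw f (q := fun _ _ => (Fintype.card β : ℝ)⁻¹)
    (fun _ _ _ => rfl) (fun _ _ => inv_pos.2 hcard) fun _ => by simp [hcard.ne']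
  rwa [top_inf_eq, partitionEntropy_top hw1, sub_zero, ← Finset.sum_mul, hw1, one_mul,
    Real.log_inv, neg_neg] at h

open Classical in
lemma partitionEntropy_inf_ker_sub_le_fano (hw : ∀ ω, 0 ≤ w ω) (hw1 : ∑ ω, w ω = 1)
    [Fintype β] [Nonempty β] (f : Ω → β) {d : Ω → β} (hd : r ≤ Setoid.ker d) :
    partitionEntropy w (r ⊓ Setoid.ker f) - partitionEntropy w r ≤
      Real.log 2 + (∑ ω with f ω ≠ d ω, w ω) * Real.log (Fintype.card β) := by
  let n : ℝ := Fintype.card β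
  have hn : 0 < n := Nat.cast_pos.2 Fintype.card_pos
  have hε : 0 < 1 / (2 * n) := by positivity
  -- Half of the mass is put on the estimate, the other half is spread uniformly.
  let q (ω : Ω) (b : β) : ℝ := (if b = d ω then 1 / 2 else 0) + 1 / (2 * n)
  have hq (ω : Ω) (b : β) : 0 < q ω b := add_pos_of_nonneg_of_pos (by split_ifs <;> norm_num) hε
  have hq1 (ω : Ω) : ∑ b, q ω b = 1 := by
    simp only [q, Finset.sum_add_distrib, Finset.sum_ite_eq', Finset.mem_univ, if_true,
      Finset.sum_const, Finset.card_univ, nsmul_eq_mul]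
    change 1 / 2 + n * (1 / (2 * n)) = 1
    field_simp
    norm_num
  have hlog (ω : Ω) :
      -Real.log (q ω (f ω)) ≤ Real.log 2 + if f ω ≠ d ω then Real.log n else 0 := by
    by_cases h : f ω = d ω
    · have : Real.log (1 / 2) ≤ Real.log (q ω (f ω)) :=
        Real.log_le_log (by norm_num) (by simp only [q, if_pos h]; linarith)
      rw [one_div, Real.log_inv] at this
      rw [if_neg (not_not.2 h)]
      linarith
    · simp only [q, if_neg h, if_pos h, zero_add, one_div]
      rw [Real.log_inv, neg_neg, Real.log_mul two_ne_zero hn.ne']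
  calc _ ≤ ∑ ω, w ω * -Real.log (q ω (f ω)) :=
        partitionEntropy_inf_ker_sub_le hw f
          (fun ω ω' h => by simp only [q, show d ω' = d ω from hd h]) hq fun ω => (hq1 ω).le
    _ ≤ ∑ ω, w ω * (Real.log 2 + if f ω ≠ d ω then Real.log n else 0) :=
        Finset.sum_le_sum fun ω _ => mul_le_mul_of_nonneg_left (hlog ω) (hw ω)
    _ = _ := by
        simp only [mul_add, Finset.sum_add_distrib, mul_ite, mul_zero, ← Finset.sum_mul, hw1,
          one_mul, ← Finset.sum_filter, n]

end FiniteEntropy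

section FiniteLaw

/-- The law of `f` on a finite set with weights `w`. -/
def finiteLaw {Ω E : Type*} [Fintype Ω] [MeasurableSpace E] (w : Ω → ℝ) (f : Ω → E) : Measure E :=
  ∑ ω, ENNReal.ofReal (w ω) • Measure.dirac (f ω)

variable {Ω E : Type*} [Fintype Ω] [MeasurableSpace E] {w : Ω → ℝ}

lemma integral_finiteLaw [MeasurableSingletonClass E] (hw : ∀ ω, 0 ≤ w ω) (f : Ω → E) (g : E → ℝ) :
    ∫ e, g e ∂finiteLaw w f = ∑ ω, w ω * g (f ω) := by
  rw [finiteLaw, integral_finsetSum_measure fun ω _ =>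
    (integrable_dirac (by simp)).smul_measure ENNReal.ofReal_ne_top]
  refine Finset.sum_congr rfl fun ω _ => ?_
  rw [integral_smul_measure, integral_dirac, ENNReal.toReal_ofReal (hw ω), smul_eq_mul]

lemma isProbabilityMeasure_finiteLaw (hw : ∀ ω, 0 ≤ w ω) (hw1 : ∑ ω, w ω = 1) (f : Ω → E) :
    IsProbabilityMeasure (finiteLaw w f) := by
  refine ⟨?_⟩
  simp only [finiteLaw, Measure.coe_finsetSum, Finset.sum_apply, Measure.smul_apply,
    measure_univ, smul_eq_mul, mul_one]
  rw [← ENNReal.ofReal_sum_of_nonneg fun ω _ => hw ω, hw1, ENNReal.ofReal_one]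

end FiniteLaw

/-! ### Random variables of a code -/

lemma sum_prod_mul_eq {ι B R : Type*} [Fintype ι] [DecidableEq ι] [Fintype B] [CommSemiring R]
    {q : ι → B → R} (i : ι) (hq : ∑ b, q i b = 1) (φ : B → R) {F : (ι → B) → R}
    (hF : ∀ y b, F (Function.update y i b) = F y) :
    ∑ y : ι → B, (∏ j, q j (y j)) * (φ (y i) * F y) =
      (∑ b, q i b * φ b) * ∑ y : ι → B, (∏ j, q j (y j)) * F y := by
  have hprod (y : ι → B) : ∏ j, q j (y j) = q i (y i) * ∏ j ∈ {i}ᶜ, q j (y j) :=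
    Fintype.prod_eq_mul_prod_compl i fun j => q j (y j)
  have hcompl (y : ι → B) (b : B) :
      ∏ j ∈ {i}ᶜ, q j (Function.update y i b j) = ∏ j ∈ {i}ᶜ, q j (y j) :=
    Finset.prod_congr rfl fun j hj => by rw [Function.update_of_ne (by simpa using hj)]
  -- The involution exchanges `y i` with an independent copy of it.
  let σ (p : (ι → B) × B) : (ι → B) × B := (Function.update p.1 i p.2, p.1 i)
  have hσ : Function.Involutive σ := fun p => by simp [σ]
  calc ∑ y : ι → B, (∏ j, q j (y j)) * (φ (y i) * F y)
    _ = ∑ p : (ι → B) × B, ((∏ j, q j (p.1 j)) * (φ (p.1 i) * F p.1)) * q i p.2 := by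
        simp only [Fintype.sum_prod_type, ← Finset.mul_sum, hq, mul_one]
    _ = ∑ p : (ι → B) × B, (q i p.2 * φ p.2) * ((∏ j, q j (p.1 j)) * F p.1) := by
        rw [← Equiv.sum_comp hσ.toPerm]
        refine Finset.sum_congr rfl fun p _ => ?_
        simp only [Function.Involutive.coe_toPerm, σ, hprod, hcompl, hF, Function.update_self]
        ring
    _ = (∑ b, q i b * φ b) * ∑ y : ι → B, (∏ j, q j (y j)) * F y := by
        rw [Fintype.sum_prod_type, Finset.sum_comm, Finset.sum_mul_sum]

/-- The sample space of the messages and the output blocks of a block code. -/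
abbrev CodeSpace (𝒴₁ 𝒴₂ : Type*) (n M₀ M₁ M₂ : ℕ) :=
  (Fin M₀ × Fin M₁ × Fin M₂) × (Fin n → 𝒴₁ × 𝒴₂)

/-- The sizes of the message sets, the messages `m₀`, `m₁`, `m₂` being named after the variables
`T`, `U`, `V` whose roles they play. -/
def messageCount (M₀ M₁ M₂ : ℕ) : Label → ℕ
  | .t => M₀
  | .u => M₁
  | .v => M₂

lemma prod_messageCount (M₀ M₁ M₂ : ℕ) :
    ∏ l, (messageCount M₀ M₁ M₂ l : ℝ) = (M₀ : ℝ) * M₁ * M₂ := by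
  rw [show (Finset.univ : Finset Label) = {.t, .u, .v} from rfl]
  simp [messageCount, mul_assoc]

/-- A triple of messages as a family indexed by their names. -/
def messages {M₀ M₁ M₂ : ℕ} :
    (Fin M₀ × Fin M₁ × Fin M₂) ≃ ∀ l, Fin (messageCount M₀ M₁ M₂ l) where
  toFun m
    | .t => m.1
    | .u => m.2.1
    | .v => m.2.2
  invFun f := (f .t, f .u, f .v)
  left_inv _ := rfl
  right_inv f := funext fun l => by cases l <;> rfl

section Revealed

variable {𝒴₁ 𝒴₂ β : Type*} {n M₀ M₁ M₂ p p' q q' : ℕ} {A A' B : Finset Label}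
  {ω ω' : CodeSpace 𝒴₁ 𝒴₂ n M₀ M₁ M₂}

/-- The observation of the messages in `A`, the letters of the first output before position `p` and
the letters of the second output from position `q` on, positions being counted from `0`. -/
def revealed (A : Finset Label) (p q : ℕ) : Setoid (CodeSpace 𝒴₁ 𝒴₂ n M₀ M₁ M₂) :=
  Setoid.ker fun ω => (fun l : A => messages ω.1 l,
    fun j : {j : Fin n // (j : ℕ) < p} => (ω.2 j).1, fun j : {j : Fin n // q ≤ j} => (ω.2 j).2)

lemma revealed_iff : revealed A p q ω' ω ↔ (∀ l ∈ A, messages ω'.1 l = messages ω.1 l) ∧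
    (∀ j : Fin n, (j : ℕ) < p → (ω'.2 j).1 = (ω.2 j).1) ∧
      ∀ j : Fin n, q ≤ j → (ω'.2 j).2 = (ω.2 j).2 := by
  rw [revealed, Setoid.ker_def]
  simp [funext_iff]

lemma revealed_anti (hA : A ⊆ A') (hp : p ≤ p') (hq : q' ≤ q) :
    (revealed A' p' q' : Setoid (CodeSpace 𝒴₁ 𝒴₂ n M₀ M₁ M₂)) ≤ revealed A p q := by
  intro ω' ω h
  obtain ⟨hm, h₁, h₂⟩ := revealed_iff.1 h
  exact revealed_iff.2 ⟨fun l hl => hm l (hA hl), fun j hj => h₁ j (hj.trans_le hp),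
    fun j hj => h₂ j (hq.trans hj)⟩

lemma revealed_inf_ker_fst {g : 𝒴₁ → β} (hg : Function.Injective g) (i : Fin n) :
    revealed A i q ⊓ Setoid.ker (fun ω : CodeSpace 𝒴₁ 𝒴₂ n M₀ M₁ M₂ => g (ω.2 i).1) =
      revealed A (i + 1) q := by
  ext ω' ω
  rw [Setoid.inf_def]
  simp only [Pi.inf_apply, inf_Prop_eq, revealed_iff, Setoid.ker_def, hg.eq_iff, Nat.lt_succ_iff,
    le_iff_lt_or_eq, or_imp, Fin.val_inj, forall_and, forall_eq]
  tauto

lemma revealed_inf_ker_snd {g : 𝒴₂ → β} (hg : Function.Injective g) (i : Fin n) :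
    revealed A p (i + 1) ⊓ Setoid.ker (fun ω : CodeSpace 𝒴₁ 𝒴₂ n M₀ M₁ M₂ => g (ω.2 i).2) =
      revealed A p i := by
  ext ω' ω
  rw [Setoid.inf_def]
  simp only [Pi.inf_apply, inf_Prop_eq, revealed_iff, Setoid.ker_def, hg.eq_iff, Nat.succ_le_iff,
    le_iff_lt_or_eq (a := (i : ℕ)), or_imp, Fin.val_inj, forall_and, forall_eq']
  tauto

lemma revealed_inf_ker_messages {f : CodeSpace 𝒴₁ 𝒴₂ n M₀ M₁ M₂ → β}
    (hf : ∀ ω ω', f ω' = f ω ↔ ∀ l ∈ B, messages ω'.1 l = messages ω.1 l) :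
    revealed A p q ⊓ Setoid.ker f = revealed (A ∪ B) p q := by
  ext ω' ω
  rw [Setoid.inf_def]
  simp only [Pi.inf_apply, inf_Prop_eq, revealed_iff, Setoid.ker_def, hf, Finset.mem_union,
    or_imp, forall_and]
  tauto

/-- The observation at time `i` which corresponds to the set `S` of auxiliary variables: `W₁` is the
past of the first output and `W₂` the future of the second. -/
def observed (S : Idx) (i : Fin n) : Setoid (CodeSpace 𝒴₁ 𝒴₂ n M₀ M₁ M₂) :=
  revealed S.1 (if S.2 = .two then 0 else i) (if S.2 = .one then n else i + 1)

lemma observed_le_of_visible {S S' : Idx} (h : Visible S (some S')) (i : Fin n) :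
    (observed S i : Setoid (CodeSpace 𝒴₁ 𝒴₂ n M₀ M₁ M₂)) ≤ observed S' i := by
  obtain ⟨A, s⟩ := S
  obtain ⟨A', s'⟩ := S'
  obtain ⟨hA, rfl | rfl⟩ := h
  · exact revealed_anti hA le_rfl le_rfl
  · refine revealed_anti hA ?_ ?_ <;> rcases s' with _ | _ | _ <;> simp

lemma observed_update (S : Idx) (i : Fin n) (m : Fin M₀ × Fin M₁ × Fin M₂)
    (y : Fin n → 𝒴₁ × 𝒴₂) (z : 𝒴₁ × 𝒴₂) :
    observed S i (m, Function.update y i z) (m, y) := by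
  refine revealed_iff.2 ⟨fun _ _ => rfl, fun j hj => ?_, fun j hj => ?_⟩ <;>
  · have hji : j ≠ i := by
      rintro rfl
      split_ifs at hj <;> omega
    simp only [Function.update_of_ne hji]

end Revealed

section CodeProfile

variable {𝒳 𝒴₁ 𝒴₂ : Type*} [MeasurableSpace 𝒳] [MeasurableSpace 𝒴₁] [MeasurableSpace 𝒴₂]
  {N a b n M₀ M₁ M₂ : ℕ} (κ : Kernel 𝒳 (𝒴₁ × 𝒴₂)) (C : Code 𝒳 𝒴₁ 𝒴₂ n M₀ M₁ M₂)

/-- The joint probability mass function of the messages and the output blocks. -/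
def Code.weight (ω : CodeSpace 𝒴₁ 𝒴₂ n M₀ M₁ M₂) : ℝ :=
  (∏ i, (κ (C.enc ω.1 i)).real {ω.2 i}) / ((M₀ : ℝ) * M₁ * M₂)

lemma Code.weight_nonneg (ω : CodeSpace 𝒴₁ 𝒴₂ n M₀ M₁ M₂) : 0 ≤ C.weight κ ω :=
  div_nonneg (Finset.prod_nonneg fun _ _ => measureReal_nonneg) (by positivity)

variable [Fintype 𝒴₁] [Fintype 𝒴₂]

section Markov

variable [MeasurableSingletonClass 𝒴₁] [MeasurableSingletonClass 𝒴₂] [IsMarkovKernel κ]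

lemma sum_measureReal_letter (x : 𝒳) : ∑ p, (κ x).real {p} = 1 := by
  simp [sum_measureReal_singleton]

lemma Code.sum_weight_fst (m : Fin M₀ × Fin M₁ × Fin M₂) :
    ∑ y, C.weight κ (m, y) = 1 / ((M₀ : ℝ) * M₁ * M₂) := by
  simp only [Code.weight]
  rw [← Finset.sum_div, ← Fintype.prod_sum fun i p => (κ (C.enc m i)).real {p}]
  simp only [sum_measureReal_letter, Finset.prod_const_one]

lemma Code.sum_weight [NeZero M₀] [NeZero M₁] [NeZero M₂] : ∑ ω, C.weight κ ω = 1 := by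
  rw [Fintype.sum_prod_type]
  simp only [C.sum_weight_fst κ, Finset.sum_const, Finset.card_univ, Fintype.card_prod,
    Fintype.card_fin, nsmul_eq_mul]
  have := NeZero.ne (M₀ : ℝ)
  have := NeZero.ne (M₁ : ℝ)
  have := NeZero.ne (M₂ : ℝ)
  push_cast
  field_simp

-- Given the messages, the letter at time `i` is independent of the letters at other times.
lemma Code.sum_weight_mul_measureReal (S : Idx) (i : Fin n) (D : Set (𝒴₁ × 𝒴₂))
    {G : CodeSpace 𝒴₁ 𝒴₂ n M₀ M₁ M₂ → ℝ} (hG : ∀ ω ω', observed S i ω' ω → G ω' = G ω) :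
    ∑ ω, C.weight κ ω * ((κ (C.enc ω.1 i)).real D * G ω) =
      ∑ ω, C.weight κ ω * (condProb (C.weight κ) (observed S i) {ω | ω.2 i ∈ D} ω * G ω) := by
  classical
  rw [← sum_mul_eq_sum_mul_condProb (C.weight_nonneg κ) {ω | ω.2 i ∈ D} hG, Finset.sum_filter]
  refine (Fintype.sum_prod_type _).trans
    ((Fintype.sum_congr _ _ fun m => ?_).trans (Fintype.sum_prod_type _).symm)
  have hD : ∑ p, (κ (C.enc m i)).real {p} * D.indicator 1 p = (κ (C.enc m i)).real D := by
    simp only [Set.indicator_apply, Pi.one_apply, mul_ite, mul_one, mul_zero]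
    rw [← Finset.sum_filter, sum_measureReal_singleton]
    simp
  have hindep := sum_prod_mul_eq (q := fun j p => (κ (C.enc m j)).real {p}) i
    (sum_measureReal_letter κ _) (D.indicator 1) (F := fun y => G (m, y))
    fun y p => hG _ _ (observed_update S i m y p)
  rw [hD] at hindep
  calc ∑ y, C.weight κ (m, y) * ((κ (C.enc m i)).real D * G (m, y))
    _ = ((κ (C.enc m i)).real D * ∑ y, (∏ j, (κ (C.enc m j)).real {y j}) * G (m, y)) /
          ((M₀ : ℝ) * M₁ * M₂) := by
        rw [Finset.mul_sum, Finset.sum_div]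
        exact Finset.sum_congr rfl fun y _ => by simp only [Code.weight]; ring
    _ = ∑ y, if (m, y) ∈ {ω : CodeSpace 𝒴₁ 𝒴₂ n M₀ M₁ M₂ | ω.2 i ∈ D} then
          C.weight κ (m, y) * G (m, y) else 0 := by
        rw [← hindep, Finset.sum_div]
        refine Finset.sum_congr rfl fun y _ => ?_
        by_cases hy : y i ∈ D <;> simp [hy, Code.weight, div_mul_eq_mul_div]

end Markov

variable (eX : Fin N ≃ 𝒳) (e₁ : Fin a ≃ 𝒴₁) (e₂ : Fin b ≃ 𝒴₂)

/-- The input at time `i` together with the conditional probabilities of the output letters at time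
`i`, given each of the observations. -/
def Code.profilePoint (z : Fin n × CodeSpace 𝒴₁ 𝒴₂ n M₀ M₁ M₂) : ProfileSpace N a b :=
  (eX.symm (C.enc z.2.1 z.1), fun S j => ⟨condProb (C.weight κ) (observed S z.1)
    {ω | ω.2 z.1 ∈ letterSet e₁ e₂ j} z.2, condProb_mem_unitInterval (C.weight_nonneg κ) _ _⟩)

/-- The law of `Code.profilePoint` at a uniformly distributed time. -/
def Code.profile : Measure (ProfileSpace N a b) :=
  finiteLaw (fun z : Fin n × CodeSpace 𝒴₁ 𝒴₂ n M₀ M₁ M₂ => C.weight κ z.2 / n)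
    (C.profilePoint κ eX e₁ e₂)

lemma Code.isProbabilityMeasure_profile [MeasurableSingletonClass 𝒴₁] [MeasurableSingletonClass 𝒴₂]
    [IsMarkovKernel κ] [NeZero n] [NeZero M₀] [NeZero M₁] [NeZero M₂] :
    IsProbabilityMeasure (C.profile κ eX e₁ e₂) := by
  refine isProbabilityMeasure_finiteLaw
    (fun z => div_nonneg (C.weight_nonneg κ _) (Nat.cast_nonneg n)) ?_ _
  calc ∑ z : Fin n × CodeSpace 𝒴₁ 𝒴₂ n M₀ M₁ M₂, C.weight κ z.2 / n
    _ = ∑ _ : Fin n, 1 / (n : ℝ) := by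
        rw [Fintype.sum_prod_type]
        exact Fintype.sum_congr _ _ fun _ => by rw [← Finset.sum_div, C.sum_weight κ]
    _ = 1 := by simp [NeZero.ne]

lemma Code.integral_profile (g : ProfileSpace N a b → ℝ) :
    ∫ k, g k ∂C.profile κ eX e₁ e₂ =
      (∑ i, ∑ ω, C.weight κ ω * g (C.profilePoint κ eX e₁ e₂ (i, ω))) / n := by
  rw [Code.profile, integral_finiteLaw
    (fun z => div_nonneg (C.weight_nonneg κ _) (Nat.cast_nonneg n)), Fintype.sum_prod_type]
  simp only [Finset.sum_div, div_mul_eq_mul_div]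

lemma Code.mask_profilePoint_congr [NeZero N] {S : Idx} {i : Fin n}
    {ω ω' : CodeSpace 𝒴₁ 𝒴₂ n M₀ M₁ M₂} (h : observed S i ω' ω) :
    mask S (C.profilePoint κ eX e₁ e₂ (i, ω')) = mask S (C.profilePoint κ eX e₁ e₂ (i, ω)) := by
  classical
  refine Prod.ext ?_ (funext fun S' => ?_) <;> simp only [mask, Code.profilePoint] <;>
    refine if_ctx_congr Iff.rfl (fun hS => ?_) fun _ => rfl
  · have hm : ω'.1 = ω.1 := messages.injective (funext fun l =>
      (revealed_iff.1 h).1 l (hS.1 (Finset.mem_univ l)))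
    rw [hm]
  · exact funext fun j => Subtype.ext (condProb_congr (observed_le_of_visible hS i h))

lemma Code.isProfile_profile [MeasurableSingletonClass 𝒴₁] [MeasurableSingletonClass 𝒴₂]
    [IsMarkovKernel κ] [NeZero N] :
    IsProfile (outputProb κ eX e₁ e₂) (C.profile κ eX e₁ e₂) := by
  intro S j g
  rw [C.integral_profile κ eX e₁ e₂ fun k => outputProb κ eX e₁ e₂ k.1 j * g (mask S k),
    C.integral_profile κ eX e₁ e₂ fun k => (k.2 S j : ℝ) * g (mask S k)]
  simp only [outputProb, Code.profilePoint, Equiv.apply_symm_apply]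
  refine congrArg (· / (n : ℝ)) (Finset.sum_congr rfl fun i _ => ?_)
  exact C.sum_weight_mul_measureReal κ S i _ fun ω ω' h =>
    congrArg g (C.mask_profilePoint_congr κ eX e₁ e₂ h)

lemma Code.profileEntropy_profile {ι : Type*} [Fintype ι] {f : ι → Fin a ⊕ Fin b}
    {g : 𝒴₁ × 𝒴₂ → ι} (hfg : ∀ y, letterSet e₁ e₂ (f y) = g ⁻¹' {y}) (A : Finset Label)
    (s : Side) :
    profileEntropy f (C.profile κ eX e₁ e₂) A s = (∑ i : Fin n,
      (partitionEntropy (C.weight κ) (observed (A, s) i ⊓ Setoid.ker fun ω => g (ω.2 i)) -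
        partitionEntropy (C.weight κ) (observed (A, s) i))) / n := by
  rw [profileEntropy, Code.integral_profile]
  refine congrArg (· / (n : ℝ)) (Finset.sum_congr rfl fun i _ => ?_)
  rw [partitionEntropy_inf_ker_sub (C.weight_nonneg κ)]
  simp only [Code.profilePoint, hfg]
  rfl

/-- The joint entropy of the messages in `A`, the letters of the first output before position `p`
and the letters of the second output from position `q` on. -/
def Code.entropy (A : Finset Label) (p q : ℕ) : ℝ :=
  partitionEntropy (C.weight κ) (revealed A p q)

lemma Code.profileEntropy_inl_one (A : Finset Label) :
    profileEntropy Sum.inl (C.profile κ eX e₁ e₂) A .one =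
      (C.entropy κ A n n - C.entropy κ A 0 n) / n := by
  rw [C.profileEntropy_profile κ eX e₁ e₂ (g := fun p => e₁.symm p.1) fun _ => rfl]
  simp only [observed, reduceCtorEq, if_false, if_true, revealed_inf_ker_fst e₁.symm.injective]
  exact congrArg (· / (n : ℝ)) ((Fin.sum_univ_eq_sum_range
    (fun i => C.entropy κ A (i + 1) n - C.entropy κ A i n) n).trans
      (Finset.sum_range_sub (C.entropy κ A · n) n))

lemma Code.profileEntropy_inr_two (A : Finset Label) :
    profileEntropy Sum.inr (C.profile κ eX e₁ e₂) A .two =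
      (C.entropy κ A 0 0 - C.entropy κ A 0 n) / n := by
  rw [C.profileEntropy_profile κ eX e₁ e₂ (g := fun p => e₂.symm p.2) fun _ => rfl]
  simp only [observed, reduceCtorEq, if_false, if_true, revealed_inf_ker_snd e₂.symm.injective]
  exact congrArg (· / (n : ℝ)) ((Fin.sum_univ_eq_sum_range
    (fun i => C.entropy κ A 0 i - C.entropy κ A 0 (i + 1)) n).trans (Finset.sum_range_sub' _ n))

-- Csiszár's sum identity: the sum of the differences telescopes along the hybrid blocks which
-- consist of the past of the first output and the future of the second.
lemma Code.profileEntropy_inl_both_sub_inr_both (A : Finset Label) :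
    profileEntropy Sum.inl (C.profile κ eX e₁ e₂) A .both -
        profileEntropy Sum.inr (C.profile κ eX e₁ e₂) A .both =
      (C.entropy κ A n n - C.entropy κ A 0 0) / n := by
  rw [C.profileEntropy_profile κ eX e₁ e₂ (g := fun p => e₁.symm p.1) fun _ => rfl,
    C.profileEntropy_profile κ eX e₁ e₂ (g := fun p => e₂.symm p.2) fun _ => rfl, ← sub_div,
    ← Finset.sum_sub_distrib]
  simp only [observed, reduceCtorEq, if_false, revealed_inf_ker_fst e₁.symm.injective,
    revealed_inf_ker_snd e₂.symm.injective, sub_sub_sub_cancel_right]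
  exact congrArg (· / (n : ℝ)) ((Fin.sum_univ_eq_sum_range
    (fun i => C.entropy κ A (i + 1) (i + 1) - C.entropy κ A i i) n).trans
      (Finset.sum_range_sub (fun i => C.entropy κ A i i) n))

end CodeProfile

/-! ### Entropies of a code -/

section CodeEntropy

variable {𝒳 𝒴₁ 𝒴₂ : Type*} {n M₀ M₁ M₂ : ℕ}

instance [NeZero M₀] [NeZero M₁] [NeZero M₂] (l : Label) : NeZero (messageCount M₀ M₁ M₂ l) := by
  cases l <;> assumption

lemma card_filter_messages_eq (A : Finset Label) (m : Fin M₀ × Fin M₁ × Fin M₂) :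
    (Finset.univ.filter fun m' : Fin M₀ × Fin M₁ × Fin M₂ =>
      ∀ l ∈ A, messages m' l = messages m l).card = ∏ l ∈ Aᶜ, messageCount M₀ M₁ M₂ l := by
  have hfilter : (Finset.univ.filter fun m' : Fin M₀ × Fin M₁ × Fin M₂ =>
      ∀ l ∈ A, messages m' l = messages m l).map messages.toEmbedding =
      Fintype.piFinset fun l => if l ∈ A then {messages m l} else Finset.univ := by
    ext f
    simp only [Finset.mem_map_equiv, Finset.mem_filter, Finset.mem_univ, true_and,
      Equiv.apply_symm_apply, Fintype.mem_piFinset]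
    refine forall_congr' fun l => ?_
    by_cases hl : l ∈ A <;> simp [hl]
  rw [← Finset.card_map, hfilter, Fintype.card_piFinset, ← Finset.prod_subset Aᶜ.subset_univ]
  · refine Finset.prod_congr rfl fun l hl => ?_
    rw [if_neg (Finset.mem_compl.1 hl), Finset.card_univ, Fintype.card_fin]
  · intro l _ hl
    rw [if_pos (by simpa using hl), Finset.card_singleton]

variable [MeasurableSpace 𝒳] [MeasurableSpace 𝒴₁] [MeasurableSpace 𝒴₂] [Fintype 𝒴₁] [Fintype 𝒴₂]
  (κ : Kernel 𝒳 (𝒴₁ × 𝒴₂)) (C : Code 𝒳 𝒴₁ 𝒴₂ n M₀ M₁ M₂)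

lemma Code.entropy_mono {A A' : Finset Label} {p p' q q' : ℕ} (hA : A ⊆ A') (hp : p ≤ p')
    (hq : q' ≤ q) : C.entropy κ A p q ≤ C.entropy κ A' p' q' :=
  partitionEntropy_anti (C.weight_nonneg κ) (revealed_anti hA hp hq)

lemma Code.entropy_union_sub_mem_Icc {A B B' : Finset Label} {p q : ℕ} {δ : ℝ}
    (hδ : C.entropy κ (A ∪ B') p q - C.entropy κ A p q ≤ δ) (hB : B ⊆ B') :
    C.entropy κ (A ∪ B) p q - C.entropy κ A p q ∈ Set.Icc 0 δ :=
  ⟨sub_nonneg.2 (C.entropy_mono κ Finset.subset_union_left le_rfl le_rfl),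
    (sub_le_sub_right (C.entropy_mono κ (Finset.union_subset_union_right hB) le_rfl le_rfl)
      _).trans hδ⟩

variable [MeasurableSingletonClass 𝒴₁] [MeasurableSingletonClass 𝒴₂]

open Classical in
lemma Code.sum_errorSet_weight [∀ x, IsFiniteMeasure (κ x)] :
    ∑ ω with ω.2 ∈ C.errorSet ω.1, C.weight κ ω = C.errorProb κ := by
  have hprod (m : Fin M₀ × Fin M₁ × Fin M₂) (y : Fin n → 𝒴₁ × 𝒴₂) :
      ∏ i, (κ (C.enc m i)).real {y i} = (Measure.pi fun i => κ (C.enc m i)).real {y} := by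
    simp only [measureReal_def, Measure.pi_singleton, ENNReal.toReal_prod]
  rw [Finset.sum_filter, Fintype.sum_prod_type, Code.errorProb, Finset.sum_div]
  refine Finset.sum_congr rfl fun m _ => ?_
  simp only [Code.weight, hprod]
  rw [← Finset.sum_filter, ← Finset.sum_div, sum_measureReal_singleton, Finset.coe_filter_univ]
  rfl

variable [IsMarkovKernel κ] [NeZero M₀] [NeZero M₁] [NeZero M₂]

lemma Code.classMass_revealed_messages (A : Finset Label) (ω : CodeSpace 𝒴₁ 𝒴₂ n M₀ M₁ M₂) :
    classMass (C.weight κ) (revealed A 0 n) ω =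
      (∏ l ∈ A, (messageCount M₀ M₁ M₂ l : ℝ))⁻¹ := by
  classical
  have hfilter : (Finset.univ.filter fun ω' : CodeSpace 𝒴₁ 𝒴₂ n M₀ M₁ M₂ =>
      revealed A 0 n ω' ω) = (Finset.univ.filter fun m' : Fin M₀ × Fin M₁ × Fin M₂ =>
        ∀ l ∈ A, messages m' l = messages ω.1 l) ×ˢ Finset.univ := by
    ext ω'
    simp [revealed_iff]
  rw [classMass, hfilter, Finset.sum_product]
  simp only [C.sum_weight_fst κ]
  rw [Finset.sum_const, card_filter_messages_eq, nsmul_eq_mul, Nat.cast_prod, mul_one_div,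
    ← prod_messageCount, ← Finset.prod_mul_prod_compl A]
  exact div_mul_cancel_right₀ (Finset.prod_ne_zero_iff.2 fun l _ => NeZero.ne _) _

lemma Code.entropy_messages (A : Finset Label) :
    C.entropy κ A 0 n = ∑ l ∈ A, Real.log (messageCount M₀ M₁ M₂ l) := by
  simp only [Code.entropy, partitionEntropy, C.classMass_revealed_messages κ]
  rw [← Finset.sum_mul, C.sum_weight κ, one_mul, Real.log_inv, neg_neg,
    Real.log_prod fun l _ => NeZero.ne _]

lemma Code.entropy_union_sub_le_of_decoder {A B : Finset Label} {p q : ℕ} {β : Type*} [Fintype β]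
    [Nonempty β] {f d : CodeSpace 𝒴₁ 𝒴₂ n M₀ M₁ M₂ → β}
    (hf : ∀ ω ω', f ω' = f ω ↔ ∀ l ∈ B, messages ω'.1 l = messages ω.1 l)
    (hd : revealed A p q ≤ Setoid.ker d) (hfd : ∀ ω, f ω ≠ d ω → ω.2 ∈ C.errorSet ω.1) :
    C.entropy κ (A ∪ B) p q - C.entropy κ A p q ≤
      Real.log 2 + C.errorProb κ * Real.log (Fintype.card β) := by
  classical
  have hfano := partitionEntropy_inf_ker_sub_le_fano (C.weight_nonneg κ) (C.sum_weight κ) f hd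
  rw [revealed_inf_ker_messages hf] at hfano
  refine hfano.trans ?_
  gcongr
  rw [← C.sum_errorSet_weight κ]
  refine Finset.sum_le_sum_of_subset_of_nonneg (fun ω hω => ?_) fun ω _ _ => C.weight_nonneg κ ω
  simp only [Finset.mem_filter, Finset.mem_univ, true_and] at hω ⊢
  exact hfd ω hω

lemma Code.entropy_union_sub_le_one (A : Finset Label) :
    C.entropy κ (A ∪ {.t, .u}) n n - C.entropy κ A n n ≤
      Real.log 2 + C.errorProb κ * (Real.log M₀ + Real.log M₁) := by
  have h := C.entropy_union_sub_le_of_decoder κ (A := A) (B := {.t, .u}) (p := n) (q := n)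
    (f := fun ω => (ω.1.1, ω.1.2.1)) (d := fun ω => C.dec₁ fun i => (ω.2 i).1)
    (fun ω ω' => by simp [messages]; rfl)
    (fun ω' ω h => congrArg C.dec₁ (funext fun i => (revealed_iff.1 h).2.1 i i.2))
    fun ω h => Or.inl h.symm
  rwa [Fintype.card_prod, Fintype.card_fin, Fintype.card_fin, Nat.cast_mul,
    Real.log_mul (NeZero.ne _) (NeZero.ne _)] at h

lemma Code.entropy_union_sub_le_two (A : Finset Label) :
    C.entropy κ (A ∪ {.t, .v}) 0 0 - C.entropy κ A 0 0 ≤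
      Real.log 2 + C.errorProb κ * (Real.log M₀ + Real.log M₂) := by
  have h := C.entropy_union_sub_le_of_decoder κ (A := A) (B := {.t, .v}) (p := 0) (q := 0)
    (f := fun ω => (ω.1.1, ω.1.2.2)) (d := fun ω => C.dec₂ fun i => (ω.2 i).2)
    (fun ω ω' => by simp [messages]; rfl)
    (fun ω' ω h => congrArg C.dec₂ (funext fun i => (revealed_iff.1 h).2.2 i (Nat.zero_le _)))
    fun ω h => Or.inr h.symm
  rwa [Fintype.card_prod, Fintype.card_fin, Fintype.card_fin, Nat.cast_mul,
    Real.log_mul (NeZero.ne _) (NeZero.ne _)] at h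

lemma Code.entropy_output_le_one [Nonempty 𝒴₁] :
    C.entropy κ ∅ n n ≤ n * Real.log (Fintype.card 𝒴₁) := by
  have hker : (revealed ∅ n n : Setoid (CodeSpace 𝒴₁ 𝒴₂ n M₀ M₁ M₂)) =
      Setoid.ker fun ω i => (ω.2 i).1 := by
    ext ω' ω
    simp [revealed_iff, Setoid.ker_def, funext_iff]
  rw [Code.entropy, hker]
  refine (partitionEntropy_ker_le_log_card (C.weight_nonneg κ) (C.sum_weight κ) _).trans_eq ?_
  simp

lemma Code.entropy_output_le_two [Nonempty 𝒴₂] :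
    C.entropy κ ∅ 0 0 ≤ n * Real.log (Fintype.card 𝒴₂) := by
  have hker : (revealed ∅ 0 0 : Setoid (CodeSpace 𝒴₁ 𝒴₂ n M₀ M₁ M₂)) =
      Setoid.ker fun ω i => (ω.2 i).2 := by
    ext ω' ω
    simp [revealed_iff, Setoid.ker_def, funext_iff]
  rw [Code.entropy, hker]
  refine (partitionEntropy_ker_le_log_card (C.weight_nonneg κ) (C.sum_weight κ) _).trans_eq ?_
  simp

omit [Fintype 𝒴₂] in
lemma Code.log_add_log_le_one [Finite 𝒴₂] [Nonempty 𝒴₁] (hε : C.errorProb κ ≤ 1 / 2) :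
    Real.log M₀ + Real.log M₁ ≤ 2 * (n * Real.log (Fintype.card 𝒴₁) + Real.log 2) := by
  have := Fintype.ofFinite 𝒴₂
  have hfano := C.entropy_union_sub_le_one κ ∅
  have hout := C.entropy_output_le_one κ
  have hmono := C.entropy_mono κ (Finset.empty_union ({.t, .u} : Finset Label)).ge (Nat.zero_le n)
    (le_refl n)
  rw [C.entropy_messages κ, Finset.sum_pair (by decide)] at hmono
  simp only [messageCount] at hmono
  have hε' := mul_le_mul_of_nonneg_right hε
    (add_nonneg (Real.log_natCast_nonneg M₀) (Real.log_natCast_nonneg M₁))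
  linarith

omit [Fintype 𝒴₁] in
lemma Code.log_add_log_le_two [Finite 𝒴₁] [Nonempty 𝒴₂] (hε : C.errorProb κ ≤ 1 / 2) :
    Real.log M₀ + Real.log M₂ ≤ 2 * (n * Real.log (Fintype.card 𝒴₂) + Real.log 2) := by
  have := Fintype.ofFinite 𝒴₁
  have hfano := C.entropy_union_sub_le_two κ ∅
  have hout := C.entropy_output_le_two κ
  have hmono := C.entropy_mono κ (Finset.empty_union ({.t, .v} : Finset Label)).ge (le_refl 0)
    (Nat.zero_le n)
  rw [C.entropy_messages κ, Finset.sum_pair (by decide)] at hmono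
  simp only [messageCount] at hmono
  have hε' := mul_le_mul_of_nonneg_right hε
    (add_nonneg (Real.log_natCast_nonneg M₀) (Real.log_natCast_nonneg M₂))
  linarith

lemma Code.hasIncrement_entropy_div [NeZero n] {B : Finset Label} {l : Label} {p q : ℕ} {δ : ℝ}
    (hδ : ∀ A, C.entropy κ (A ∪ B) p q - C.entropy κ A p q ≤ n * δ) (hl : l ∈ B) :
    HasIncrement (fun A => (C.entropy κ A p q - C.entropy κ A 0 n) / n) l
      (Real.log (messageCount M₀ M₁ M₂ l) / n) δ := by
  intro A hlA
  have hn : (0 : ℝ) < n := Nat.cast_pos.2 (Nat.pos_of_neZero n)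
  obtain ⟨h0, h1⟩ := C.entropy_union_sub_mem_Icc κ (hδ A) (Finset.singleton_subset_iff.2 hl)
  rw [Finset.union_comm, ← Finset.insert_eq] at h0 h1
  beta_reduce
  rw [C.entropy_messages κ, C.entropy_messages κ, Finset.sum_insert hlA, ← sub_div, ← sub_div,
    abs_div, Nat.abs_cast, div_le_iff₀' hn]
  exact abs_le.2 ⟨by linarith, by linarith⟩

variable {N a b : ℕ} [NeZero n] (eX : Fin N ≃ 𝒳) (e₁ : Fin a ≃ 𝒴₁) (e₂ : Fin b ≃ 𝒴₂)

lemma Code.entropyEquations_profile {δ : ℝ}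
    (hδ₁ : ∀ A, C.entropy κ (A ∪ {.t, .u}) n n - C.entropy κ A n n ≤ n * δ)
    (hδ₂ : ∀ A, C.entropy κ (A ∪ {.t, .v}) 0 0 - C.entropy κ A 0 0 ≤ n * δ) :
    EntropyEquations (profileEntropy Sum.inl (C.profile κ eX e₁ e₂))
      (profileEntropy Sum.inr (C.profile κ eX e₁ e₂)) (Real.log M₀ / n) (Real.log M₁ / n)
      (Real.log M₂ / n) (2 * δ) := by
  have hn : (0 : ℝ) < n := Nat.cast_pos.2 (Nat.pos_of_neZero n)
  have hδ : 0 ≤ n * δ := by simpa using hδ₁ {.t, .u}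
  have hδ2 : δ ≤ 2 * δ := by linarith [nonneg_of_mul_nonneg_right hδ hn]
  have hone {l : Label} (hl : l ∈ ({.t, .u} : Finset Label)) :=
    (C.hasIncrement_entropy_div κ hδ₁ hl).mono hδ2
  have htwo {l : Label} (hl : l ∈ ({.t, .v} : Finset Label)) :=
    (C.hasIncrement_entropy_div κ hδ₂ hl).mono hδ2
  simp only [← C.profileEntropy_inl_one κ eX e₁ e₂] at hone
  simp only [← C.profileEntropy_inr_two κ eX e₁ e₂] at htwo
  refine ⟨hone (by simp), htwo (by simp), hone (by simp), htwo (by simp), fun A => ?_,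
    fun A B₁ B₂ hB₁ hB₂ => ?_⟩
  · rw [sub_eq_sub_iff_sub_eq_sub, C.profileEntropy_inl_one, C.profileEntropy_inr_two,
      C.profileEntropy_inl_both_sub_inr_both]
    ring
  · have h₁ := C.entropy_union_sub_mem_Icc κ (hδ₁ (A ∪ B₂)) hB₁
    have h₁' := C.entropy_union_sub_mem_Icc κ (hδ₁ A) hB₁
    have h₂ := C.entropy_union_sub_mem_Icc κ (hδ₂ (A ∪ B₁)) hB₂
    have h₂' := C.entropy_union_sub_mem_Icc κ (hδ₂ A) hB₂
    rw [Finset.union_right_comm] at h₂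
    have hsides := fun A => C.profileEntropy_inl_both_sub_inr_both κ eX e₁ e₂ A
    calc _ = |((C.entropy κ (A ∪ B₂) n n - C.entropy κ (A ∪ B₂) 0 0) / n -
            (C.entropy κ (A ∪ B₂ ∪ B₁) n n - C.entropy κ (A ∪ B₂ ∪ B₁) 0 0) / n -
            (C.entropy κ A n n - C.entropy κ A 0 0) / n +
            (C.entropy κ (A ∪ B₁) n n - C.entropy κ (A ∪ B₁) 0 0) / n)| := by
          simp only [← hsides]
          congr 1
          ring
      _ ≤ 2 * δ := by
          rw [← sub_div, ← sub_div, ← add_div, abs_div, Nat.abs_cast, div_le_iff₀' hn]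
          exact abs_le.2 ⟨by linarith [h₁.1, h₁.2, h₁'.1, h₁'.2, h₂.1, h₂.2, h₂'.1, h₂'.2],
            by linarith [h₁.1, h₁.2, h₁'.1, h₁'.2, h₂.1, h₂.2, h₂'.1, h₂'.2]⟩

end CodeEntropy

/-! ### Passage to the limit -/

section Limit

lemma le_log_div {n M : ℕ} [NeZero n] {r : ℝ} (h : Real.exp (n * r) ≤ M) : r ≤ Real.log M / n := by
  rw [le_div_iff₀' (Nat.cast_pos.2 (Nat.pos_of_neZero n))]
  exact (Real.le_log_iff_exp_le ((Real.exp_pos _).trans_le h)).2 h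

lemma neZero_of_exp_le {M : ℕ} {r : ℝ} (h : Real.exp r ≤ M) : NeZero M :=
  ⟨(Nat.cast_pos.1 ((Real.exp_pos r).trans_le h)).ne'⟩

section Fano

variable {𝒳 𝒴₁ 𝒴₂ : Type*} [MeasurableSpace 𝒳]
  [Fintype 𝒴₁] [Nonempty 𝒴₁] [MeasurableSpace 𝒴₁] [MeasurableSingletonClass 𝒴₁]
  [Fintype 𝒴₂] [Nonempty 𝒴₂] [MeasurableSpace 𝒴₂] [MeasurableSingletonClass 𝒴₂]

lemma fano_le_mul {n : ℕ} {p x L η : ℝ} (hη : 0 < η) (hL : 0 ≤ L) (hp : 0 ≤ p)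
    (hxL : x ≤ 2 * (n * L + Real.log 2)) (hpη : p ≤ η / (4 * (L + Real.log 2)))
    (hn : 2 * Real.log 2 / η ≤ n) (hn1 : 1 ≤ n) : Real.log 2 + p * x ≤ n * η := by
  have hlog2 : 0 < Real.log 2 := Real.log_pos one_lt_two
  have hxn : x ≤ 2 * n * (L + Real.log 2) := by
    have : Real.log 2 ≤ n * Real.log 2 := le_mul_of_one_le_left hlog2.le (Nat.one_le_cast.2 hn1)
    linarith
  have hpL : p * (4 * (L + Real.log 2)) ≤ η := (le_div_iff₀ (by positivity)).1 hpη
  have hpx : p * x ≤ n * η / 2 :=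
    calc p * x ≤ p * (2 * n * (L + Real.log 2)) := by gcongr
      _ = n * (p * (4 * (L + Real.log 2))) / 2 := by ring
      _ ≤ n * η / 2 := by gcongr
  have hlogn : 2 * Real.log 2 ≤ n * η := (div_le_iff₀ hη).1 hn
  linarith

lemma Achievable.exists_code_entropy_union_sub_le {κ : Kernel 𝒳 (𝒴₁ × 𝒴₂)} [IsMarkovKernel κ]
    {R : ℝ × ℝ × ℝ} (hR : Achievable κ R) {η : ℝ} (hη : 0 < η) :
    ∃ (n M₀ M₁ M₂ : ℕ) (_ : NeZero n) (_ : NeZero M₀) (_ : NeZero M₁) (_ : NeZero M₂)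
      (C : Code 𝒳 𝒴₁ 𝒴₂ n M₀ M₁ M₂),
      R ≤ (Real.log M₀ / n, Real.log M₁ / n, Real.log M₂ / n) ∧
      (∀ A, C.entropy κ (A ∪ {.t, .u}) n n - C.entropy κ A n n ≤ n * η) ∧
      ∀ A, C.entropy κ (A ∪ {.t, .v}) 0 0 - C.entropy κ A 0 0 ≤ n * η := by
  set L₁ := Real.log (Fintype.card 𝒴₁)
  set L₂ := Real.log (Fintype.card 𝒴₂)
  have hL₁ : 0 ≤ L₁ := Real.log_natCast_nonneg _
  have hL₂ : 0 ≤ L₂ := Real.log_natCast_nonneg _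
  obtain ⟨n₀, hn₀⟩ := hR.2.2.2
    (1 / 2 ⊓ (η / (4 * (L₁ + Real.log 2)) ⊓ η / (4 * (L₂ + Real.log 2)))) (by positivity)
  obtain ⟨n₁, hn₁⟩ := exists_nat_ge (2 * Real.log 2 / η)
  set n := n₀ ⊔ (n₁ ⊔ 1)
  have hn1 : 1 ≤ n := le_sup_right.trans le_sup_right
  have hnη : 2 * Real.log 2 / η ≤ n :=
    hn₁.trans (Nat.cast_le.2 (le_sup_left.trans le_sup_right))
  obtain ⟨M₀, M₁, M₂, C, hM₀, hM₁, hM₂, hC⟩ := hn₀ n le_sup_left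
  obtain ⟨hC2, hC₁, hC₂⟩ := le_inf_iff.1 hC |>.imp_right le_inf_iff.1
  have hC0 : 0 ≤ C.errorProb κ := by unfold Code.errorProb; positivity
  have : NeZero n := ⟨Nat.one_le_iff_ne_zero.1 hn1⟩
  have : NeZero M₀ := neZero_of_exp_le hM₀
  have : NeZero M₁ := neZero_of_exp_le hM₁
  have : NeZero M₂ := neZero_of_exp_le hM₂
  refine ⟨n, M₀, M₁, M₂, ‹_›, ‹_›, ‹_›, ‹_›, C, ⟨le_log_div hM₀, le_log_div hM₁, le_log_div hM₂⟩,
    fun A => (C.entropy_union_sub_le_one κ A).trans ?_,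
    fun A => (C.entropy_union_sub_le_two κ A).trans ?_⟩
  · exact fano_le_mul hη hL₁ hC0 (C.log_add_log_le_one κ hC2) hC₁ hnη hn1
  · exact fano_le_mul hη hL₂ hC0 (C.log_add_log_le_two κ hC2) hC₂ hnη hn1

omit [Fintype 𝒴₁] [Fintype 𝒴₂] in
lemma Achievable.exists_profile {κ : Kernel 𝒳 (𝒴₁ × 𝒴₂)} [IsMarkovKernel κ] {N a b : ℕ} [NeZero N]
    (eX : Fin N ≃ 𝒳) (e₁ : Fin a ≃ 𝒴₁) (e₂ : Fin b ≃ 𝒴₂) {R : ℝ × ℝ × ℝ} (hR : Achievable κ R)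
    {η : ℝ} (hη : 0 < η) :
    ∃ (P : ProbabilityMeasure (ProfileSpace N a b)) (c₀ c₁ c₂ : ℝ),
      IsProfile (outputProb κ eX e₁ e₂) (P : Measure (ProfileSpace N a b)) ∧
      EntropyEquations (profileEntropy Sum.inl (P : Measure (ProfileSpace N a b)))
        (profileEntropy Sum.inr (P : Measure (ProfileSpace N a b))) c₀ c₁ c₂ (2 * η) ∧
      R ≤ (c₀, c₁, c₂) := by
  have := Fintype.ofEquiv _ e₁
  have := Fintype.ofEquiv _ e₂
  obtain ⟨n, M₀, M₁, M₂, _, _, _, _, C, hRC, hδ₁, hδ₂⟩ := hR.exists_code_entropy_union_sub_le hη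
  exact ⟨⟨C.profile κ eX e₁ e₂, C.isProbabilityMeasure_profile κ eX e₁ e₂⟩, _, _, _,
    C.isProfile_profile κ eX e₁ e₂, C.entropyEquations_profile κ eX e₁ e₂ hδ₁ hδ₂, hRC⟩

end Fano

section Compactness

open Filter Topology

variable {ι : Type*} {l : Filter ι}

lemma tendsto_of_abs_sub_le {f c η : ι → ℝ} {F : ℝ} (hf : Tendsto f l (𝓝 F))
    (h : ∀ i, |f i - c i| ≤ η i) (hη : Tendsto η l (𝓝 0)) : Tendsto c l (𝓝 F) := by
  have hfc : Tendsto (fun i => f i - c i) l (𝓝 0) := squeeze_zero_norm h hη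
  simpa using hf.sub hfc

lemma HasIncrement.tendsto {h : ι → Finset Label → ℝ} {g : Finset Label → ℝ} {j : Label}
    {c η : ι → ℝ} (hg : ∀ A, Tendsto (fun i => h i A) l (𝓝 (g A)))
    (hinc : ∀ i, HasIncrement (h i) j (c i) (η i)) (hη : Tendsto η l (𝓝 0)) {A : Finset Label}
    (hA : j ∉ A) : Tendsto c l (𝓝 (g A - g (insert j A))) :=
  tendsto_of_abs_sub_le ((hg A).sub (hg (insert j A))) (fun i => hinc i A hA) hη

lemma HasIncrement.of_tendsto [l.NeBot] {h : ι → Finset Label → ℝ} {g : Finset Label → ℝ}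
    {j : Label} {c η : ι → ℝ} {d : ℝ} (hg : ∀ A, Tendsto (fun i => h i A) l (𝓝 (g A)))
    (hinc : ∀ i, HasIncrement (h i) j (c i) (η i)) (hη : Tendsto η l (𝓝 0))
    (hc : Tendsto c l (𝓝 d)) : HasIncrement g j d 0 := fun A hA => by
  rw [tendsto_nhds_unique (HasIncrement.tendsto hg hinc hη hA) hc, sub_self, abs_zero]

lemma EntropyEquations.of_tendsto [l.NeBot] {H₁ H₂ : ι → Finset Label → Side → ℝ}
    {G₁ G₂ : Finset Label → Side → ℝ} {c₀ c₁ c₂ η : ι → ℝ}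
    (hH₁ : ∀ A s, Tendsto (fun i => H₁ i A s) l (𝓝 (G₁ A s)))
    (hH₂ : ∀ A s, Tendsto (fun i => H₂ i A s) l (𝓝 (G₂ A s)))
    (hη : Tendsto η l (𝓝 0))
    (h : ∀ i, EntropyEquations (H₁ i) (H₂ i) (c₀ i) (c₁ i) (c₂ i) (η i)) :
    ∃ d₀ d₁ d₂, Tendsto (fun i => (c₀ i, c₁ i, c₂ i)) l (𝓝 (d₀, d₁, d₂)) ∧
      EntropyEquations G₁ G₂ d₀ d₁ d₂ 0 := by
  have hone A := hH₁ A .one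
  have htwo A := hH₂ A .two
  have hc₀ := HasIncrement.tendsto hone (fun i => (h i).t_one) hη (Finset.notMem_empty _)
  have hc₁ := HasIncrement.tendsto hone (fun i => (h i).u_one) hη (Finset.notMem_empty _)
  have hc₂ := HasIncrement.tendsto htwo (fun i => (h i).v_two) hη (Finset.notMem_empty _)
  refine ⟨_, _, _, hc₀.prodMk_nhds (hc₁.prodMk_nhds hc₂),
    .of_tendsto hone (fun i => (h i).t_one) hη hc₀, .of_tendsto htwo (fun i => (h i).t_two) hη hc₀,
    .of_tendsto hone (fun i => (h i).u_one) hη hc₁, .of_tendsto htwo (fun i => (h i).v_two) hη hc₂,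
    fun A => tendsto_nhds_unique ((hH₁ A .one).sub (hH₁ A .both))
      (((hH₂ A .two).sub (hH₂ A .both)).congr fun i => ((h i).sides A).symm),
    fun A B₁ B₂ hB₁ hB₂ => ?_⟩
  refine le_of_tendsto_of_tendsto' (Tendsto.abs ?_) hη fun i => (h i).sub_sub A B₁ B₂ hB₁ hB₂
  exact (((hH₁ (A ∪ B₂) .both).sub (hH₁ (A ∪ B₂ ∪ B₁) .both)).add
    ((hH₂ A .both).sub (hH₂ (A ∪ B₁) .both))).sub
    (((hH₂ (A ∪ B₂) .both).sub (hH₂ (A ∪ B₂ ∪ B₁) .both)).add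
      ((hH₁ A .both).sub (hH₁ (A ∪ B₁) .both)))

lemma tendsto_integral_of_continuous {E : Type*} [TopologicalSpace E] [CompactSpace E]
    [MeasurableSpace E] [OpensMeasurableSpace E] {P : ι → ProbabilityMeasure E}
    {Q : ProbabilityMeasure E} (hP : Tendsto P l (𝓝 Q)) {g : E → ℝ} (hg : Continuous g) :
    Tendsto (fun i => ∫ e, g e ∂(P i : Measure E)) l (𝓝 (∫ e, g e ∂(Q : Measure E))) :=
  ProbabilityMeasure.tendsto_iff_forall_integral_tendsto.1 hP
    (BoundedContinuousFunction.mkOfCompact ⟨g, hg⟩)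

variable {N a b : ℕ} {P : ι → ProbabilityMeasure (ProfileSpace N a b)}
  {Q : ProbabilityMeasure (ProfileSpace N a b)}

lemma tendsto_profileEntropy (hP : Tendsto P l (𝓝 Q)) {α : Type*} [Fintype α]
    (f : α → Fin a ⊕ Fin b) (A : Finset Label) (s : Side) :
    Tendsto (fun i => profileEntropy f (P i : Measure (ProfileSpace N a b)) A s) l
      (𝓝 (profileEntropy f (Q : Measure (ProfileSpace N a b)) A s)) :=
  tendsto_integral_of_continuous hP (continuous_finsetSum Finset.univ fun _ _ =>
    Real.continuous_negMulLog.comp (by fun_prop))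

lemma isProfile_of_tendsto [NeZero N] [l.NeBot] {q : Fin N → Fin a ⊕ Fin b → ℝ}
    (hP : Tendsto P l (𝓝 Q)) (h : ∀ i, IsProfile q (P i : Measure (ProfileSpace N a b))) :
    IsProfile q (Q : Measure (ProfileSpace N a b)) := by
  intro S j g
  have hgm : Continuous fun k : ProfileSpace N a b => g (mask S k) :=
    g.continuous.comp (continuous_mask S)
  have hq : Continuous fun k : ProfileSpace N a b => q k.1 j :=
    (continuous_of_discreteTopology (f := fun x => q x j)).comp continuous_fst
  have hk : Continuous fun k : ProfileSpace N a b => (k.2 S j : ℝ) := by fun_prop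
  exact tendsto_nhds_unique (tendsto_integral_of_continuous hP (hq.mul hgm))
    ((tendsto_integral_of_continuous hP (hk.mul hgm)).congr fun i => (h i S j g).symm)

end Compactness

variable {𝒳 𝒴₁ 𝒴₂ : Type*} [MeasurableSpace 𝒳]
  [Fintype 𝒴₁] [Nonempty 𝒴₁] [MeasurableSpace 𝒴₁] [MeasurableSingletonClass 𝒴₁]
  [Fintype 𝒴₂] [Nonempty 𝒴₂] [MeasurableSpace 𝒴₂] [MeasurableSingletonClass 𝒴₂]
  (κ : Kernel 𝒳 (𝒴₁ × 𝒴₂))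

lemma restrictedOuterRegion_subset_outerRegion : restrictedOuterRegion κ ⊆ outerRegion κ :=
  fun _ ⟨Ω, mΩ, μ, hμ, T, U, V, W₁, W₂, X, Y₁, Y₂, hA, hR, _⟩ =>
    ⟨Ω, mΩ, μ, hμ, T, U, V, W₁, W₂, X, Y₁, Y₂, hA, hR⟩

open Filter Topology in
lemma capacityRegion_subset_restrictedOuterRegion [Finite 𝒳] [Nonempty 𝒳] [IsMarkovKernel κ] :
    capacityRegion κ ⊆ restrictedOuterRegion κ := by
  intro R hR
  have : NeZero (Nat.card 𝒳) := ⟨Finite.card_pos.ne'⟩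
  obtain ⟨r, hr, hrR⟩ := mem_closure_iff_seq_limit.1 hR
  choose P c₀ c₁ c₂ hprofile happrox hrc using fun k : ℕ =>
    Achievable.exists_profile (Finite.equivFin 𝒳).symm (Fintype.equivFin 𝒴₁).symm
      (Fintype.equivFin 𝒴₂).symm (hr k) (Nat.one_div_pos_of_nat (n := k))
  have hatTop : (hyperfilter ℕ : Filter ℕ) ≤ atTop := Nat.hyperfilter_le_atTop
  obtain ⟨Q, hQ⟩ : ∃ Q, Tendsto P (hyperfilter ℕ) (𝓝 Q) :=
    ⟨_, ((hyperfilter ℕ).map P).le_nhds_lim⟩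
  have hη : Tendsto (fun k : ℕ => 2 * (1 / ((k : ℝ) + 1))) (hyperfilter ℕ) (𝓝 0) := by
    simpa using (tendsto_one_div_add_atTop_nhds_zero_nat.mono_left hatTop).const_mul (2 : ℝ)
  obtain ⟨d₀, d₁, d₂, hc, hE⟩ := EntropyEquations.of_tendsto (tendsto_profileEntropy hQ Sum.inl)
    (tendsto_profileEntropy hQ Sum.inr) hη happrox
  have hrR' := hrR.mono_left hatTop
  exact mem_restrictedOuterRegion_of_isProfile κ _ _ _ _ (isProfile_of_tendsto hQ hprofile) hE
    (ge_of_tendsto' hrR' fun k => ⟨(hr k).1, (hr k).2.1, (hr k).2.2.1⟩)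
    (le_of_tendsto_of_tendsto' hrR' hc hrc)

end Limit

end

end BroadcastOuter

theorem lemma2 {𝒳 𝒴₁ 𝒴₂ : Type*}
    [Fintype 𝒳] [Nonempty 𝒳] [MeasurableSpace 𝒳] [MeasurableSingletonClass 𝒳]
    [Fintype 𝒴₁] [Nonempty 𝒴₁] [MeasurableSpace 𝒴₁] [MeasurableSingletonClass 𝒴₁]
    [Fintype 𝒴₂] [Nonempty 𝒴₂] [MeasurableSpace 𝒴₂] [MeasurableSingletonClass 𝒴₂]
    (κ : ProbabilityTheory.Kernel 𝒳 (𝒴₁ × 𝒴₂)) [ProbabilityTheory.IsMarkovKernel κ] :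
    BroadcastOuter.capacityRegion κ ⊆ BroadcastOuter.outerRegion κ ∧
      BroadcastOuter.capacityRegion κ ⊆ BroadcastOuter.restrictedOuterRegion κ := by
  have h := BroadcastOuter.capacityRegion_subset_restrictedOuterRegion κ
  exact ⟨h.trans (BroadcastOuter.restrictedOuterRegion_subset_outerRegion κ), h⟩
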